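/- **Setting.** Let $\mathfrak H$ be a separable complex Hilbert space, $\mathfrak H_n=\mathfrak H^{\otimes n}$ ($\mathfrak H_0=\mathbf C$). For a permutation $\pi$ of $\{1,\dots,n\}$ let $U_\pi$ be the unitary of $\mathfrak H_n$ moving the content of slot $i$ to slot $\pi(i)$; for a transposition $(k\,s)$ write $\sigma_{k,s}$. For each $n$ let $\mathfrak A_n\subset\mathcal B(\mathfrak H_n)$ be a $*$-algebra (possibly without unit; $\mathfrak A_0=\mathbf C$, $\mathfrak A:=\mathfrak A_1$), stable under $A\mapsto|A|$ and $A\mapsto U_\pi AU_\pi^*$, with $\mathfrak A_j\otimes\mathfrak A_k\subset\mathfrak A_{j+k}$, and let $\ell:\mathfrak A_n\to\mathbf C$ be positive linear functionals ($\ell=\mathrm{id}$ for $n=0$) such that $\|A\|_1:=\ell(|A|)$ is a norm, $|\ell(A)|\le\ell(|A|)$, $\ell(A\otimes B)=\ell(A)\ell(B)$, $\|U_\pi AU_\pi^*\|_1=\|A\|_1$, and the algebraic tensor power of $\mathfrak A$ is $\|\cdot\|_1$-dense in $\mathfrak A_n$. From now on $\mathfrak A_n$ denotes the completion for $\|\cdot\|_1$,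 with all these operations extended by continuity; an element is positive if it lies in the closure of the positive operators, and symmetric if it is fixed by all $A\mapsto U_\pi AU_\pi^*$. Let $\ell_n:\mathfrak A_n\to\mathfrak A_{n-1}$ be positive linear contractions with $\ell_n(A_1\otimes\cdots\otimes A_n)=\ell(A_n)\,A_1\otimes\cdots\otimes A_{n-1}$ for $A_i\in\mathfrak A$, and $\ell_{j,n}=\ell_{j+1}\cdots\ell_n$. Let $V\in\mathcal B(\mathfrak A_2)$ map symmetric elements to symmetric elements, and suppose that for every $n\ge2$ the operator $V\otimes\mathbb I$ is bounded on $\mathfrak A_n$ with norm at most $\|V\|$. Let $T_{i,r}$ ($i\ne r$) be the operator on $\mathfrak A_n$ acting as $V$ on the slots $i,r$, and $T_n=\sum_{1\le i<r\le n}T_{i,r}$. Let $K_0$ be a (possibly unbounded) linear operator on $\mathfrak A$, and $K_0^n=\sum_{i=1}^n\mathbb I^{\otimes(i-1)}\otimes K_0\otimes\mathbb I^{\otimes(n-i)}$ on $\mathfrak A_n$ (closure from the span of $A_1\otimes\cdots\otimes A_n$, $A_i\in D(K_0)$). Fix $N\ge1$ and suppose that $K_0$ generates a strongly continuous contraction semigroup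 on $\mathfrak A$, that for $1\le j\le N$ the operator $K_0^j+T_j/N$ generates a strongly continuous contraction semigroup on $\mathfrak A_j$, and that the semigroups generated by $K_0$ and by $K_0^N+V^N$, $V^N:=T_N/N$, preserve positivity and the norm of positive elements. Suppose also $\ell(K_0F)=0$ for $F\in D(K_0)$, and $\ell_{j,N}(T_{i,r}A)=0$ for $A\in\mathfrak A_N$, $1\le j<N$, $i,r>j$, $i\ne r$. Let $F^N(0)\in\mathfrak A_N$ be a state (positive, symmetric, $\|F^N(0)\|_1=1$), $F^N(t)=e^{t(K_0^N+V^N)}F^N(0)$ and $F^N_k(t)=\ell_{k,N}F^N(t)$. Let $Q(F,G)=\ell_2(V(F\otimes G))$ and let $F:[0,\infty)\to\mathfrak A$ be a continuous mild solution of $\partial_tF=K_0F+Q(F,F)$, i.e. $F(t)=e^{tK_0}F(0)+\int_0^te^{(t-s)K_0}Q(F(s),F(s))\,ds$, with $F(t)\ge0$ and $\|F(t)\|_1=1$ for all $t\ge0$. For $1\le j\le N$, $J=\{1,\dots,j\}$, the correlation error is $$E_j(t)=\sum_{K\subset J}(-1)^{|K|}\,\sigma_{J\setminus K,j}\bigl(F^N_{j-|K|}(t)\otimes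 F(t)^{\otimes|K|}\bigr)\sigma_{J\setminus K,j}^*,\qquad \sigma_{L,j}=\sigma_{i_1,1}\cdots\sigma_{i_l,l}\ \text{ for } L=\{i_1<\dots<i_l\},$$ so that $F^N_{j-|K|}(t)$ occupies the slots $J\setminus K$ and $F(t)$ each slot of $K$. **Theorem.** Put $$C_1=\frac{4\cdot16\,(2e)^{\frac1{12e}+1}}{|\log(1-\frac1{24e})|},\quad C_2=16\,(2e)^{1+\frac1{12e}}\,C_0,\quad B_1=2C_1,\quad B_2=B_0+\tfrac12+\frac{16\,C_2^2}{C_1-2}.$$ Suppose that for some $C_0\ge1$ and all $j=1,\dots,N$, $$\|E_j(0)\|_1\le C_0^j\Bigl(\frac j{\sqrt N}\Bigr)^j .$$ Then $C_1\ge0$, $C_2\ge1$, and for all $t>0$ and all $j=1,\dots,N$, $$\|E_j(t)\|_1\le\bigl(C_2\,e^{C_1t\|V\|}\bigr)^j\Bigl(\frac j{\sqrt N}\Bigr)^j .$$ If in addition $\|E_1(0)\|_1\le B_0/N$ for some $B_0>0$, then $B_1>0$, $B_2\ge1$, and for all $t>0$ $$\|E_1(t)\|_1\le\frac1N\,B_2\,e^{B_1t\|V\|}.$$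 -/

import Mathlib

noncomputable section

namespace MeanField

open scoped TensorProduct InnerProductSpace ENNReal Topology
open Filter Set UniformSpace

/-! ### Absolute values of bounded operators -/

section Operators

variable {H : Type*} [NormedAddCommGroup H] [InnerProductSpace ℂ H] [CompleteSpace H]

/-- `*`-algebras of bounded operators on `H`, possibly without unit. -/
abbrev OpAlgebra (H : Type*) [NormedAddCommGroup H] [InnerProductSpace ℂ H] [CompleteSpace H] :=
  NonUnitalStarSubalgebra ℂ (H →L[ℂ] H)

/-- `|A| = √(A* A)`. -/
def absOp (A : H →L[ℂ] H) : H →L[ℂ] H := CFC.abs A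

theorem absOp_nonneg (A : H →L[ℂ] H) : 0 ≤ absOp A := CFC.abs_nonneg A

theorem absOp_mul_self (A : H →L[ℂ] H) : absOp A * absOp A = star A * A := CFC.abs_mul_abs A

theorem absOp_eq {A B : H →L[ℂ] H} (hB : 0 ≤ B) (h : B * B = star A * A) : absOp A = B :=
  CFC.sqrt_unique h hB

theorem absOp_of_nonneg {A : H →L[ℂ] H} (hA : 0 ≤ A) : absOp A = A := CFC.abs_of_nonneg A hA

theorem absOp_zero : absOp (0 : H →L[ℂ] H) = 0 := CFC.abs_zero

theorem absOp_neg (A : H →L[ℂ] H) : absOp (-A) = absOp A := CFC.abs_neg A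

theorem absOp_smul (c : ℂ) (A : H →L[ℂ] H) : absOp (c • A) = ((‖c‖ : ℝ) : ℂ) • absOp A :=
  (CFC.abs_smul c A).trans (RCLike.real_smul_eq_coe_smul (K := ℂ) _ _)

theorem star_mul_self_op_nonneg (R : H →L[ℂ] H) : 0 ≤ star R * R := star_mul_self_nonneg R

theorem exists_eq_star_mul_self {A : H →L[ℂ] H} (hA : 0 ≤ A) : ∃ R, A = star R * R :=
  ⟨CFC.sqrt A, by
    rw [(CFC.sqrt_nonneg A).isSelfAdjoint.star_eq, CFC.sqrt_mul_sqrt_self A hA]⟩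

end Operators

/-! ### The spaces `ℓ²(α)` and tensor products of operators -/

/-- The Hilbert space `ℓ²(α)`. -/
def L2 (α : Type*) : Type _ := lp (fun _ : α => ℂ) 2

namespace L2

variable {α : Type*}

instance : NormedAddCommGroup (L2 α) := inferInstanceAs (NormedAddCommGroup (lp (fun _ : α => ℂ) 2))
instance : InnerProductSpace ℂ (L2 α) :=
  inferInstanceAs (InnerProductSpace ℂ (lp (fun _ : α => ℂ) 2))
instance : CompleteSpace (L2 α) := inferInstanceAs (CompleteSpace (lp (fun _ : α => ℂ) 2))

instance : CoeFun (L2 α) fun _ => α → ℂ := ⟨fun f => f.1⟩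

/-- The element of `ℓ²(α)` with the given coordinates. -/
def mk (f : α → ℂ) (h : Summable fun a => ‖f a‖ ^ 2) : L2 α :=
  ⟨f, memℓp_gen (by simpa using h)⟩

@[simp] theorem mk_apply (f : α → ℂ) (h : Summable fun a => ‖f a‖ ^ 2) (a : α) : mk f h a = f a := rfl
@[simp] theorem add_apply (f g : L2 α) (a : α) : (f + g) a = f a + g a := rfl
@[simp] theorem smul_apply (c : ℂ) (f : L2 α) (a : α) : (c • f) a = c * f a := rfl

@[ext] theorem ext {f g : L2 α} (h : ∀ a, f a = g a) : f = g := lp.ext (funext h)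

theorem summable_norm_sq (f : L2 α) : Summable fun a => ‖f a‖ ^ 2 := by
  have h := (lp.memℓp (E := fun _ : α => ℂ) (p := 2) f).summable (by norm_num)
  simpa using h

theorem inner_eq (f g : L2 α) : ⟪f, g⟫_ℂ = ∑' a, g a * star (f a) :=
  lp.inner_eq_tsum (𝕜 := ℂ) (G := fun _ : α => ℂ) f g

theorem summable_inner (f g : L2 α) : Summable fun a => ‖g a * star (f a)‖ :=
  (lp.summable_inner (𝕜 := ℂ) (G := fun _ : α => ℂ) f g).norm

theorem norm_eq (f : L2 α) : ‖f‖ = (∑' a, ‖f a‖ ^ (2 : ℝ≥0∞).toReal) ^ (1 / (2 : ℝ≥0∞).toReal) :=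
  lp.norm_eq_tsum_rpow (E := fun _ : α => ℂ) (by norm_num) f

open scoped Classical in
/-- The vector with the single non-zero coordinate `c` at `a`. -/
def single (a : α) (c : ℂ) : L2 α := lp.single (E := fun _ : α => ℂ) 2 a c

open scoped Classical in
theorem single_apply (a : α) (c : ℂ) (b : α) : single a c b = if b = a then c else 0 := by
  change lp.single (E := fun _ : α => ℂ) 2 a c b = _
  simp [lp.single_apply, Pi.single_apply]

theorem hasSum_single (f : L2 α) : HasSum (fun a => single a (f a)) f := by
  classical
  have h := lp.hasSum_single (E := fun _ : α => ℂ) (p := 2) (by norm_num) f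
  convert h using 2
  unfold single
  congr!

end L2

/-- `(f ⊗ g)(a, b) = f a * g b`. -/
def tmulVec {α β : Type*} (f : L2 α) (g : L2 β) : L2 (α × β) :=
  L2.mk (fun p => f p.1 * g p.2) (by
    simpa [mul_pow] using f.summable_norm_sq.mul_of_nonneg g.summable_norm_sq
      (fun _ => sq_nonneg _) (fun _ => sq_nonneg _))

theorem inner_tmulVec {α β : Type*} (f f' : L2 α) (g g' : L2 β) :
    ⟪tmulVec f g, tmulVec f' g'⟫_ℂ = ⟪f, f'⟫_ℂ * ⟪g, g'⟫_ℂ := by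
  rw [L2.inner_eq, L2.inner_eq, L2.inner_eq,
    tsum_mul_tsum_of_summable_norm (L2.summable_inner f f') (L2.summable_inner g g')]
  refine tsum_congr fun p => ?_
  simp [tmulVec]
  ring

/-- The isometric embedding `ℓ²(α) ⊗ ℓ²(β) → ℓ²(α × β)` of the algebraic tensor product. -/
def tensorIsometry (α β : Type*) : L2 α ⊗[ℂ] L2 β →ₗᵢ[ℂ] L2 (α × β) :=
  (TensorProduct.lift (LinearMap.mk₂ ℂ tmulVec
    (fun f f' g => by ext p; simp [tmulVec, add_mul])
    (fun c f g => by ext p; simp [tmulVec, mul_assoc])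
    (fun f g g' => by ext p; simp [tmulVec, mul_add])
    (fun c f g => by ext p; simp [tmulVec, mul_left_comm]))).isometryOfInner (by
      intro x y
      induction x using TensorProduct.induction_on with
      | zero => simp
      | add x x' hx hx' => simp only [map_add, inner_add_left, hx, hx']
      | tmul f g =>
        induction y using TensorProduct.induction_on with
        | zero => simp
        | add y y' hy hy' => simp only [map_add, inner_add_right, hy, hy']
        | tmul f' g' => simp [inner_tmulVec])

theorem tensorIsometry_tmul {α β : Type*} (f : L2 α) (g : L2 β) :
    tensorIsometry α β (f ⊗ₜ g) = tmulVec f g := rfl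

theorem denseRange_tensorIsometry (α β : Type*) : DenseRange (tensorIsometry α β) := by
  classical
  intro x
  refine mem_closure_of_tendsto (L2.hasSum_single x) (Filter.Eventually.of_forall ?_)
  intro s
  change _ ∈ LinearMap.range (tensorIsometry α β).toLinearMap
  refine Submodule.sum_mem _ fun p _ => ⟨L2.single p.1 (x p) ⊗ₜ L2.single p.2 1, ?_⟩
  change tmulVec _ _ = _
  ext q
  obtain ⟨a, b⟩ := p
  obtain ⟨c, d⟩ := q
  by_cases h1 : c = a <;> by_cases h2 : d = b <;>
    simp [tmulVec, L2.single_apply, h1, h2]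

/-- The operator `A ⊗ B` on `ℓ²(α × β)`, determined by `(A ⊗ B)(f ⊗ g) = A f ⊗ B g`. -/
def opProd {α β : Type*} (A : L2 α →L[ℂ] L2 α) (B : L2 β →L[ℂ] L2 β) :
    L2 (α × β) →L[ℂ] L2 (α × β) :=
  ((tensorIsometry α β).toContinuousLinearMap ∘L TensorProduct.mapL A B).extend
    (tensorIsometry α β).toContinuousLinearMap

theorem opProd_tensorIsometry {α β : Type*} (A : L2 α →L[ℂ] L2 α) (B : L2 β →L[ℂ] L2 β)
    (x : L2 α ⊗[ℂ] L2 β) : opProd A B (tensorIsometry α β x) =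
      tensorIsometry α β (TensorProduct.mapL A B x) :=
  ContinuousLinearMap.extend_eq
    ((tensorIsometry α β).toContinuousLinearMap ∘L TensorProduct.mapL A B)
    (e := (tensorIsometry α β).toContinuousLinearMap) (denseRange_tensorIsometry α β)
    (tensorIsometry α β).isometry.isUniformInducing x

theorem opProd_ext {α β : Type*} {S T : L2 (α × β) →L[ℂ] L2 (α × β)}
    (h : ∀ f g, S (tmulVec f g) = T (tmulVec f g)) : S = T := by
  have h' : ∀ x, S (tensorIsometry α β x) = T (tensorIsometry α β x) := by
    intro x
    induction x using TensorProduct.induction_on with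
    | zero => simp
    | add x y hx hy => simp only [map_add, hx, hy]
    | tmul f g => exact h f g
  exact ContinuousLinearMap.coeFn_injective
    ((denseRange_tensorIsometry α β).equalizer S.continuous T.continuous (funext h'))

theorem opProd_tmulVec {α β : Type*} (A : L2 α →L[ℂ] L2 α) (B : L2 β →L[ℂ] L2 β)
    (f : L2 α) (g : L2 β) : opProd A B (tmulVec f g) = tmulVec (A f) (B g) :=
  opProd_tensorIsometry A B (f ⊗ₜ g)

theorem opProd_mul {α β : Type*} (A A' : L2 α →L[ℂ] L2 α) (B B' : L2 β →L[ℂ] L2 β) :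
    opProd A B * opProd A' B' = opProd (A * A') (B * B') :=
  opProd_ext fun f g => by simp [opProd_tmulVec]

theorem opProd_star {α β : Type*} (A : L2 α →L[ℂ] L2 α) (B : L2 β →L[ℂ] L2 β) :
    star (opProd A B) = opProd (star A) (star B) := by
  simp only [ContinuousLinearMap.star_eq_adjoint]
  symm
  rw [ContinuousLinearMap.eq_adjoint_iff]
  have key : ∀ x y : L2 α ⊗[ℂ] L2 β,
      ⟪opProd (ContinuousLinearMap.adjoint A) (ContinuousLinearMap.adjoint B)
        (tensorIsometry α β x), tensorIsometry α β y⟫_ℂ =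
      ⟪tensorIsometry α β x, opProd A B (tensorIsometry α β y)⟫_ℂ := by
    intro x y
    induction x using TensorProduct.induction_on with
    | zero => simp
    | add x x' hx hx' => simp only [map_add, inner_add_left, hx, hx']
    | tmul f g =>
      induction y using TensorProduct.induction_on with
      | zero => simp
      | add y y' hy hy' => simp only [map_add, inner_add_right, hy, hy']
      | tmul f' g' =>
        simp only [tensorIsometry_tmul, opProd_tmulVec, inner_tmulVec,
          ContinuousLinearMap.adjoint_inner_left]
  intro x y
  refine (denseRange_tensorIsometry α β).induction_on₂ ?_ key x y
  exact isClosed_eq (((opProd _ _).continuous.comp continuous_fst).inner continuous_snd)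
    (continuous_fst.inner ((opProd A B).continuous.comp continuous_snd))

/-- The unitary `ℓ²(α) ≃ ℓ²(β)` given by a bijection `α ≃ β`. -/
def reindex {α β : Type*} (e : α ≃ β) : L2 α ≃ₗᵢ[ℂ] L2 β where
  toFun f := L2.mk (fun b => f (e.symm b)) (f.summable_norm_sq.comp_injective e.symm.injective)
  invFun f := L2.mk (fun a => f (e a)) (f.summable_norm_sq.comp_injective e.injective)
  map_add' _ _ := rfl
  map_smul' _ _ := rfl
  left_inv f := L2.ext fun a => congrArg f.1 (e.symm_apply_apply a)
  right_inv f := L2.ext fun b => congrArg f.1 (e.apply_symm_apply b)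
  norm_map' f := by
    rw [L2.norm_eq, L2.norm_eq]
    congr 1
    exact e.symm.tsum_eq fun a => ‖f a‖ ^ (2 : ℝ≥0∞).toReal

/-- Conjugation `T ↦ U T U*` by the unitary `U = reindex e`. -/
def opReindex {α β : Type*} (e : α ≃ β) (T : L2 α →L[ℂ] L2 α) : L2 β →L[ℂ] L2 β :=
  (reindex e).toContinuousLinearEquiv.toContinuousLinearMap ∘L T ∘L
    (reindex e).symm.toContinuousLinearEquiv.toContinuousLinearMap

theorem opReindex_apply {α β : Type*} (e : α ≃ β) (T : L2 α →L[ℂ] L2 α) (x : L2 β) :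
    opReindex e T x = reindex e (T ((reindex e).symm x)) := rfl

theorem opReindex_mul {α β : Type*} (e : α ≃ β) (T T' : L2 α →L[ℂ] L2 α) :
    opReindex e (T * T') = opReindex e T * opReindex e T' := by
  ext1 x
  simp [opReindex_apply]

theorem opReindex_add {α β : Type*} (e : α ≃ β) (T T' : L2 α →L[ℂ] L2 α) :
    opReindex e (T + T') = opReindex e T + opReindex e T' := by
  ext1 x
  simp [opReindex_apply]

theorem opReindex_smul {α β : Type*} (e : α ≃ β) (c : ℂ) (T : L2 α →L[ℂ] L2 α) :
    opReindex e (c • T) = c • opReindex e T := by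
  ext1 x
  simp [opReindex_apply]

theorem opReindex_star {α β : Type*} (e : α ≃ β) (T : L2 α →L[ℂ] L2 α) :
    star (opReindex e T) = opReindex e (star T) := by
  simp only [ContinuousLinearMap.star_eq_adjoint]
  symm
  rw [ContinuousLinearMap.eq_adjoint_iff]
  intro x y
  rw [opReindex_apply, opReindex_apply, ← LinearIsometryEquiv.inner_map_map (reindex e).symm,
    LinearIsometryEquiv.symm_apply_apply, ContinuousLinearMap.adjoint_inner_left,
    ← LinearIsometryEquiv.inner_map_map (reindex e), LinearIsometryEquiv.apply_symm_apply]

theorem opProd_add_left {α β : Type*} (A A' : L2 α →L[ℂ] L2 α) (B : L2 β →L[ℂ] L2 β) :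
    opProd (A + A') B = opProd A B + opProd A' B :=
  opProd_ext fun f g => by
    simp only [opProd_tmulVec, add_apply]
    ext p
    simp [tmulVec, add_mul]

theorem opProd_add_right {α β : Type*} (A : L2 α →L[ℂ] L2 α) (B B' : L2 β →L[ℂ] L2 β) :
    opProd A (B + B') = opProd A B + opProd A B' :=
  opProd_ext fun f g => by
    simp only [opProd_tmulVec, add_apply]
    ext p
    simp [tmulVec, mul_add]

theorem opProd_smul_left {α β : Type*} (c : ℂ) (A : L2 α →L[ℂ] L2 α) (B : L2 β →L[ℂ] L2 β) :
    opProd (c • A) B = c • opProd A B :=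
  opProd_ext fun f g => by
    simp only [opProd_tmulVec, smul_apply]
    ext p
    simp [tmulVec, mul_assoc]

theorem opProd_smul_right {α β : Type*} (c : ℂ) (A : L2 α →L[ℂ] L2 α) (B : L2 β →L[ℂ] L2 β) :
    opProd A (c • B) = c • opProd A B :=
  opProd_ext fun f g => by
    simp only [opProd_tmulVec, smul_apply]
    ext p
    simp [tmulVec, mul_left_comm]

theorem opProd_nonneg {α β : Type*} {A : L2 α →L[ℂ] L2 α} {B : L2 β →L[ℂ] L2 β}
    (hA : 0 ≤ A) (hB : 0 ≤ B) : 0 ≤ opProd A B := by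
  obtain ⟨R, rfl⟩ := exists_eq_star_mul_self hA
  obtain ⟨R', rfl⟩ := exists_eq_star_mul_self hB
  rw [← opProd_mul, ← opProd_star]
  exact star_mul_self_op_nonneg _

theorem absOp_opProd {α β : Type*} (A : L2 α →L[ℂ] L2 α) (B : L2 β →L[ℂ] L2 β) :
    absOp (opProd A B) = opProd (absOp A) (absOp B) := by
  refine absOp_eq (opProd_nonneg (absOp_nonneg A) (absOp_nonneg B)) ?_
  rw [opProd_star, opProd_mul, opProd_mul, absOp_mul_self, absOp_mul_self]

theorem opReindex_nonneg {α β : Type*} (e : α ≃ β) {A : L2 α →L[ℂ] L2 α} (hA : 0 ≤ A) :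
    0 ≤ opReindex e A := by
  obtain ⟨R, rfl⟩ := exists_eq_star_mul_self hA
  rw [opReindex_mul, ← opReindex_star]
  exact star_mul_self_op_nonneg _

theorem absOp_opReindex {α β : Type*} (e : α ≃ β) (A : L2 α →L[ℂ] L2 α) :
    absOp (opReindex e A) = opReindex e (absOp A) := by
  refine absOp_eq (opReindex_nonneg e (absOp_nonneg A)) ?_
  rw [← opReindex_mul, absOp_mul_self, opReindex_mul, opReindex_star]

/-! ### Tensor powers of the one-particle space `𝔥 = ℓ²(ι)` -/

/-- The Hilbert tensor power `𝔥^{⊗ n}` of `𝔥 = ℓ²(ι)`, realised as `ℓ²(ιⁿ)`; the vector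
`f₁ ⊗ ⋯ ⊗ fₙ` is `m ↦ f₁ (m 1) ⋯ fₙ (m n)`. -/
abbrev TensorPower (ι : Type*) (n : ℕ) := L2 (Fin n → ι)

/-- Bounded operators on `𝔥^{⊗ n}`. -/
abbrev Op (ι : Type*) (n : ℕ) := TensorPower ι n →L[ℂ] TensorPower ι n

/-- `A ⊗ B` acting on `𝔥^{⊗ n}` for `A` acting on the first `j` and `B` on the last `k` factors,
`j + k = n`. -/
def opTensor {ι : Type*} {j k n : ℕ} (h : j + k = n) (A : Op ι j) (B : Op ι k) : Op ι n :=
  opReindex ((Fin.appendEquiv j k).trans ((finCongr h).arrowCongr (Equiv.refl ι))) (opProd A B)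

/-- `U_π A U_π*`, where `U_π` is the unitary of `𝔥^{⊗ n}` which moves the content of slot `i`
to slot `π i`. For `π` the transposition of `k` and `s`, `U_π` is the operator `σ_{k,s}`. -/
def opPerm {ι : Type*} {n : ℕ} (π : Equiv.Perm (Fin n)) (A : Op ι n) : Op ι n :=
  opReindex (π.arrowCongr (Equiv.refl ι)) A

/-- `A₁ ⊗ ⋯ ⊗ Aₙ`. -/
def opTprod {ι : Type*} : ∀ {n : ℕ}, (Fin n → Op ι 1) → Op ι n
  | 0, _ => 1
  | n + 1, A => opTensor (rfl : n + 1 = n + 1) (opTprod fun i : Fin n => A i.castSucc)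
      (A (Fin.last n))

theorem absOp_opTensor {ι : Type*} {j k n : ℕ} (h : j + k = n) (A : Op ι j) (B : Op ι k) :
    absOp (opTensor h A B) = opTensor h (absOp A) (absOp B) := by
  rw [opTensor, absOp_opReindex, absOp_opProd, opTensor]

/-- The algebras `𝔄ₙ ⊂ B(𝔥^{⊗ n})` with the functional `ℓ`. The level `n = 0` is `𝔄₀ = ℂ`
with `ℓ = id`. -/
structure StateAlgebra (ι : Type*) where
  /-- the `*`-algebra `𝔄ₙ` -/
  alg : ∀ n, OpAlgebra (TensorPower ι n)
  one_mem_zero : (1 : Op ι 0) ∈ alg 0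
  abs_mem : ∀ {n} {A : Op ι n}, A ∈ alg n → absOp A ∈ alg n
  tensor_mem : ∀ {j k n} (h : j + k = n) {A : Op ι j} {B : Op ι k},
    A ∈ alg j → B ∈ alg k → opTensor h A B ∈ alg n
  perm_mem : ∀ {n} (π : Equiv.Perm (Fin n)) {A : Op ι n}, A ∈ alg n → opPerm π A ∈ alg n
  /-- the linear functional `ℓ` on `𝔄ₙ` -/
  ell : ∀ n, alg n →ₗ[ℂ] ℂ
  ell_one : ell 0 ⟨1, one_mem_zero⟩ = 1
  ell_nonneg : ∀ {n} (A : alg n), 0 ≤ (A : Op ι n) → 0 ≤ (ell n A).re ∧ (ell n A).im = 0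
  norm_ell_le : ∀ {n} (A : alg n), ‖ell n A‖ ≤ (ell n ⟨absOp A, abs_mem A.2⟩).re
  ell_tensor : ∀ {j k n} (h : j + k = n) (A : alg j) (B : alg k),
    ell n ⟨opTensor h A B, tensor_mem h A.2 B.2⟩ = ell j A * ell k B
  /-- `‖A‖₁ = ℓ(|A|)` satisfies the triangle inequality -/
  ell_abs_add : ∀ {n} (A B : alg n), (ell n ⟨absOp (A + B : Op ι n), abs_mem (add_mem A.2 B.2)⟩).re ≤
    (ell n ⟨absOp A, abs_mem A.2⟩).re + (ell n ⟨absOp B, abs_mem B.2⟩).re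
  /-- `‖A‖₁ = ℓ(|A|)` is definite -/
  ell_abs_eq_zero : ∀ {n} (A : alg n), (ell n ⟨absOp A, abs_mem A.2⟩).re = 0 → A = 0
  /-- `‖σ A σ*‖₁ = ‖A‖₁` -/
  ell_abs_perm : ∀ {n} (π : Equiv.Perm (Fin n)) (A : alg n),
    (ell n ⟨absOp (opPerm π (A : Op ι n)), abs_mem (perm_mem π A.2)⟩).re =
      (ell n ⟨absOp A, abs_mem A.2⟩).re
  /-- `𝔄ₙ = 𝔄^{⊗ n}` up to `‖·‖₁`-closure: the algebraic tensor power of `𝔄 = 𝔄₁` is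
  `‖·‖₁`-dense in `𝔄ₙ` -/
  dense_tprod : ∀ {n} (A : alg n) (ε : ℝ), 0 < ε → ∃ B : alg n,
    (B : Op ι n) ∈ Submodule.span ℂ {T | ∃ a : Fin n → Op ι 1, (∀ i, a i ∈ alg 1) ∧
      T = opTprod a} ∧
    (ell n ⟨absOp (A - B : Op ι n), abs_mem (sub_mem A.2 B.2)⟩).re < ε

namespace StateAlgebra

variable {ι : Type*} (S : StateAlgebra ι)

/-- The algebra `𝔄ₙ`, to be normed by `‖A‖₁ = ℓ(|A|)`. -/
def PreL1 (n : ℕ) : Type _ := S.alg n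

instance (n : ℕ) : AddCommGroup (S.PreL1 n) := inferInstanceAs (AddCommGroup (S.alg n))
instance (n : ℕ) : Module ℂ (S.PreL1 n) := inferInstanceAs (Module ℂ (S.alg n))

/-- An element of `𝔄ₙ` as an operator. -/
def toOp (n : ℕ) : S.PreL1 n →ₗ[ℂ] Op ι n := (S.alg n).toSubmodule.subtype

/-- The norm `‖A‖₁ = ℓ(|A|)`. -/
def norm₁ (n : ℕ) : AddGroupNorm (S.PreL1 n) where
  toFun A := (S.ell n ⟨absOp (S.toOp n A), S.abs_mem A.2⟩).re
  map_zero' := by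
    have h : (⟨absOp (S.toOp n 0), S.abs_mem (S.alg n).zero_mem⟩ : S.alg n) = 0 :=
      Subtype.ext absOp_zero
    exact (congrArg (fun x => (S.ell n x).re) h).trans (by simp)
  add_le' A B := S.ell_abs_add A B
  neg' A := by
    have h : absOp (S.toOp n (-A)) = absOp (S.toOp n A) := by
      rw [map_neg, absOp_neg]
    exact congrArg (fun x => (S.ell n x).re) (Subtype.ext h)
  eq_zero_of_map_eq_zero' A h := S.ell_abs_eq_zero A h

instance (n : ℕ) : NormedAddCommGroup (S.PreL1 n) := (S.norm₁ n).toNormedAddCommGroup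

theorem norm_def {n : ℕ} (A : S.PreL1 n) :
    ‖A‖ = (S.ell n ⟨absOp (S.toOp n A), S.abs_mem A.2⟩).re := rfl

/-- An operator belonging to `𝔄ₙ`, as an element of the normed space. -/
def ofOp {n : ℕ} (T : Op ι n) (hT : T ∈ S.alg n) : S.PreL1 n := ⟨T, hT⟩

@[simp] theorem toOp_ofOp {n : ℕ} (T : Op ι n) (hT : T ∈ S.alg n) :
    S.toOp n (S.ofOp T hT) = T := rfl

theorem toOp_injective (n : ℕ) : Function.Injective (S.toOp n) := Subtype.val_injective

theorem norm_tensor_eq {j k n : ℕ} (h : j + k = n) (A : S.PreL1 j) (B : S.PreL1 k) :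
    ‖S.ofOp (opTensor h (S.toOp j A) (S.toOp k B)) (S.tensor_mem h A.2 B.2)‖ = ‖A‖ * ‖B‖ := by
  have h1 : (⟨absOp (opTensor h (S.toOp j A) (S.toOp k B)),
      S.abs_mem (S.tensor_mem h A.2 B.2)⟩ : S.alg n) =
      ⟨opTensor h (absOp (S.toOp j A)) (absOp (S.toOp k B)),
        S.tensor_mem h (S.abs_mem A.2) (S.abs_mem B.2)⟩ :=
    Subtype.ext (absOp_opTensor h _ _)
  have h2 := S.ell_tensor h ⟨absOp (S.toOp j A), S.abs_mem A.2⟩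
    ⟨absOp (S.toOp k B), S.abs_mem B.2⟩
  have h3 := (S.ell_nonneg ⟨absOp (S.toOp j A), S.abs_mem A.2⟩ (absOp_nonneg _)).2
  refine (congrArg (fun x => (S.ell n x).re) h1).trans ?_
  rw [h2, Complex.mul_re, h3, zero_mul, sub_zero]
  rfl

instance (n : ℕ) : NormedSpace ℂ (S.PreL1 n) where
  norm_smul_le c A := by
    have h : (⟨absOp (S.toOp n (c • A)), S.abs_mem (c • A : S.PreL1 n).2⟩ : S.alg n) =
        ((‖c‖ : ℝ) : ℂ) • ⟨absOp (S.toOp n A), S.abs_mem A.2⟩ := by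
      refine Subtype.ext ?_
      change absOp (S.toOp n (c • A)) = ((‖c‖ : ℝ) : ℂ) • absOp (S.toOp n A)
      rw [map_smul, absOp_smul]
    rw [norm_def, norm_def, h, map_smul]
    simp

/-- The Banach space obtained by completing `𝔄ₙ` with respect to `‖·‖₁` (again denoted `𝔄ₙ` in
the mathematical text). -/
abbrev Space (n : ℕ) : Type _ := Completion (S.PreL1 n)

/-- The inclusion of the algebra into its completion. -/
def incl (n : ℕ) : S.PreL1 n →L[ℂ] S.Space n := Completion.toComplL

/-- The positive cone: the closure of the set of positive operators in the algebra. -/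
def posCone (n : ℕ) : Set (S.Space n) :=
  closure (S.incl n '' {A | 0 ≤ S.toOp n A})

/-- The continuous extension of `ℓ`. -/
def ellL (n : ℕ) : S.Space n →L[ℂ] ℂ :=
  (LinearMap.mkContinuous (show S.PreL1 n →ₗ[ℂ] ℂ from S.ell n) 1 (fun A => by
    rw [one_mul]; exact S.norm_ell_le A)).fromCompletion

/-- `A ↦ U_π A U_π*` on the algebra. -/
def prePerm {n : ℕ} (π : Equiv.Perm (Fin n)) : S.PreL1 n →L[ℂ] S.PreL1 n :=
  LinearMap.mkContinuous
    { toFun := fun A => S.ofOp (opPerm π (S.toOp n A)) (S.perm_mem π A.2)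
      map_add' := fun A B => S.toOp_injective n
        (by simp only [map_add, toOp_ofOp]; exact opReindex_add _ _ _)
      map_smul' := fun c A => S.toOp_injective n
        (by simp only [map_smul, toOp_ofOp, RingHom.id_apply]; exact opReindex_smul _ _ _) } 1
    (fun A => by rw [one_mul]; exact (S.ell_abs_perm π A).le)

/-- `A ↦ U_π A U_π*` on the completion. -/
def perm {n : ℕ} (π : Equiv.Perm (Fin n)) : S.Space n →L[ℂ] S.Space n :=
  (S.prePerm π).completion

/-- `(A, B) ↦ A ⊗ B` on the algebras. -/
def preTensor {j k n : ℕ} (h : j + k = n) : S.PreL1 j →L[ℂ] S.PreL1 k →L[ℂ] S.PreL1 n :=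
  LinearMap.mkContinuous₂
    (LinearMap.mk₂ ℂ (fun (A : S.PreL1 j) (B : S.PreL1 k) =>
        S.ofOp (opTensor h (S.toOp j A) (S.toOp k B)) (S.tensor_mem h A.2 B.2))
      (fun A A' B => S.toOp_injective n (by
        simp only [map_add, toOp_ofOp, opTensor, opProd_add_left, opReindex_add]))
      (fun c A B => S.toOp_injective n (by
        simp only [map_smul, toOp_ofOp, opTensor, opProd_smul_left, opReindex_smul]))
      (fun A B B' => S.toOp_injective n (by
        simp only [map_add, toOp_ofOp, opTensor, opProd_add_right, opReindex_add]))
      (fun c A B => S.toOp_injective n (by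
        simp only [map_smul, toOp_ofOp, opTensor, opProd_smul_right, opReindex_smul]))) 1
    (fun A B => by rw [one_mul]; exact (S.norm_tensor_eq h A B).le)

/-- `(A, B) ↦ A ⊗ B` on the completions. -/
def tensor {j k n : ℕ} (h : j + k = n) : S.Space j →L[ℂ] S.Space k →L[ℂ] S.Space n :=
  ((((ContinuousLinearMap.compL ℂ (S.PreL1 k) (S.PreL1 n) (S.Space n) (S.incl n)) ∘L
    S.preTensor h).fromCompletion).flip.fromCompletion).flip

theorem ellL_incl {n : ℕ} (A : S.PreL1 n) : S.ellL n (S.incl n A) = S.ell n A :=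
  ContinuousLinearMap.fromCompletion_apply_coe _ _

theorem perm_incl {n : ℕ} (π : Equiv.Perm (Fin n)) (A : S.PreL1 n) :
    S.perm π (S.incl n A) = S.incl n (S.prePerm π A) :=
  ContinuousLinearMap.completion_apply_coe _ _

theorem tensor_incl {j k n : ℕ} (h : j + k = n) (A : S.PreL1 j) (B : S.PreL1 k) :
    S.tensor h (S.incl j A) (S.incl k B) = S.incl n (S.preTensor h A B) := by
  have h1 := fun T : S.PreL1 k →L[ℂ] S.Space j →L[ℂ] S.Space n =>
    ContinuousLinearMap.fromCompletion_apply_coe T B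
  have h2 := fun T : S.PreL1 j →L[ℂ] S.PreL1 k →L[ℂ] S.Space n =>
    ContinuousLinearMap.fromCompletion_apply_coe T A
  refine (congrArg (fun T : S.Space j →L[ℂ] S.Space n => T (S.incl j A)) (h1 _)).trans ?_
  exact congrArg (fun T : S.PreL1 k →L[ℂ] S.Space n => T B) (h2 _)

/-- The unit of `𝔄₀ = ℂ`. -/
def one : S.Space 0 := S.incl 0 (S.ofOp 1 S.one_mem_zero)

/-- `A₁ ⊗ ⋯ ⊗ Aₙ ∈ 𝔄ₙ` for `Aᵢ ∈ 𝔄`. -/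
def tprod : ∀ {n : ℕ}, (Fin n → S.Space 1) → S.Space n
  | 0, _ => S.one
  | n + 1, A => S.tensor (rfl : n + 1 = n + 1) (tprod fun i : Fin n => A i.castSucc)
      (A (Fin.last n))

/-- `A ∈ 𝔄ₙ` is symmetric. -/
def IsSymmetric {n : ℕ} (A : S.Space n) : Prop := ∀ π : Equiv.Perm (Fin n), S.perm π A = A

/-- States of the `n`-particle system. -/
structure IsState {n : ℕ} (A : S.Space n) : Prop where
  pos : A ∈ S.posCone n
  symm : S.IsSymmetric A
  norm_eq : ‖A‖ = 1

end StateAlgebra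

/-- State algebras together with the partial traces `ℓₙ : 𝔄ₙ → 𝔄ₙ₋₁`. Here `ptr n` is `ℓₙ₊₁`. -/
structure MarginalSystem (ι : Type*) extends StateAlgebra ι where
  ptr : ∀ n, toStateAlgebra.Space (n + 1) →L[ℂ] toStateAlgebra.Space n
  ptr_tprod : ∀ {n} (A : Fin (n + 1) → toStateAlgebra.Space 1),
    ptr n (toStateAlgebra.tprod A) =
      toStateAlgebra.ellL 1 (A (Fin.last n)) • toStateAlgebra.tprod fun i : Fin n => A i.castSucc
  ptr_pos : ∀ {n} {A}, A ∈ toStateAlgebra.posCone (n + 1) → ptr n A ∈ toStateAlgebra.posCone n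
  norm_ptr_le : ∀ {n} (A), ‖ptr n A‖ ≤ ‖A‖

namespace MarginalSystem

variable {ι : Type*} (S : MarginalSystem ι)

/-- `𝔄ₙ`, complete with respect to `‖·‖₁`. -/
abbrev Space (n : ℕ) : Type _ := S.toStateAlgebra.Space n

/-- `ℓ_{j,n} = ℓ_{j+1} ⋯ ℓₙ : 𝔄ₙ → 𝔄ⱼ` for `j ≤ n`. -/
def marginal {j n : ℕ} (h : j ≤ n) : S.Space n →L[ℂ] S.Space j :=
  Nat.leRec (motive := fun m _ => S.Space m →L[ℂ] S.Space j)
    (ContinuousLinearMap.id ℂ (S.Space j)) (fun m _ T => T ∘L S.ptr m) h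

/-- The permutation `σ_{K,j} = (i₁ 1)(i₂ 2)⋯(iₖ k)` of `{1, …, j}`, for
`K = {i₁ < ⋯ < iₖ}`; it moves slot `s` to slot `i_s` for `s ≤ k`. -/
def slotPerm {j : ℕ} (K : Finset (Fin j)) : Equiv.Perm (Fin j) :=
  (List.ofFn fun s : Fin K.card =>
    Equiv.swap (K.orderEmbOfFin rfl s) (Fin.castLE (card_finset_fin_le K) s)).prod

/-- The correlation error
`E_j = ∑_{K ⊂ J} (-1)^{|K|} σ_{J∖K,j} (F_{j-|K|} ⊗ F^{⊗ |K|}) σ_{J∖K,j}*` of order `j ≤ N`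
associated with the `N`-particle element `FN` (with marginals `F_k`) and `F ∈ 𝔄`. -/
def correlationError {N : ℕ} (FN : S.Space N) (F : S.Space 1) {j : ℕ} (hj : j ≤ N) : S.Space j :=
  ∑ K : Finset (Fin j), (-1 : ℂ) ^ K.card •
    S.perm (slotPerm Kᶜ)
      (S.tensor ((add_comm _ _).trans (by simp [Finset.card_add_card_compl]) :
          Kᶜ.card + K.card = j)
        (S.marginal ((card_finset_fin_le Kᶜ).trans hj) FN)
        (S.tprod fun _ : Fin K.card => F))

end MarginalSystem

/-! ### Interactions -/

/-- `W = V ⊗ 𝕀` on `𝔄ₙ`, for `V` acting on `𝔄₂`. -/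
def MarginalSystem.IsAmpliation {ι : Type*} (S : MarginalSystem ι)
    (V : S.Space 2 →L[ℂ] S.Space 2) {n : ℕ} (W : S.Space n →L[ℂ] S.Space n) : Prop :=
  ∀ (m : ℕ) (h : 2 + m = n) (A : S.Space 2) (B : S.Space m),
    W (S.tensor h A B) = S.tensor h (V A) B

/-- A symmetry preserving bounded two-body potential. As for every operator acting on two of `n`
particles, its action `V ⊗ 𝕀` on `𝔄ₙ` is bounded with `‖V ⊗ 𝕀‖ ≤ ‖V‖`. -/
structure TwoBodyPotential {ι : Type*} (S : MarginalSystem ι) where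
  V : S.Space 2 →L[ℂ] S.Space 2
  symm : ∀ A, S.IsSymmetric A → S.IsSymmetric (V A)
  exists_ampliation : ∀ n, 2 ≤ n → ∃ W : S.Space n →L[ℂ] S.Space n,
    S.IsAmpliation V W ∧ ‖W‖ ≤ ‖V‖

namespace TwoBodyPotential

variable {ι : Type*} {S : MarginalSystem ι} (P : TwoBodyPotential S)

open scoped Classical in
/-- `V ⊗ 𝕀` on `𝔄ₙ`, `n ≥ 2`. -/
def ampliation (n : ℕ) : S.Space n →L[ℂ] S.Space n :=
  if h : 2 ≤ n then (P.exists_ampliation n h).choose else 0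

/-- A permutation moving slot `i` to the first and slot `r` to the second place, `i ≠ r`. -/
def toFront {n : ℕ} (i r : Fin n) : Equiv.Perm (Fin n) :=
  let a : Fin n := ⟨0, i.pos⟩
  let b : Fin n := ⟨1 % n, Nat.mod_lt 1 i.pos⟩
  Equiv.swap b (Equiv.swap a i r) * Equiv.swap a i

/-- `T_{i,r}`, the action of `V` on the slots `i` and `r`; for `n = N` this is `V_{i,r}`. -/
def pair {n : ℕ} (i r : Fin n) : S.Space n →L[ℂ] S.Space n :=
  S.perm (toFront i r)⁻¹ ∘L P.ampliation n ∘L S.perm (toFront i r)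

/-- `T_n = ∑_{i < r} T_{i,r}` on `𝔄ₙ`. -/
def total (n : ℕ) : S.Space n →L[ℂ] S.Space n :=
  ∑ i : Fin n, ∑ r : Fin n with i < r, P.pair i r

/-- `Q(F, G) = ℓ₂(V(F ⊗ G))`. -/
def Q (F G : S.Space 1) : S.Space 1 := S.ptr 1 (P.V (S.tensor (rfl : 1 + 1 = 2) F G))

end TwoBodyPotential

/-! ### Semigroups and evolutions -/

section Semigroups

variable {E : Type*} [NormedAddCommGroup E] [NormedSpace ℂ E]

/-- `U t`, `t ≥ 0`, is a strongly continuous semigroup. -/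
structure IsC0Semigroup (U : ℝ → E →L[ℂ] E) : Prop where
  zero : U 0 = ContinuousLinearMap.id ℂ E
  add : ∀ s t, 0 ≤ s → 0 ≤ t → U (s + t) = U s ∘L U t
  cont : ∀ x, ContinuousOn (fun t => U t x) (Ici 0)

/-- The (infinitesimal) generator of the semigroup `U` is the operator with graph `Γ`. -/
def HasGenerator (U : ℝ → E →L[ℂ] E) (Γ : Set (E × E)) : Prop :=
  ∀ x y, (x, y) ∈ Γ ↔ Tendsto (fun t : ℝ => (t : ℂ)⁻¹ • (U t x - x)) (𝓝[>] 0) (𝓝 y)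

end Semigroups

/-- The graph of `K₀ⁿ = ∑ᵢ 𝕀 ⊗ K₀ ⊗ 𝕀` on `𝔄ₙ`: the closure of
`A₁ ⊗ ⋯ ⊗ Aₙ ↦ ∑ᵢ A₁ ⊗ ⋯ ⊗ K₀ Aᵢ ⊗ ⋯ ⊗ Aₙ`, for `Aᵢ` in the domain of `K₀`. -/
def MarginalSystem.freeGraph {ι : Type*} (S : MarginalSystem ι)
    (K₀ : S.Space 1 →ₗ.[ℂ] S.Space 1) (n : ℕ) : Submodule ℂ (S.Space n × S.Space n) :=
  (Submodule.span ℂ (range fun A : Fin n → K₀.domain =>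
    (S.tprod fun i => (A i : S.Space 1),
      ∑ i, S.tprod (Function.update (fun i => (A i : S.Space 1)) i (K₀ (A i)))))).topologicalClosure

/-- The semigroup preserves positivity, and the norm of positive elements. -/
structure MarginalSystem.IsPositive {ι : Type*} (S : MarginalSystem ι) {n : ℕ}
    (U : ℝ → S.Space n →L[ℂ] S.Space n) : Prop where
  pos : ∀ t, 0 ≤ t → ∀ A ∈ S.posCone n, U t A ∈ S.posCone n
  norm_eq : ∀ t, 0 ≤ t → ∀ A ∈ S.posCone n, ‖U t A‖ = ‖A‖

/-- The mean-field dynamics of `N` particles: a (possibly unbounded) operator `K₀` on `𝔄` and a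
two-body potential `V`, with the semigroups `e^{t K₀}` and `e^{t (K₀ʲ + Tⱼ / N)}`, `j ≤ N`. For
`j = N` the latter is the `N`-particle evolution, as `T_N / N = V^N`. -/
structure Dynamics {ι : Type*} (S : MarginalSystem ι) (N : ℕ) extends TwoBodyPotential S where
  K₀ : S.Space 1 →ₗ.[ℂ] S.Space 1
  /-- `e^{t K₀}` -/
  free : ℝ → S.Space 1 →L[ℂ] S.Space 1
  free_c0 : IsC0Semigroup free
  free_generator : HasGenerator free (K₀.graph : Set (S.Space 1 × S.Space 1))
  norm_free_le : ∀ t, 0 ≤ t → ‖free t‖ ≤ 1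
  free_positive : S.IsPositive free
  /-- `e^{t (K₀ʲ + Tⱼ / N)}` -/
  evol : ∀ j, ℝ → S.Space j →L[ℂ] S.Space j
  evol_c0 : ∀ j, 1 ≤ j → j ≤ N → IsC0Semigroup (evol j)
  evol_generator : ∀ j, 1 ≤ j → j ≤ N → HasGenerator (evol j)
    {p | (p.1, p.2 - (N : ℂ)⁻¹ • toTwoBodyPotential.total j p.1) ∈ S.freeGraph K₀ j}
  norm_evol_le : ∀ j, 1 ≤ j → j ≤ N → ∀ t, 0 ≤ t → ‖evol j t‖ ≤ 1
  evol_positive : S.IsPositive (evol N)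
  /-- `ℓ(K₀ F) = 0` -/
  ell_K₀ : ∀ F : K₀.domain, S.ellL 1 (K₀ F) = 0
  /-- `ℓ_{j,N}(V_{i,r} A) = 0` for `i ≠ r`, `i, r > j` -/
  marginal_pair : ∀ (j : ℕ) (hj : j < N), 1 ≤ j → ∀ i r : Fin N, i ≠ r → j ≤ i → j ≤ r →
    ∀ A, S.marginal hj.le (toTwoBodyPotential.pair i r A) = 0

namespace Dynamics

variable {ι : Type*} {S : MarginalSystem ι} {N : ℕ} (D : Dynamics S N)

/-- `F` is the (mild) solution of the mean-field equation `∂ₜ F = K₀ F + Q(F, F)`, and it stays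
positive and normalised. -/
structure IsMeanFieldSolution (F : ℝ → S.Space 1) : Prop where
  cont : ContinuousOn F (Ici 0)
  mild : ∀ t, 0 ≤ t → F t = D.free t (F 0) + ∫ s in (0 : ℝ)..t, D.free (t - s) (D.Q (F s) (F s))
  pos : ∀ t, 0 ≤ t → F t ∈ S.posCone 1
  norm_eq : ∀ t, 0 ≤ t → ‖F t‖ = 1

/-- The correlation error `E_j(t)` of the evolved state `F^N(t) = e^{t (K₀ᴺ + Vᴺ)} F^N(0)` with
respect to the solution `F(t)` of the mean-field equation. -/
def E (FN : S.Space N) (F : ℝ → S.Space 1) {j : ℕ} (hj : j ≤ N) (t : ℝ) : S.Space j :=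
  S.correlationError (D.evol N t FN) (F t) hj

end Dynamics

/-! ### Constants -/


/-- `C₁ = 4 · 16 (2e)^{1/(12e) + 1} / |log (1 - 1/(24e))|` -/
def C₁ : ℝ := 4 * (16 * (2 * Real.exp 1) ^ (1 / (12 * Real.exp 1) + 1)) /
  |Real.log (1 - 1 / (24 * Real.exp 1))|

/-- `C₂ = 16 (2e)^{1 + 1/(12e)} C₀` -/
def C₂ (C₀ : ℝ) : ℝ := 16 * (2 * Real.exp 1) ^ (1 + 1 / (12 * Real.exp 1)) * C₀

/-- `B₁ = 2 C₁` -/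
def B₁ : ℝ := 2 * C₁

/-- `B₂ = B₀ + 1/2 + 16 C₂² / (C₁ - 2)` -/
def B₂ (B₀ C₀ : ℝ) : ℝ := B₀ + 1 / 2 + 16 * C₂ C₀ ^ 2 / (C₁ - 2)

end MeanField
end

noncomputable section

namespace MeanField

open scoped TensorProduct InnerProductSpace ENNReal Topology
open Filter Set UniformSpace

/-! ### Product vectors and product operators -/

section ProductVectors

variable {ι : Type*}

/-- `f ⊗ g` for `f`, `g` in tensor powers of the one-particle space. -/
def vecTensor {j k n : ℕ} (h : j + k = n) (f : TensorPower ι j) (g : TensorPower ι k) :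
    TensorPower ι n :=
  reindex ((Fin.appendEquiv j k).trans ((finCongr h).arrowCongr (Equiv.refl ι))) (tmulVec f g)

theorem opTensor_vecTensor {j k n : ℕ} (h : j + k = n) (A : Op ι j) (B : Op ι k)
    (f : TensorPower ι j) (g : TensorPower ι k) :
    opTensor h A B (vecTensor h f g) = vecTensor h (A f) (B g) := by
  rw [opTensor, opReindex_apply, vecTensor, LinearIsometryEquiv.symm_apply_apply, opProd_tmulVec]
  rfl

/-- `f₁ ⊗ ⋯ ⊗ fₙ`. -/
def prodVec : ∀ {n : ℕ}, (Fin n → TensorPower ι 1) → TensorPower ι n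
  | 0, _ => L2.single Fin.elim0 1
  | n + 1, f => vecTensor (rfl : n + 1 = n + 1) (prodVec fun i : Fin n => f i.castSucc)
      (f (Fin.last n))

theorem vecTensor_apply {j k : ℕ} (f : TensorPower ι j) (g : TensorPower ι k)
    (m : Fin (j + k) → ι) :
    vecTensor rfl f g m = f (fun i => m (Fin.castAdd k i)) * g (fun i => m (Fin.natAdd j i)) := rfl

theorem prodVec_apply : ∀ {n : ℕ} (f : Fin n → TensorPower ι 1) (m : Fin n → ι),
    prodVec f m = ∏ i, f i fun _ => m i
  | 0, f, m => by
    rw [prodVec, L2.single_apply, if_pos (Subsingleton.elim _ _)]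
    simp
  | n + 1, f, m => by
    rw [prodVec, vecTensor_apply, prodVec_apply, Fin.prod_univ_castSucc]
    have h : (fun i : Fin 1 => m (Fin.natAdd n i)) = fun _ => m (Fin.last n) := funext fun i => by
      rw [Subsingleton.elim i 0]
      rfl
    rw [h]
    rfl

theorem opTprod_prodVec : ∀ {n : ℕ} (a : Fin n → Op ι 1) (f : Fin n → TensorPower ι 1),
    opTprod a (prodVec f) = prodVec fun i => a i (f i)
  | 0, _, _ => rfl
  | n + 1, a, f => by
    rw [opTprod, prodVec, opTensor_vecTensor, opTprod_prodVec]
    rfl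

theorem single_eq_smul_prodVec {n : ℕ} (m : Fin n → ι) (c : ℂ) :
    L2.single m c = c • prodVec fun i => L2.single (fun _ => m i) 1 := by
  classical
  ext q
  rw [L2.smul_apply, prodVec_apply, L2.single_apply]
  simp only [L2.single_apply]
  split_ifs with h
  · subst h
    simp
  · obtain ⟨i, hi⟩ := Function.ne_iff.mp h
    rw [Finset.prod_eq_zero (Finset.mem_univ i), mul_zero]
    rw [if_neg]
    exact fun h => hi (congrFun h 0)

theorem op_ext {n : ℕ} {A B : Op ι n} (h : ∀ f, A (prodVec f) = B (prodVec f)) : A = B := by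
  ext1 x
  have key : ∀ T : Op ι n, HasSum (fun m => T (L2.single m (x m))) (T x) := fun T =>
    T.hasSum (L2.hasSum_single x)
  refine (key A).unique ?_
  convert key B using 2 with m
  rw [single_eq_smul_prodVec, map_smul, map_smul, h]

theorem reindex_prodVec {n : ℕ} (π : Equiv.Perm (Fin n)) (f : Fin n → TensorPower ι 1) :
    reindex (π.arrowCongr (Equiv.refl ι)) (prodVec f) = prodVec fun i => f (π.symm i) := by
  ext m
  change prodVec f (fun i => m (π i)) = _
  rw [prodVec_apply, prodVec_apply]
  rw [← Equiv.prod_comp π fun i => (f (π.symm i) : (Fin 1 → ι) → ℂ) fun _ => m i]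
  simp

theorem opPerm_opTprod {n : ℕ} (π : Equiv.Perm (Fin n)) (a : Fin n → Op ι 1) :
    opPerm π (opTprod a) = opTprod fun i => a (π.symm i) := by
  refine op_ext fun f => ?_
  have h : prodVec f = reindex (π.arrowCongr (Equiv.refl ι)) (prodVec fun i => f (π i)) := by
    rw [reindex_prodVec]
    simp
  rw [opPerm, opReindex_apply, opTprod_prodVec, h, LinearIsometryEquiv.symm_apply_apply,
    opTprod_prodVec, reindex_prodVec]
  simp

theorem vecTensor_prodVec {j k n : ℕ} (h : j + k = n) (f : Fin j → TensorPower ι 1)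
    (g : Fin k → TensorPower ι 1) :
    vecTensor h (prodVec f) (prodVec g) = prodVec fun i => Fin.append f g (Fin.cast h.symm i) := by
  subst h
  ext m
  rw [vecTensor_apply]
  simp only [prodVec_apply, Fin.prod_univ_add, Fin.cast_eq_self, Fin.append_left, Fin.append_right]

theorem prodVec_append {j k n : ℕ} (h : j + k = n) (f : Fin n → TensorPower ι 1) :
    prodVec f = vecTensor h (prodVec fun i => f (Fin.cast h (Fin.castAdd k i)))
      (prodVec fun i => f (Fin.cast h (Fin.natAdd j i))) := by
  subst h
  rw [vecTensor_prodVec]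
  congr 1
  funext i
  simp only [Fin.cast_eq_self]
  exact (congrFun (Fin.append_castAdd_natAdd (f := f)) i).symm

theorem opTensor_opTprod {j k n : ℕ} (h : j + k = n) (a : Fin j → Op ι 1) (b : Fin k → Op ι 1) :
    opTensor h (opTprod a) (opTprod b) =
      opTprod fun i => Fin.append a b (Fin.cast h.symm i) := by
  refine op_ext fun f => ?_
  rw [prodVec_append h f, opTensor_vecTensor, opTprod_prodVec, opTprod_prodVec, ← prodVec_append,
    opTprod_prodVec, vecTensor_prodVec]
  subst h
  congr 1
  funext i
  refine Fin.addCases (fun i => ?_) (fun i => ?_) i <;> simp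

theorem opTprod_one (a : Op ι 1) : (opTprod fun _ : Fin 1 => a) = a := by
  have h : ∀ f : TensorPower ι 1, (prodVec fun _ : Fin 1 => f) = f := fun f => by
    ext m
    have hm : m = fun _ => m 0 := funext fun i => by rw [Subsingleton.elim i 0]
    rw [prodVec_apply, Fin.prod_univ_one, ← hm]
  refine op_ext fun f => ?_
  have hf : f = fun _ => f 0 := funext fun i => by rw [Subsingleton.elim i 0]
  rw [hf, opTprod_prodVec, h, h]

end ProductVectors

/-! ### Elementary tensors in the completed algebras -/

namespace StateAlgebra

variable {ι : Type*} (S : StateAlgebra ι)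

theorem continuous_tprod : ∀ {n : ℕ}, Continuous (S.tprod : (Fin n → S.Space 1) → S.Space n)
  | 0 => continuous_const
  | n + 1 => by
    have h := (continuous_tprod (n := n)).comp
      (continuous_pi fun i : Fin n => continuous_apply (A := fun _ : Fin (n + 1) => S.Space 1)
        i.castSucc)
    exact ((S.tensor (rfl : n + 1 = n + 1)).continuous.comp h).clm_apply
      (continuous_apply (Fin.last n))

theorem opTprod_mem : ∀ {n : ℕ} {a : Fin n → Op ι 1}, (∀ i, a i ∈ S.alg 1) → opTprod a ∈ S.alg n
  | 0, _, _ => S.one_mem_zero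
  | _ + 1, _, h => S.tensor_mem rfl (opTprod_mem fun i => h i.castSucc) (h _)

theorem tprod_incl : ∀ {n : ℕ} (a : Fin n → S.PreL1 1),
    S.tprod (fun i => S.incl 1 (a i)) =
      S.incl n (S.ofOp (opTprod fun i => S.toOp 1 (a i)) (S.opTprod_mem fun i => (a i).2))
  | 0, _ => rfl
  | n + 1, a => by
    rw [tprod, tprod_incl, tensor_incl]
    rfl

theorem denseRange_incl (n : ℕ) : DenseRange (S.incl n) := Completion.denseRange_coe

theorem denseRange_incl_pi (n : ℕ) :
    DenseRange fun (a : Fin n → S.PreL1 1) i => S.incl 1 (a i) :=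
  DenseRange.piMap fun _ => S.denseRange_incl 1

/-- Continuous identities between families of elements of `𝔄` hold if they hold on the algebra. -/
theorem tprod_induction {n : ℕ} {X : Type*} [TopologicalSpace X] [T2Space X]
    {f g : (Fin n → S.Space 1) → X} (hf : Continuous f) (hg : Continuous g)
    (h : ∀ a : Fin n → S.PreL1 1, f (fun i => S.incl 1 (a i)) = g fun i => S.incl 1 (a i)) :
    f = g :=
  (S.denseRange_incl_pi n).equalizer hf hg (funext h)

theorem perm_tprod {n : ℕ} (π : Equiv.Perm (Fin n)) (A : Fin n → S.Space 1) :
    S.perm π (S.tprod A) = S.tprod fun i => A (π.symm i) := by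
  refine congrFun (S.tprod_induction (f := fun A => S.perm π (S.tprod A))
    (g := fun A => S.tprod fun i => A (π.symm i)) ?_ ?_ fun a => ?_) A
  · exact (S.perm π).continuous.comp S.continuous_tprod
  · exact S.continuous_tprod.comp (continuous_pi fun i => continuous_apply _)
  · simp only [tprod_incl, perm_incl]
    congr 1
    exact S.toOp_injective n (opPerm_opTprod π _)

theorem tensor_tprod {j k n : ℕ} (h : j + k = n) (A : Fin j → S.Space 1) (B : Fin k → S.Space 1) :
    S.tensor h (S.tprod A) (S.tprod B) = S.tprod fun i => Fin.append A B (Fin.cast h.symm i) := by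
  subst h
  have hA : ∀ a : Fin j → S.PreL1 1, ∀ b : Fin k → S.PreL1 1,
      S.tensor rfl (S.tprod fun i => S.incl 1 (a i)) (S.tprod fun i => S.incl 1 (b i)) =
      S.tprod (Fin.append (fun i => S.incl 1 (a i)) fun i => S.incl 1 (b i)) := by
    intro a b
    have hc : (Fin.append (fun i => S.incl 1 (a i)) fun i => S.incl 1 (b i)) =
        fun i => S.incl 1 (Fin.append a b i) := by
      funext i
      refine Fin.addCases (fun i => ?_) (fun i => ?_) i <;> simp
    rw [hc]
    simp only [tprod_incl, tensor_incl]
    congr 1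
    refine S.toOp_injective _ ((opTensor_opTprod rfl _ _).trans ?_)
    rw [toOp_ofOp]
    congr 1
    funext i
    refine Fin.addCases (fun i => ?_) (fun i => ?_) i <;> simp
  have hB : ∀ a : Fin j → S.PreL1 1, ∀ B : Fin k → S.Space 1,
      S.tensor rfl (S.tprod fun i => S.incl 1 (a i)) (S.tprod B) =
      S.tprod (Fin.append (fun i => S.incl 1 (a i)) B) := fun a B => by
    refine congrFun (S.tprod_induction (f := fun B =>
      S.tensor rfl (S.tprod fun i => S.incl 1 (a i)) (S.tprod B))
      (g := fun B => S.tprod (Fin.append (fun i => S.incl 1 (a i)) B)) ?_ ?_ (hA a)) B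
    · exact (S.tensor rfl _).continuous.comp S.continuous_tprod
    · refine S.continuous_tprod.comp (continuous_pi fun i => ?_)
      refine Fin.addCases (fun i => ?_) (fun i => ?_) i <;> simp <;> fun_prop
  refine congrFun (S.tprod_induction (f := fun A => S.tensor rfl (S.tprod A) (S.tprod B))
      (g := fun A => S.tprod (Fin.append A B)) ?_ ?_ (fun a => hB a B)) A
  · exact ((S.tensor rfl).continuous.comp S.continuous_tprod).clm_apply continuous_const
  · refine S.continuous_tprod.comp (continuous_pi fun i => ?_)
    refine Fin.addCases (fun i => ?_) (fun i => ?_) i <;> simp <;> fun_prop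

theorem tprod_one (A : S.Space 1) : (S.tprod fun _ : Fin 1 => A) = A := by
  refine congrFun (f := fun A => S.tprod fun _ : Fin 1 => A) (g := id) ?_ A
  refine (S.denseRange_incl 1).equalizer
    (S.continuous_tprod.comp (continuous_pi fun _ => continuous_id)) continuous_id ?_
  funext a
  simp only [Function.comp, tprod_incl, id]
  congr 1
  exact S.toOp_injective 1 (opTprod_one _)

/-- The span of the elementary tensors is dense in `𝔄ₙ`. -/
theorem dense_span_tprod (n : ℕ) :
    (Submodule.span ℂ (range (S.tprod (n := n)))).topologicalClosure = ⊤ := by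
  rw [Submodule.eq_top_iff']
  intro x
  refine (S.denseRange_incl n).induction_on x
    (Submodule.isClosed_topologicalClosure _) fun A => ?_
  refine Metric.mem_closure_iff.mpr fun ε hε => ?_
  obtain ⟨B, hB, hlt⟩ := S.dense_tprod A ε hε
  refine ⟨S.incl n B, ?_, ?_⟩
  · have key : ∀ T ∈ Submodule.span ℂ {T : Op ι n | ∃ a : Fin n → Op ι 1, (∀ i, a i ∈ S.alg 1) ∧
        T = opTprod a}, ∃ hT : T ∈ S.alg n,
          S.incl n (S.ofOp T hT) ∈ Submodule.span ℂ (range (S.tprod (n := n))) := by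
      intro T hT
      induction hT using Submodule.span_induction with
      | mem T h =>
        obtain ⟨a, ha, rfl⟩ := h
        refine ⟨S.opTprod_mem ha, Submodule.subset_span ⟨fun i => S.incl 1 (S.ofOp (a i) (ha i)), ?_⟩⟩
        rw [tprod_incl]
        rfl
      | zero =>
        refine ⟨zero_mem _, ?_⟩
        have : S.ofOp (0 : Op ι n) (zero_mem _) = 0 := rfl
        rw [this, map_zero]
        exact zero_mem _
      | add T T' _ _ h h' =>
        obtain ⟨h1, h2⟩ := h
        obtain ⟨h1', h2'⟩ := h'
        refine ⟨add_mem h1 h1', ?_⟩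
        have : S.ofOp (T + T') (add_mem h1 h1') = S.ofOp T h1 + S.ofOp T' h1' := rfl
        rw [this, map_add]
        exact add_mem h2 h2'
      | smul c T _ h =>
        obtain ⟨h1, h2⟩ := h
        refine ⟨SMulMemClass.smul_mem c h1, ?_⟩
        have : S.ofOp (c • T) (SMulMemClass.smul_mem c h1) = c • S.ofOp T h1 := rfl
        rw [this, map_smul]
        exact Submodule.smul_mem _ c h2
    exact (key B hB).2
  · rw [dist_eq_norm]
    refine (congrArg norm (map_sub (S.incl n) A (show S.PreL1 n from B))).symm.trans_lt ?_
    exact (Completion.norm_coe _).trans_lt hlt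

theorem clm_ext {n : ℕ} {X : Type*} [NormedAddCommGroup X] [NormedSpace ℂ X]
    {L L' : S.Space n →L[ℂ] X} (h : ∀ A, L (S.tprod A) = L' (S.tprod A)) : L = L' := by
  refine ContinuousLinearMap.ext_on ?_ (fun x hx => ?_)
    (s := range (S.tprod (n := n)))
  · exact Submodule.dense_iff_topologicalClosure_eq_top.mpr (S.dense_span_tprod n)
  · obtain ⟨A, rfl⟩ := hx
    exact h A

theorem norm_incl {n : ℕ} (A : S.PreL1 n) : ‖S.incl n A‖ = ‖A‖ := Completion.norm_coe A

theorem norm_tensor {j k n : ℕ} (h : j + k = n) (A : S.Space j) (B : S.Space k) :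
    ‖S.tensor h A B‖ = ‖A‖ * ‖B‖ := by
  have h1 : ∀ (a : S.PreL1 j) (B : S.Space k), ‖S.tensor h (S.incl j a) B‖ = ‖S.incl j a‖ * ‖B‖ :=
    fun a B => (S.denseRange_incl k).induction_on B
      (isClosed_eq (S.tensor h (S.incl j a)).continuous.norm (continuous_const.mul continuous_norm))
      fun b => by
        rw [tensor_incl, norm_incl, norm_incl, norm_incl]
        exact S.norm_tensor_eq h a b
  refine (S.denseRange_incl j).induction_on A (isClosed_eq ?_ ?_) fun a => h1 a B
  · exact ((S.tensor h).continuous.clm_apply continuous_const).norm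
  · exact continuous_norm.mul continuous_const

theorem tprod_succ {n : ℕ} (A : Fin (n + 1) → S.Space 1) :
    S.tprod A = S.tensor (rfl : n + 1 = n + 1) (S.tprod fun i : Fin n => A i.castSucc)
      (A (Fin.last n)) := rfl

theorem tprod_update_add : ∀ {n : ℕ} (A : Fin n → S.Space 1) (i : Fin n) (x y : S.Space 1),
    S.tprod (Function.update A i (x + y)) =
      S.tprod (Function.update A i x) + S.tprod (Function.update A i y)
  | n + 1, A, i, x, y => by
    simp only [tprod_succ]
    refine Fin.lastCases ?_ (fun i => ?_) i
    · simp
    · have h : ∀ z : S.Space 1, (fun k : Fin n => Function.update A i.castSucc z k.castSucc) =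
          Function.update (fun k : Fin n => A k.castSucc) i z := fun z =>
        Function.update_comp_eq_of_injective A (Fin.castSucc_injective n) i z
      have h' : ∀ z : S.Space 1, Function.update A i.castSucc z (Fin.last n) = A (Fin.last n) :=
        fun z => Function.update_of_ne (Fin.castSucc_lt_last i).ne' _ _
      simp only [h, h', tprod_update_add, map_add, add_apply]

theorem tprod_update_smul : ∀ {n : ℕ} (A : Fin n → S.Space 1) (i : Fin n) (c : ℂ) (x : S.Space 1),
    S.tprod (Function.update A i (c • x)) = c • S.tprod (Function.update A i x)
  | n + 1, A, i, c, x => by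
    simp only [tprod_succ]
    refine Fin.lastCases ?_ (fun i => ?_) i
    · simp
    · have h : ∀ z : S.Space 1, (fun k : Fin n => Function.update A i.castSucc z k.castSucc) =
          Function.update (fun k : Fin n => A k.castSucc) i z := fun z =>
        Function.update_comp_eq_of_injective A (Fin.castSucc_injective n) i z
      have h' : ∀ z : S.Space 1, Function.update A i.castSucc z (Fin.last n) = A (Fin.last n) :=
        fun z => Function.update_of_ne (Fin.castSucc_lt_last i).ne' _ _
      simp only [h, h', tprod_update_smul, map_smul, smul_apply]

theorem tprod_smul : ∀ {n : ℕ} (c : Fin n → ℂ) (A : Fin n → S.Space 1),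
    (S.tprod fun i => c i • A i) = (∏ i, c i) • S.tprod A
  | 0, c, A => by simp [tprod]
  | n + 1, c, A => by
    rw [tprod_succ, tprod_succ, tprod_smul, Fin.prod_univ_castSucc]
    simp [smul_smul, mul_comm]

theorem norm_one : ‖S.one‖ = 1 := by
  rw [one, norm_incl, norm_def]
  have h : (⟨absOp (S.toOp 0 (S.ofOp 1 S.one_mem_zero)),
      S.abs_mem (S.ofOp 1 S.one_mem_zero).2⟩ : S.alg 0) = ⟨1, S.one_mem_zero⟩ :=
    Subtype.ext (absOp_of_nonneg zero_le_one)
  rw [h, S.ell_one, Complex.one_re]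

theorem norm_tprod : ∀ {n : ℕ} (A : Fin n → S.Space 1), ‖S.tprod A‖ = ∏ i, ‖A i‖
  | 0, _ => by simpa [tprod] using S.norm_one
  | n + 1, A => by rw [tprod_succ, norm_tensor, norm_tprod, Fin.prod_univ_castSucc]

theorem norm_perm {n : ℕ} (π : Equiv.Perm (Fin n)) (A : S.Space n) : ‖S.perm π A‖ = ‖A‖ := by
  refine (S.denseRange_incl n).induction_on A
    (isClosed_eq (S.perm π).continuous.norm continuous_norm) fun a => ?_
  rw [perm_incl, norm_incl, norm_incl]
  exact S.ell_abs_perm π a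

theorem perm_mul {n : ℕ} (π ρ : Equiv.Perm (Fin n)) : S.perm (π * ρ) = S.perm π ∘L S.perm ρ :=
  S.clm_ext fun A => by
    rw [ContinuousLinearMap.comp_apply, perm_tprod, perm_tprod, perm_tprod]
    rfl

theorem perm_mul_apply {n : ℕ} (π ρ : Equiv.Perm (Fin n)) (A : S.Space n) :
    S.perm (π * ρ) A = S.perm π (S.perm ρ A) := by rw [perm_mul]; rfl

theorem perm_one {n : ℕ} : S.perm (1 : Equiv.Perm (Fin n)) = ContinuousLinearMap.id ℂ _ :=
  S.clm_ext fun A => by rw [perm_tprod]; rfl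

theorem norm_ellL_le {n : ℕ} (A : S.Space n) : ‖S.ellL n A‖ ≤ ‖A‖ := by
  refine (S.denseRange_incl n).induction_on A
    (isClosed_le (S.ellL n).continuous.norm continuous_norm) fun a => ?_
  rw [ellL_incl, norm_incl]
  exact S.norm_ell_le a

theorem ellL_of_mem_posCone {n : ℕ} {A : S.Space n} (hA : A ∈ S.posCone n) :
    S.ellL n A = ‖A‖ := by
  refine closure_minimal (s := S.incl n '' {A | 0 ≤ S.toOp n A})
    (t := {A | S.ellL n A = ‖A‖}) ?_ ?_ hA
  · rintro _ ⟨a, ha, rfl⟩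
    have h1 := S.ell_nonneg a ha
    change S.ellL n (S.incl n a) = _
    rw [ellL_incl, norm_incl, norm_def]
    have h2 : (⟨absOp (S.toOp n a), S.abs_mem a.2⟩ : S.alg n) = a :=
      Subtype.ext (absOp_of_nonneg ha)
    refine Complex.ext ?_ ?_
    · rw [Complex.ofReal_re]
      exact congrArg (fun x => (S.ell n x).re) h2.symm
    · rw [Complex.ofReal_im]
      exact h1.2
  · exact isClosed_eq (S.ellL n).continuous (Complex.continuous_ofReal.comp continuous_norm)

end StateAlgebra

/-! ### Operators acting slot by slot -/

namespace MarginalSystem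

variable {ι : Type*} (S : MarginalSystem ι)

/-- Trace out slot `i` and insert `G` there. -/
def slot : ∀ {n : ℕ}, Fin n → S.Space 1 →L[ℂ] S.Space n →L[ℂ] S.Space n
  | 0, i => i.elim0
  | n + 1, i =>
    ContinuousLinearMap.compL ℂ _ _ _ (S.perm (Equiv.swap i (Fin.last n))) ∘L
      (ContinuousLinearMap.compL ℂ _ _ _).flip (S.ptr n ∘L S.perm (Equiv.swap i (Fin.last n))) ∘L
      (S.tensor (rfl : n + 1 = n + 1)).flip

theorem slot_apply {n : ℕ} (i : Fin (n + 1)) (G : S.Space 1) (x : S.Space (n + 1)) :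
    S.slot i G x = S.perm (Equiv.swap i (Fin.last n)) (S.tensor (rfl : n + 1 = n + 1)
      (S.ptr n (S.perm (Equiv.swap i (Fin.last n)) x)) G) := rfl

theorem slot_tprod {n : ℕ} (i : Fin n) (G : S.Space 1) (A : Fin n → S.Space 1) :
    S.slot i G (S.tprod A) = S.ellL 1 (A i) • S.tprod (Function.update A i G) := by
  cases n with
  | zero => exact i.elim0
  | succ n =>
    rw [slot_apply, S.perm_tprod, S.ptr_tprod, map_smul, smul_apply, map_smul]
    congr 1
    · simp
    · have h : ∀ B : Fin (n + 1) → S.Space 1, S.tensor (rfl : n + 1 = n + 1)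
          (S.tprod fun k : Fin n => B k.castSucc) G = S.tprod (Function.update B (Fin.last n) G) :=
        fun B => by
          rw [S.tprod_succ]
          simp
      refine (congrArg _ (h fun k => A ((Equiv.swap i (Fin.last n)).symm k))).trans ?_
      rw [S.perm_tprod]
      congr 1
      funext k
      by_cases hk : k = i
      · subst hk; simp
      · rw [Function.update_of_ne hk, Function.update_of_ne]
        · simp
        · simp only [Equiv.symm_swap]
          intro h
          apply hk
          have := congrArg (Equiv.swap i (Fin.last n)) h
          simpa using this

theorem norm_slot_apply_le {n : ℕ} (i : Fin n) (G : S.Space 1) (x : S.Space n) :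
    ‖S.slot i G x‖ ≤ ‖G‖ * ‖x‖ := by
  cases n with
  | zero => exact i.elim0
  | succ n =>
    rw [slot_apply, S.norm_perm, S.norm_tensor, mul_comm]
    refine mul_le_mul_of_nonneg_left ((S.norm_ptr_le _).trans ?_) (norm_nonneg G)
    rw [S.norm_perm]

/-- A pair `(α, G)` encodes the operator `A ↦ α A + ℓ(A) G` on `𝔄`. -/
abbrev SlotOp : Type _ := ℂ × S.Space 1

/-- The action of `(α, G)`. -/
def act (p : S.SlotOp) (A : S.Space 1) : S.Space 1 := p.1 • A + S.ellL 1 A • p.2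

/-- The identity. -/
def keep : S.SlotOp := (1, 0)

/-- `A ↦ ℓ(A) G`. -/
def ins (G : S.Space 1) : S.SlotOp := (0, G)

/-- `A ↦ A - ℓ(A) G`. -/
def fluct (G : S.Space 1) : S.SlotOp := (1, -G)

@[simp] theorem act_keep (A : S.Space 1) : S.act S.keep A = A := by simp [act, keep]
@[simp] theorem act_ins (G A : S.Space 1) : S.act (S.ins G) A = S.ellL 1 A • G := by
  simp [act, ins]
@[simp] theorem act_fluct (G A : S.Space 1) : S.act (S.fluct G) A = A - S.ellL 1 A • G := by
  simp [act, fluct, sub_eq_add_neg]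

theorem fluct_add_ins (G : S.Space 1) : S.fluct G + S.ins G = S.keep := by
  simp [fluct, ins, keep]

/-- `(α, G)` acting in slot `i`. -/
def slotOp {n : ℕ} (i : Fin n) (p : S.SlotOp) : S.Space n →L[ℂ] S.Space n :=
  p.1 • ContinuousLinearMap.id ℂ _ + S.slot i p.2

theorem slotOp_tprod {n : ℕ} (i : Fin n) (p : S.SlotOp) (A : Fin n → S.Space 1) :
    S.slotOp i p (S.tprod A) = S.tprod (Function.update A i (S.act p (A i))) := by
  rw [slotOp, act, S.tprod_update_add, S.tprod_update_smul, S.tprod_update_smul, add_apply,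
    slot_tprod, Function.update_eq_self]
  rfl

theorem norm_slotOp_le {n : ℕ} (i : Fin n) (p : S.SlotOp) :
    ‖S.slotOp i p‖ ≤ ‖p.1‖ + ‖p.2‖ := by
  refine ContinuousLinearMap.opNorm_le_bound _ (by positivity) fun x => ?_
  rw [add_mul]
  refine (norm_add_le _ _).trans (add_le_add ?_ (S.norm_slot_apply_le i _ x))
  exact (norm_smul p.1 x).le

/-- The operator acting as `c i` on slot `i`, for all `i`. -/
def slots {n : ℕ} (c : Fin n → S.SlotOp) : S.Space n →L[ℂ] S.Space n :=
  ((List.finRange n).map fun i => S.slotOp i (c i)).prod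

theorem list_prod_slotOp_tprod {n : ℕ} (c : Fin n → S.SlotOp) (A : Fin n → S.Space 1)
    (l : List (Fin n)) (hl : l.Nodup) :
    (l.map fun i => S.slotOp i (c i)).prod (S.tprod A) =
      S.tprod fun i => if i ∈ l then S.act (c i) (A i) else A i := by
  induction l with
  | nil => simp
  | cons i l ih =>
    rw [List.nodup_cons] at hl
    rw [List.map_cons, List.prod_cons, mul_apply_eq_comp, ih hl.2, slotOp_tprod]
    congr 1
    funext k
    by_cases hk : k = i
    · subst hk
      simp [hl.1]
    · simp [hk]

@[simp] theorem slots_tprod {n : ℕ} (c : Fin n → S.SlotOp) (A : Fin n → S.Space 1) :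
    S.slots c (S.tprod A) = S.tprod fun i => S.act (c i) (A i) := by
  rw [slots, list_prod_slotOp_tprod _ _ _ _ (List.nodup_finRange n)]
  simp

theorem slots_keep {n : ℕ} : S.slots (fun _ : Fin n => S.keep) = ContinuousLinearMap.id ℂ _ :=
  S.clm_ext fun A => by simp

theorem slots_update_add {n : ℕ} (c : Fin n → S.SlotOp) (i : Fin n) (p q : S.SlotOp) :
    S.slots (Function.update c i (p + q)) =
      S.slots (Function.update c i p) + S.slots (Function.update c i q) :=
  S.clm_ext fun A => by
    have h : ∀ r : S.SlotOp, (fun k => S.act (Function.update c i r k) (A k)) =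
        Function.update (fun k => S.act (c k) (A k)) i (S.act r (A i)) := fun r => by
      funext k
      by_cases hk : k = i
      · subst hk; simp
      · simp [Function.update_of_ne hk]
    have h' : S.act (p + q) (A i) = S.act p (A i) + S.act q (A i) := by
      simp only [act, Prod.fst_add, Prod.snd_add, add_smul, smul_add]
      abel
    rw [add_apply, slots_tprod, slots_tprod, slots_tprod, h, h, h, h', S.tprod_update_add]

theorem slots_update_keep {n : ℕ} (i : Fin n) (p : S.SlotOp) :
    S.slots (Function.update (fun _ => S.keep) i p) = S.slotOp i p :=
  S.clm_ext fun A => by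
    rw [slots_tprod, slotOp_tprod]
    congr 1
    funext k
    by_cases hk : k = i
    · subst hk; simp
    · simp [Function.update_of_ne hk]

theorem slots_comp {n : ℕ} {c d e : Fin n → S.SlotOp}
    (h : ∀ i A, S.act (c i) (S.act (d i) A) = S.act (e i) A) :
    S.slots c ∘L S.slots d = S.slots e :=
  S.clm_ext fun A => by simp [h]

theorem slots_slots {n : ℕ} {c d e : Fin n → S.SlotOp}
    (h : ∀ i A, S.act (c i) (S.act (d i) A) = S.act (e i) A) (x : S.Space n) :
    S.slots c (S.slots d x) = S.slots e x := by
  rw [← slots_comp S h]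
  rfl

theorem perm_slots {n : ℕ} (π : Equiv.Perm (Fin n)) (c : Fin n → S.SlotOp) (x : S.Space n) :
    S.perm π (S.slots c x) = S.slots (fun i => c (π.symm i)) (S.perm π x) := by
  refine congrArg (fun L : S.Space n →L[ℂ] S.Space n => L x)
    (S.clm_ext (L := S.perm π ∘L S.slots c)
      (L' := S.slots (fun i => c (π.symm i)) ∘L S.perm π) fun A => ?_)
  simp [S.perm_tprod]

theorem norm_slots_le {n : ℕ} (c : Fin n → S.SlotOp) :
    ‖S.slots c‖ ≤ ∏ i, (‖(c i).1‖ + ‖(c i).2‖) := by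
  have h : ∀ l : List (Fin n), ‖(l.map fun i => S.slotOp i (c i)).prod‖ ≤
      (l.map fun i => ‖(c i).1‖ + ‖(c i).2‖).prod := by
    intro l
    induction l with
    | nil => exact ContinuousLinearMap.norm_id_le
    | cons i l ih =>
      simp only [List.map_cons, List.prod_cons]
      exact (norm_mul_le _ _).trans (mul_le_mul (S.norm_slotOp_le i _) ih (norm_nonneg _)
        (by positivity))
  refine (h _).trans (le_of_eq ?_)
  rw [← List.ofFn_eq_map, List.prod_ofFn]

theorem continuous_slots {n : ℕ} {X : Type*} [TopologicalSpace X] {c : X → Fin n → S.SlotOp}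
    (hc : Continuous c) : Continuous fun x => S.slots (c x) := by
  refine continuous_list_prod _ fun i _ => ?_
  have h := (continuous_apply i).comp hc
  refine ((continuous_fst.comp h).smul continuous_const).add ?_
  exact (S.slot i).continuous.comp (continuous_snd.comp h)

/-! ### Marginals -/

theorem marginal_self {n : ℕ} : S.marginal (le_refl n) = ContinuousLinearMap.id ℂ _ :=
  Nat.leRec_self _ _

theorem marginal_succ {j n : ℕ} (h : j ≤ n) :
    S.marginal (h.trans n.le_succ) = S.marginal h ∘L S.ptr n :=
  Nat.leRec_succ _ _ _

theorem marginal_tprod {j n : ℕ} (h : j ≤ n) (A : Fin n → S.Space 1) :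
    S.marginal h (S.tprod A) =
      (∏ i : Fin n with j ≤ i.val, S.ellL 1 (A i)) • S.tprod fun i => A (Fin.castLE h i) := by
  induction n, h using Nat.le_induction with
  | base =>
    rw [marginal_self, Finset.filter_false_of_mem]
    · simp
    · intro i _
      simp
  | succ n h ih =>
    rw [marginal_succ S h, ContinuousLinearMap.comp_apply, S.ptr_tprod, map_smul, ih, smul_smul]
    congr 1
    rw [Finset.prod_filter, Finset.prod_filter, Fin.prod_univ_castSucc, mul_comm]
    simp [h]

/-- The marginal of order `j`, with the remaining slots filled by a normalised element. -/
theorem norm_marginal {j n : ℕ} (h : j ≤ n) {F : S.Space 1} (hF : ‖F‖ = 1) (x : S.Space n) :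
    ‖S.marginal h x‖ = ‖S.slots (fun i => if i.val < j then S.keep else S.ins F) x‖ := by
  have h1 : S.slots (fun i => if i.val < j then S.keep else S.ins F) =
      (S.tensor (Nat.add_sub_cancel' h)).flip (S.tprod fun _ => F) ∘L S.marginal h := by
    refine S.clm_ext fun A => ?_
    rw [slots_tprod, ContinuousLinearMap.comp_apply, marginal_tprod, map_smul,
      ContinuousLinearMap.flip_apply, S.tensor_tprod]
    have e1 : (fun i => S.act (if i.val < j then S.keep else S.ins F) (A i)) =
        fun i : Fin n => (if j ≤ i.val then S.ellL 1 (A i) else 1) •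
          if i.val < j then A i else F := by
      funext i
      by_cases hi : i.val < j
      · simp [hi, not_le.mpr hi]
      · simp [hi, not_lt.mp hi]
    rw [e1, S.tprod_smul, Finset.prod_filter]
    congr 2
    funext i
    obtain ⟨i, rfl⟩ := (finCongr (Nat.add_sub_cancel' h)).surjective i
    refine Fin.addCases (fun i => ?_) (fun i => ?_) i
    · simp
      rfl
    · simp
  rw [h1, ContinuousLinearMap.comp_apply, ContinuousLinearMap.flip_apply, S.norm_tensor,
    S.norm_tprod]
  simp [hF]

end MarginalSystem

/-! ### The correlation error as a product of slot operators -/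

theorem prod_ofFn_swap_apply_of_ne {α : Type*} [DecidableEq α] {k : ℕ} (f g : Fin k → α) {y : α}
    (hf : ∀ s, y ≠ f s) (hg : ∀ s, y ≠ g s) :
    (List.ofFn fun s => Equiv.swap (f s) (g s)).prod y = y := by
  induction k with
  | zero => simp
  | succ k ih =>
    rw [List.ofFn_succ, List.prod_cons, Equiv.Perm.mul_apply,
      ih (fun s => f s.succ) (fun s => g s.succ) (fun s => hf _) (fun s => hg _),
      Equiv.swap_apply_of_ne_of_ne (hf 0) (hg 0)]

theorem prod_ofFn_swap_apply {j k : ℕ} (hk : k ≤ j) (f : Fin k → Fin j) (hf : StrictMono f)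
    (s : Fin k) :
    (List.ofFn fun s => Equiv.swap (f s) (Fin.castLE hk s)).prod (Fin.castLE hk s) = f s := by
  have hle : ∀ s : Fin k, s.val ≤ (f s).val := fun s => by
    obtain ⟨s, hs⟩ := s
    induction s with
    | zero => exact Nat.zero_le _
    | succ s ih =>
      have h := ih (by omega)
      have h2 : f ⟨s, by omega⟩ < f ⟨s + 1, hs⟩ := hf (by simp)
      have h3 : (f ⟨s, by omega⟩).val < (f ⟨s + 1, hs⟩).val := h2
      exact Nat.succ_le_of_lt (h.trans_lt h3)
  induction k with
  | zero => exact s.elim0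
  | succ k ih =>
    rw [List.ofFn_succ', List.concat_eq_append, List.prod_append, List.prod_singleton,
      Equiv.Perm.mul_apply]
    have hf' : StrictMono fun s : Fin k => f s.castSucc := fun a b hab => hf (by simpa using hab)
    refine Fin.lastCases ?_ (fun s => ?_) s
    · rw [Equiv.swap_apply_right]
      refine prod_ofFn_swap_apply_of_ne _ _ (fun s => ?_) fun s => ?_
      · exact (hf (Fin.castSucc_lt_last s)).ne'
      · refine Fin.ne_of_val_ne (ne_of_gt ?_)
        exact lt_of_lt_of_le s.2 (hle (Fin.last k))
    · rw [Equiv.swap_apply_of_ne_of_ne]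
      · exact ih (by omega) _ hf' s (fun s => hle s.castSucc)
      · refine Fin.ne_of_val_ne (ne_of_lt ?_)
        exact lt_of_lt_of_le s.2 (hle (Fin.last k))
      · refine Fin.ne_of_val_ne (ne_of_lt ?_)
        exact s.2

@[to_additive]
theorem prod_fin_split {M : Type*} [CommMonoid M] {j n : ℕ} (h : j ≤ n) (g : Fin n → M) :
    ∏ i, g i = (∏ i : Fin n with j ≤ i.val, g i) * ∏ i : Fin j, g (Fin.castLE h i) := by
  obtain ⟨k, rfl⟩ := Nat.exists_eq_add_of_le h
  rw [Finset.prod_filter, Fin.prod_univ_add, Fin.prod_univ_add, mul_comm]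
  congr 1
  have h1 : ∀ i : Fin j, ¬ j ≤ i.val := fun i => not_le.mpr i.2
  simp [h1]

theorem exists_perm_castLE {j n : ℕ} (h : j ≤ n) (π : Equiv.Perm (Fin j)) :
    ∃ ρ : Equiv.Perm (Fin n), (∀ i, ρ (Fin.castLE h i) = Fin.castLE h (π i)) ∧
      ∀ i, j ≤ i.val → ρ i = i := by
  refine ⟨π.extendDomain (Fin.castLEOrderIso h).toEquiv, fun i => ?_, fun i hi => ?_⟩
  · exact π.extendDomain_apply_image (Fin.castLEOrderIso h).toEquiv i
  · exact π.extendDomain_apply_not_subtype _ (not_lt.mpr hi)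

namespace StateAlgebra

variable {ι : Type*} (S : StateAlgebra ι)

/-- `(A₁, …, Aₙ) ↦ A₁ ⊗ ⋯ ⊗ Aₙ` as a multilinear map. -/
def tprodMultilinear (n : ℕ) : MultilinearMap ℂ (fun _ : Fin n => S.Space 1) (S.Space n) where
  toFun := S.tprod
  map_update_add' A i x y := by
    convert S.tprod_update_add A i x y
  map_update_smul' A i c x := by
    convert S.tprod_update_smul A i c x

end StateAlgebra

namespace MarginalSystem

variable {ι : Type*} (S : MarginalSystem ι)

theorem slotPerm_apply {j : ℕ} (K : Finset (Fin j)) (s : Fin K.card) :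
    slotPerm K (Fin.castLE (card_finset_fin_le K) s) = K.orderEmbOfFin rfl s :=
  prod_ofFn_swap_apply _ _ (K.orderEmbOfFin rfl).strictMono s

theorem slotPerm_symm_lt_iff {j : ℕ} (K : Finset (Fin j)) (i : Fin j) :
    ((slotPerm K).symm i).val < K.card ↔ i ∈ K := by
  constructor
  · intro h
    have h1 := slotPerm_apply K ⟨_, h⟩
    have h2 : Fin.castLE (card_finset_fin_le K) ⟨_, h⟩ = (slotPerm K).symm i := rfl
    rw [h2, Equiv.apply_symm_apply] at h1
    rw [h1]
    exact K.orderEmbOfFin_mem rfl _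
  · intro h
    have : i ∈ Set.range (K.orderEmbOfFin rfl) := by simpa using h
    obtain ⟨s, rfl⟩ := this
    rw [← slotPerm_apply, Equiv.symm_apply_apply]
    exact s.2

/-- `F` is inserted in the slots of `K`. -/
def insOn {j n : ℕ} (F : S.Space 1) (K : Finset (Fin j)) (i : Fin n) : S.SlotOp :=
  if ∃ h : i.val < j, (⟨i, h⟩ : Fin j) ∈ K then S.ins F else S.keep

theorem marginal_insOn_tprod {j n : ℕ} (hj : j ≤ n) (F : S.Space 1) (K : Finset (Fin j))
    (A : Fin n → S.Space 1) : S.marginal hj (S.slots (S.insOn F K) (S.tprod A)) =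
      (∏ i : Fin n, if ∀ h : i.val < j, (⟨i, h⟩ : Fin j) ∈ K then S.ellL 1 (A i) else 1) •
        S.tprod fun i => if i ∈ K then F else A (Fin.castLE hj i) := by
  have e1 : (fun i => S.act (S.insOn F K i) (A i)) =
      fun i : Fin n => (if ∃ h : i.val < j, (⟨i, h⟩ : Fin j) ∈ K then S.ellL 1 (A i) else 1) •
        if ∃ h : i.val < j, (⟨i, h⟩ : Fin j) ∈ K then F else A i := by
    funext i
    unfold insOn
    split_ifs <;> simp
  rw [slots_tprod, e1, S.tprod_smul, map_smul, marginal_tprod, smul_smul, Finset.prod_filter,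
    ← Finset.prod_mul_distrib]
  congr 1
  · refine Finset.prod_congr rfl fun i _ => ?_
    by_cases hi : i.val < j
    · have : ¬ j ≤ i.val := not_le.mpr hi
      simp [hi, this]
    · simp [hi, not_lt.mp hi]
  · congr 1
    funext i
    simp

theorem marginal_fluct {j n : ℕ} (hj : j ≤ n) (F : S.Space 1) (x : S.Space n) :
    S.marginal hj (S.slots (fun i => if i.val < j then S.fluct F else S.keep) x) =
      ∑ K : Finset (Fin j), (-1 : ℂ) ^ K.card • S.marginal hj (S.slots (S.insOn F K) x) := by
  have h : S.marginal hj ∘L S.slots (fun i => if i.val < j then S.fluct F else S.keep) =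
      ∑ K : Finset (Fin j), (-1 : ℂ) ^ K.card • (S.marginal hj ∘L S.slots (S.insOn F K)) := by
    refine S.clm_ext fun A => ?_
    rw [ContinuousLinearMap.comp_apply, slots_tprod, marginal_tprod, sum_apply]
    simp only [smul_apply, ContinuousLinearMap.comp_apply, marginal_insOn_tprod]
    have e1 : (fun i : Fin j => S.act (if (Fin.castLE hj i).val < j then S.fluct F else S.keep)
        (A (Fin.castLE hj i))) = (fun i : Fin j => (-S.ellL 1 (A (Fin.castLE hj i))) • F) +
          fun i : Fin j => A (Fin.castLE hj i) := by
      funext i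
      simp [sub_eq_add_neg, add_comm]
    rw [e1]
    change _ • S.tprodMultilinear j _ = _
    rw [MultilinearMap.map_add_univ, Finset.smul_sum]
    refine Finset.sum_congr rfl fun K _ => ?_
    have e2 : (K.piecewise (fun i : Fin j => (-S.ellL 1 (A (Fin.castLE hj i))) • F)
        fun i : Fin j => A (Fin.castLE hj i)) = fun i =>
          (if i ∈ K then -S.ellL 1 (A (Fin.castLE hj i)) else 1) •
            if i ∈ K then F else A (Fin.castLE hj i) := by
      funext i
      by_cases hi : i ∈ K <;> simp [hi]
    rw [e2]
    change _ • S.tprod _ = _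
    rw [S.tprod_smul, smul_smul, smul_smul]
    congr 1
    rw [prod_fin_split hj fun i => if ∀ h : i.val < j, (⟨i, h⟩ : Fin j) ∈ K then
      S.ellL 1 (A i) else 1, mul_left_comm]
    congr 1
    · refine Finset.prod_congr rfl fun i hi => ?_
      have hi : ¬ i.val < j := not_lt.mpr (Finset.mem_filter.mp hi).2
      simp [hi]
    · have h1 : ∀ i : Fin j, (⟨(Fin.castLE hj i).val, i.2⟩ : Fin j) = i := fun _ => rfl
      simp only [Fin.val_castLE, Fin.is_lt, forall_true_left, Fin.eta]
      rw [← Finset.prod_filter, ← Finset.prod_filter, Finset.filter_univ_mem, Finset.prod_neg]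
  have h' := congrArg (fun L : S.Space n →L[ℂ] S.Space j => L x) h
  simpa [sum_apply] using h'

theorem perm_tensor_marginal {j n : ℕ} (hj : j ≤ n) (F : S.Space 1) (K : Finset (Fin j))
    (h : Kᶜ.card + K.card = j) {x : S.Space n} (hx : S.IsSymmetric x) :
    S.perm (slotPerm Kᶜ) (S.tensor h (S.marginal ((card_finset_fin_le Kᶜ).trans hj) x)
      (S.tprod fun _ : Fin K.card => F)) = S.marginal hj (S.slots (S.insOn F K) x) := by
  obtain ⟨ρ, hρ, hρ'⟩ := exists_perm_castLE hj (slotPerm Kᶜ)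
  have hs : ∀ i, ρ.symm (Fin.castLE hj i) = Fin.castLE hj ((slotPerm Kᶜ).symm i) := fun i => by
    rw [Equiv.symm_apply_eq, hρ, Equiv.apply_symm_apply]
  have hs' : ∀ i, j ≤ i.val → ρ.symm i = i := fun i hi => by
    rw [Equiv.symm_apply_eq, hρ' i hi]
  have hc : Kᶜ.card ≤ j := card_finset_fin_le Kᶜ
  suffices h : S.perm (slotPerm Kᶜ) ∘L (S.tensor h).flip (S.tprod fun _ : Fin K.card => F) ∘L
      S.marginal (hc.trans hj) = S.marginal hj ∘L S.slots (S.insOn F K) ∘L S.perm ρ by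
    have h' := congrArg (fun L : S.Space n →L[ℂ] S.Space j => L x) h
    simp only [ContinuousLinearMap.comp_apply, hx ρ] at h'
    exact h'
  refine S.clm_ext fun A => ?_
  simp only [ContinuousLinearMap.comp_apply, S.perm_tprod, marginal_insOn_tprod, marginal_tprod,
    map_smul, ContinuousLinearMap.flip_apply, S.tensor_tprod]
  congr 1
  · rw [Finset.prod_filter, ← Equiv.prod_comp ρ.symm]
    refine Finset.prod_congr rfl fun i _ => ?_
    congr 1
    rw [eq_iff_iff]
    by_cases hi : i.val < j
    · have h1 := hs ⟨i, hi⟩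
      have h2 : Fin.castLE hj ⟨i, hi⟩ = i := rfl
      rw [h2] at h1
      rw [h1, Fin.val_castLE, ← not_lt, slotPerm_symm_lt_iff]
      simp [hi]
    · rw [hs' i (not_lt.mp hi)]
      simp only [hi, IsEmpty.forall_iff, iff_true]
      exact hc.trans (not_lt.mp hi)
  · congr 1
    funext i
    rw [hs]
    have h1 := slotPerm_symm_lt_iff Kᶜ i
    rw [Finset.mem_compl] at h1
    by_cases hi : i ∈ K
    · rw [if_pos hi]
      have h2 : Kᶜ.card ≤ ((slotPerm Kᶜ).symm i).val := not_lt.mp fun h3 => h1.mp h3 hi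
      generalize (slotPerm Kᶜ).symm i = k at h2
      obtain ⟨k, rfl⟩ := (finCongr h).surjective k
      revert h2
      refine Fin.addCases (fun k => ?_) (fun k => ?_) k
      · intro h2
        exact absurd k.2 (not_lt.mpr h2)
      · simp
    · rw [if_neg hi]
      have h2 := h1.mpr hi
      generalize (slotPerm Kᶜ).symm i = k at h2
      obtain ⟨k, rfl⟩ := (finCongr h).surjective k
      revert h2
      refine Fin.addCases (fun k => ?_) (fun k => ?_) k
      · intro _
        simp
        rfl
      · simp

theorem correlationError_eq {j n : ℕ} (hj : j ≤ n) (F : S.Space 1) {x : S.Space n}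
    (hx : S.IsSymmetric x) : S.correlationError x F hj =
      S.marginal hj (S.slots (fun i => if i.val < j then S.fluct F else S.keep) x) := by
  rw [marginal_fluct, correlationError]
  exact Finset.sum_congr rfl fun K _ => by rw [S.perm_tensor_marginal hj F K _ hx]

end MarginalSystem

/-! ### Two-body operators and slot operators -/

namespace MarginalSystem

variable {ι : Type*} (S : MarginalSystem ι)

theorem tprod_eq_tensor {j k : ℕ} (A : Fin (j + k) → S.Space 1) :
    S.tprod A = S.tensor rfl (S.tprod fun i => A (Fin.castAdd k i))
      (S.tprod fun i => A (Fin.natAdd j i)) := by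
  rw [S.tensor_tprod]
  congr 1
  funext i
  exact (congrFun (Fin.append_castAdd_natAdd (f := A)) i).symm

theorem clm_ext_tensor {j k : ℕ} {X : Type*} [NormedAddCommGroup X] [NormedSpace ℂ X]
    {L L' : S.Space (j + k) →L[ℂ] X}
    (h : ∀ A b, L (S.tensor rfl (S.tprod A) (S.tprod b)) =
      L' (S.tensor rfl (S.tprod A) (S.tprod b))) : L = L' :=
  S.clm_ext fun A => by rw [tprod_eq_tensor, h]

theorem slots_tensor {j k : ℕ} (c : Fin (j + k) → S.SlotOp) (A : S.Space j)
    (b : Fin k → S.Space 1) :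
    S.slots c (S.tensor rfl A (S.tprod b)) =
      S.tensor rfl (S.slots (fun i => c (Fin.castAdd k i)) A)
        (S.tprod fun i => S.act (c (Fin.natAdd j i)) (b i)) := by
  suffices h : S.slots c ∘L (S.tensor rfl).flip (S.tprod b) =
      (S.tensor rfl).flip (S.tprod fun i => S.act (c (Fin.natAdd j i)) (b i)) ∘L
        S.slots (fun i => c (Fin.castAdd k i)) from
    congrArg (fun L : S.Space j →L[ℂ] S.Space (j + k) => L A) h
  refine S.clm_ext fun A => ?_
  simp only [ContinuousLinearMap.comp_apply, ContinuousLinearMap.flip_apply, slots_tprod,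
    S.tensor_tprod]
  congr 1
  funext i
  refine Fin.addCases (fun i => ?_) (fun i => ?_) i <;> simp

theorem perm_tensor_of_fix {j k : ℕ} (ρ : Equiv.Perm (Fin (j + k)))
    (hρ : ∀ i : Fin j, ρ (Fin.castAdd k i) = Fin.castAdd k i) (b : Fin k → S.Space 1) :
    ∃ b' : Fin k → S.Space 1, ∀ A : S.Space j,
      S.perm ρ (S.tensor rfl A (S.tprod b)) = S.tensor rfl A (S.tprod b') := by
  refine ⟨fun i => Fin.append (fun _ => 0) b (ρ.symm (Fin.natAdd j i)), fun A => ?_⟩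
  suffices h : S.perm ρ ∘L (S.tensor rfl).flip (S.tprod b) = (S.tensor rfl).flip
      (S.tprod fun i => Fin.append (fun _ => 0) b (ρ.symm (Fin.natAdd j i))) from
    congrArg (fun L : S.Space j →L[ℂ] S.Space (j + k) => L A) h
  refine S.clm_ext fun A => ?_
  simp only [ContinuousLinearMap.comp_apply, ContinuousLinearMap.flip_apply, S.perm_tprod,
    S.tensor_tprod]
  congr 1
  funext i
  refine Fin.addCases (fun i => ?_) (fun i => ?_) i
  · have h : ρ.symm (Fin.castAdd k i) = Fin.castAdd k i := by
      rw [Equiv.symm_apply_eq, hρ]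
    simp [h]
  · simp only [Fin.cast_eq_self, Fin.append_right]
    have h : ∀ i' : Fin j, ρ.symm (Fin.natAdd j i) ≠ Fin.castAdd k i' := fun i' h => by
      rw [Equiv.symm_apply_eq, hρ] at h
      have := congrArg Fin.val h
      simp at this
      omega
    revert h
    generalize ρ.symm (Fin.natAdd j i) = l
    refine Fin.addCases (fun l => ?_) (fun l => ?_) l
    · exact fun h => absurd rfl (h l)
    · simp

theorem perm_swap_tensor {k : ℕ} (A : S.Space 2) (b : Fin k → S.Space 1) :
    S.perm (Equiv.swap (Fin.castAdd k 0) (Fin.castAdd k 1)) (S.tensor rfl A (S.tprod b)) =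
      S.tensor rfl (S.perm (Equiv.swap 0 1) A) (S.tprod b) := by
  suffices h : S.perm (Equiv.swap (Fin.castAdd k 0) (Fin.castAdd k 1)) ∘L
      (S.tensor rfl).flip (S.tprod b) = (S.tensor rfl).flip (S.tprod b) ∘L
        S.perm (Equiv.swap 0 1) from
    congrArg (fun L : S.Space 2 →L[ℂ] S.Space (2 + k) => L A) h
  refine S.clm_ext fun A => ?_
  simp only [ContinuousLinearMap.comp_apply, ContinuousLinearMap.flip_apply, S.perm_tprod,
    S.tensor_tprod]
  congr 1
  funext i
  simp only [Equiv.symm_swap, Fin.cast_eq_self]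
  refine Fin.addCases (fun i => ?_) (fun i => ?_) i
  · rw [← (Fin.castAdd_injective 2 k).map_swap]
    simp
  · rw [Equiv.swap_apply_of_ne_of_ne]
    · simp
    · exact Fin.ne_of_val_ne (by simp)
    · exact Fin.ne_of_val_ne (by simp; omega)

end MarginalSystem

namespace TwoBodyPotential

variable {ι : Type*} {S : MarginalSystem ι} (P : TwoBodyPotential S)

theorem norm_ampliation_le (n : ℕ) : ‖P.ampliation n‖ ≤ ‖P.V‖ := by
  unfold ampliation
  split_ifs with h
  · exact (P.exists_ampliation n h).choose_spec.2
  · simp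

theorem ampliation_tensor {m : ℕ} (A : S.Space 2) (B : S.Space m) :
    P.ampliation (2 + m) (S.tensor rfl A B) = S.tensor rfl (P.V A) B := by
  unfold ampliation
  rw [dif_pos (Nat.le_add_right 2 m)]
  exact (P.exists_ampliation (2 + m) (Nat.le_add_right 2 m)).choose_spec.1 m rfl A B

theorem norm_pair_apply_le {n : ℕ} (i r : Fin n) (x : S.Space n) :
    ‖P.pair i r x‖ ≤ ‖P.V‖ * ‖x‖ := by
  rw [pair, ContinuousLinearMap.comp_apply, ContinuousLinearMap.comp_apply, S.norm_perm]
  refine ((P.ampliation n).le_of_opNorm_le (P.norm_ampliation_le n) _).trans ?_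
  rw [S.norm_perm]

theorem ampliation_slots {m : ℕ} (c : Fin (2 + m) → S.SlotOp)
    (hc : ∀ i : Fin 2, c (Fin.castAdd m i) = S.keep) (x : S.Space (2 + m)) :
    P.ampliation (2 + m) (S.slots c x) = S.slots c (P.ampliation (2 + m) x) := by
  refine congrArg (fun L : S.Space (2 + m) →L[ℂ] S.Space (2 + m) => L x)
    (S.clm_ext_tensor (L := P.ampliation (2 + m) ∘L S.slots c)
      (L' := S.slots c ∘L P.ampliation (2 + m)) fun A b => ?_)
  simp only [ContinuousLinearMap.comp_apply, S.slots_tensor, hc, ampliation_tensor, S.slots_keep]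
  rfl

theorem ampliation_perm_of_fix {m : ℕ} (ρ : Equiv.Perm (Fin (2 + m)))
    (hρ : ∀ i : Fin 2, ρ (Fin.castAdd m i) = Fin.castAdd m i) (x : S.Space (2 + m)) :
    P.ampliation (2 + m) (S.perm ρ x) = S.perm ρ (P.ampliation (2 + m) x) := by
  refine congrArg (fun L : S.Space (2 + m) →L[ℂ] S.Space (2 + m) => L x)
    (S.clm_ext_tensor (L := P.ampliation (2 + m) ∘L S.perm ρ)
      (L' := S.perm ρ ∘L P.ampliation (2 + m)) fun A b => ?_)
  obtain ⟨b', hb'⟩ := S.perm_tensor_of_fix ρ hρ b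
  simp only [ContinuousLinearMap.comp_apply, ampliation_tensor, hb']

theorem perm_swap_ampliation {m : ℕ} {x : S.Space (2 + m)}
    (hx : S.perm (Equiv.swap (Fin.castAdd m 0) (Fin.castAdd m 1)) x = x) :
    S.perm (Equiv.swap (Fin.castAdd m 0) (Fin.castAdd m 1)) (P.ampliation (2 + m) x) =
      P.ampliation (2 + m) x := by
  set σ := S.perm (Equiv.swap (Fin.castAdd m (0 : Fin 2)) (Fin.castAdd m 1)) with hσ
  have key : σ ∘L P.ampliation (2 + m) ∘L (ContinuousLinearMap.id ℂ _ + σ) =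
      P.ampliation (2 + m) ∘L (ContinuousLinearMap.id ℂ _ + σ) := by
    refine S.clm_ext_tensor fun A b => ?_
    have h1 : (ContinuousLinearMap.id ℂ (S.Space (2 + m)) + σ) (S.tensor rfl (S.tprod A) (S.tprod b)) =
        S.tensor rfl (S.tprod A + S.perm (Equiv.swap (0 : Fin 2) 1) (S.tprod A)) (S.tprod b) := by
      rw [add_apply, hσ, S.perm_swap_tensor, map_add]
      rfl
    rw [ContinuousLinearMap.comp_apply, ContinuousLinearMap.comp_apply, h1, ampliation_tensor]
    have h2 : S.IsSymmetric (S.tprod A + S.perm (Equiv.swap (0 : Fin 2) 1) (S.tprod A)) := by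
      intro π
      have hπ : π = 1 ∨ π = Equiv.swap 0 1 := by
        revert π
        decide
      rcases hπ with rfl | rfl
      · rw [S.perm_one]; rfl
      · rw [map_add, ← S.perm_mul_apply, Equiv.swap_mul_self, S.perm_one, add_comm]
        rfl
    exact (S.perm_swap_tensor _ _).trans (by rw [P.symm _ h2])
  have h := congrArg (fun L : S.Space (2 + m) →L[ℂ] S.Space (2 + m) => L x) key
  simp only [ContinuousLinearMap.comp_apply, add_apply, ContinuousLinearMap.id_apply, hx,
    map_add] at h
  have h2 : (2 : ℂ) • σ (P.ampliation (2 + m) x) = (2 : ℂ) • P.ampliation (2 + m) x := by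
    rw [two_smul, two_smul, h]
  exact smul_right_injective _ two_ne_zero h2

theorem ampliation_exchange {m : ℕ} (F : S.Space 1) (x : S.Space (2 + m)) :
    S.slots (Function.update (fun _ => S.keep) (Fin.castAdd m 1) (S.ins F))
      (P.ampliation (2 + m) (S.slots (Function.update (Function.update (fun _ => S.keep)
        (Fin.castAdd m 0) (S.ins F)) (Fin.castAdd m 1) (S.ins F)) x)) =
      S.slots (Function.update (Function.update (fun _ => S.keep)
        (Fin.castAdd m 0) (S.ins (P.Q F F))) (Fin.castAdd m 1) (S.ins F)) x := by
  set c : Fin (2 + m) → S.SlotOp := Function.update (fun _ => S.keep) (Fin.castAdd m 1) (S.ins F)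
  set d : S.Space 1 → Fin (2 + m) → S.SlotOp := fun G => Function.update (Function.update
    (fun _ => S.keep) (Fin.castAdd m 0) (S.ins G)) (Fin.castAdd m 1) (S.ins F) with hd
  change S.slots c (P.ampliation (2 + m) (S.slots (d F) x)) = S.slots (d (P.Q F F)) x
  have hc0 : (fun i => c (Fin.castAdd m i)) =
      Function.update (fun _ : Fin 2 => S.keep) 1 (S.ins F) :=
    Function.update_comp_eq_of_injective _ (Fin.castAdd_injective 2 m) 1 _
  have hne : ∀ (i : Fin m) (k : Fin 2), Fin.natAdd 2 i ≠ Fin.castAdd m k := fun i k =>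
    Fin.ne_of_val_ne (by simp; omega)
  have hc1 : ∀ i, c (Fin.natAdd 2 i) = S.keep := fun i => Function.update_of_ne (hne _ _) _ _
  have hd0 : ∀ G, d G (Fin.castAdd m 0) = S.ins G := fun G => by
    rw [hd]
    dsimp only
    rw [Function.update_of_ne, Function.update_self]
    exact Fin.ne_of_val_ne (by simp)
  have hd1 : ∀ G, d G (Fin.castAdd m 1) = S.ins F := fun G => Function.update_self _ _ _
  have hd2 : ∀ G i, d G (Fin.natAdd 2 i) = S.keep := fun G i => by
    rw [hd]
    dsimp only
    rw [Function.update_of_ne (hne _ _), Function.update_of_ne (hne _ _)]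
  have h2 : ∀ G H : S.Space 1, S.tprod ![G, H] = S.tensor (rfl : 1 + 1 = 2) G H := fun G H => by
    rw [S.tprod_succ]
    have : (fun i : Fin 1 => ![G, H] i.castSucc) = fun _ => G := by
      funext i
      rw [Subsingleton.elim i 0]
      rfl
    rw [this, S.tprod_one]
    rfl
  have hdA : ∀ G (A : Fin 2 → S.Space 1), S.slots (fun i => d G (Fin.castAdd m i)) (S.tprod A) =
      (S.ellL 1 (A 0) * S.ellL 1 (A 1)) • S.tensor (rfl : 1 + 1 = 2) G F := fun G A => by
    rw [S.slots_tprod]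
    have : (fun i => S.act (d G (Fin.castAdd m i)) (A i)) =
        fun i => S.ellL 1 (A i) • ![G, F] i := by
      funext i
      fin_cases i
      · exact (congrArg (fun p => S.act p (A 0)) (hd0 G)).trans (S.act_ins _ _)
      · exact (congrArg (fun p => S.act p (A 1)) (hd1 G)).trans (S.act_ins _ _)
    rw [this, S.tprod_smul, Fin.prod_univ_two, h2]
  refine congrArg (fun L : S.Space (2 + m) →L[ℂ] S.Space (2 + m) => L x)
    (S.clm_ext_tensor (L := S.slots c ∘L P.ampliation (2 + m) ∘L S.slots (d F))
      (L' := S.slots (d (P.Q F F))) fun A b => ?_)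
  simp only [ContinuousLinearMap.comp_apply, S.slots_tensor, ampliation_tensor, hc0, hc1, hd2,
    S.act_keep, hdA, map_smul, S.slots_update_keep, smul_apply]
  congr 2
  congr 1
  have h3 : ∀ y : S.Space 2, S.slotOp 1 (S.ins F) y = S.tensor (rfl : 1 + 1 = 2) (S.ptr 1 y) F := by
    intro y
    have h4 : Equiv.swap (1 : Fin 2) (Fin.last 1) = 1 := Equiv.swap_self _
    simp only [MarginalSystem.slotOp, MarginalSystem.ins, zero_smul, zero_add]
    rw [S.slot_apply, h4, S.perm_one]
    rfl
  exact h3 _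

end TwoBodyPotential

namespace TwoBodyPotential

variable {ι : Type*} {S : MarginalSystem ι} (P : TwoBodyPotential S)

theorem toFront_left {m : ℕ} {i r : Fin (2 + m)} (h : i ≠ r) :
    toFront i r i = Fin.castAdd m 0 := by
  have ha : (⟨0, i.pos⟩ : Fin (2 + m)) = Fin.castAdd m 0 := rfl
  have hb : (⟨1 % (2 + m), Nat.mod_lt 1 i.pos⟩ : Fin (2 + m)) = Fin.castAdd m 1 :=
    Fin.ext (Nat.mod_eq_of_lt (by omega))
  have hab : (Fin.castAdd m 0 : Fin (2 + m)) ≠ Fin.castAdd m 1 := Fin.ne_of_val_ne (by simp)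
  simp only [toFront, ha, hb, Equiv.Perm.mul_apply, Equiv.swap_apply_right]
  rw [Equiv.swap_apply_of_ne_of_ne hab]
  intro h'
  have h2 := congrArg (Equiv.swap (Fin.castAdd m 0) i) h'
  rw [Equiv.swap_apply_left, Equiv.swap_apply_self] at h2
  exact h h2

theorem toFront_right {m : ℕ} {i r : Fin (2 + m)} :
    toFront i r r = Fin.castAdd m 1 := by
  have hb : (⟨1 % (2 + m), Nat.mod_lt 1 i.pos⟩ : Fin (2 + m)) = Fin.castAdd m 1 :=
    Fin.ext (Nat.mod_eq_of_lt (by omega))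
  simp only [toFront, hb, Equiv.Perm.mul_apply, Equiv.swap_apply_right]

theorem exists_eq_two_add {n : ℕ} {i r : Fin n} (h : i ≠ r) : ∃ m, n = 2 + m := by
  have h1 : i.val ≠ r.val := fun h' => h (Fin.ext h')
  exact ⟨n - 2, by omega⟩

theorem pair_slots {n : ℕ} {i r : Fin n} (h : i ≠ r) (c : Fin n → S.SlotOp) (hi : c i = S.keep)
    (hr : c r = S.keep) (x : S.Space n) :
    P.pair i r (S.slots c x) = S.slots c (P.pair i r x) := by
  obtain ⟨m, rfl⟩ := exists_eq_two_add h
  simp only [pair, ContinuousLinearMap.comp_apply, S.perm_slots]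
  rw [P.ampliation_slots, S.perm_slots]
  · congr 2
    funext k
    exact congrArg c ((toFront i r).symm_apply_apply k)
  · intro k
    fin_cases k
    · exact (congrArg c ((Equiv.symm_apply_eq _).mpr (toFront_left h).symm)).trans hi
    · exact (congrArg c ((Equiv.symm_apply_eq _).mpr toFront_right.symm)).trans hr

theorem pair_exchange {n : ℕ} {i r : Fin n} (h : i ≠ r) (F : S.Space 1) (x : S.Space n) :
    S.slots (Function.update (fun _ => S.keep) r (S.ins F)) (P.pair i r
      (S.slots (Function.update (Function.update (fun _ => S.keep) i (S.ins F)) r (S.ins F)) x)) =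
      S.slots (Function.update (Function.update (fun _ => S.keep) i (S.ins (P.Q F F)))
        r (S.ins F)) x := by
  obtain ⟨m, rfl⟩ := exists_eq_two_add h
  set τ := toFront i r with hτ
  have h0 : τ i = Fin.castAdd m 0 := toFront_left h
  have h1 : τ r = Fin.castAdd m 1 := toFront_right
  have hup : ∀ (c : Fin (2 + m) → S.SlotOp) (k : Fin (2 + m)) (p : S.SlotOp),
      (fun l => Function.update c k p (τ.symm l)) = Function.update (fun l => c (τ.symm l)) (τ k) p :=
    fun c k p => by
      funext l
      by_cases hl : l = τ k
      · subst hl; simp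
      · rw [Function.update_of_ne hl, Function.update_of_ne]
        exact fun h' => hl ((Equiv.symm_apply_eq _).mp h')
  have hinj : ∀ y z : S.Space (2 + m), S.perm τ y = S.perm τ z → y = z := fun y z hyz => by
    have := congrArg (S.perm τ⁻¹) hyz
    simpa only [← S.perm_mul_apply, inv_mul_cancel, S.perm_one,
      ContinuousLinearMap.id_apply] using this
  apply hinj
  have hp : ∀ y, S.perm τ (P.pair i r y) = P.ampliation (2 + m) (S.perm τ y) := fun y => by
    simp only [pair, ContinuousLinearMap.comp_apply, ← hτ]
    rw [← S.perm_mul_apply, mul_inv_cancel, S.perm_one]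
    rfl
  rw [S.perm_slots, hp, S.perm_slots, S.perm_slots]
  simp only [hup, h0, h1]
  exact P.ampliation_exchange F _

theorem pair_comm {n : ℕ} {i r : Fin n} (h : i ≠ r) {x : S.Space n} (hx : S.IsSymmetric x)
    (π : Equiv.Perm (Fin n)) :
    S.perm π (P.pair i r x) = P.pair (π i) (π r) x ∧ P.pair r i x = P.pair i r x := by
  obtain ⟨m, rfl⟩ := exists_eq_two_add h
  have hfix : ∀ ρ ρ' : Equiv.Perm (Fin (2 + m)), ρ (Fin.castAdd m 0) = ρ' (Fin.castAdd m 0) →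
      ρ (Fin.castAdd m 1) = ρ' (Fin.castAdd m 1) →
      S.perm ρ (P.ampliation (2 + m) x) = S.perm ρ' (P.ampliation (2 + m) x) := by
    intro ρ ρ' h0 h1
    have h2 := P.ampliation_perm_of_fix (ρ⁻¹ * ρ') (fun k => by
      rw [Equiv.Perm.mul_apply, Equiv.Perm.inv_def, Equiv.symm_apply_eq]
      fin_cases k
      · exact h0.symm
      · exact h1.symm) x
    rw [hx, S.perm_mul_apply] at h2
    nth_rw 1 [h2]
    rw [← S.perm_mul_apply, mul_inv_cancel, S.perm_one]
    rfl
  have hinv : ∀ (i r k : Fin (2 + m)) (l), toFront i r k = l → (toFront i r)⁻¹ l = k :=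
    fun i r k l hk => by rw [Equiv.Perm.inv_def, Equiv.symm_apply_eq, hk]
  simp only [pair, ContinuousLinearMap.comp_apply, hx (toFront _ _)]
  constructor
  · rw [← S.perm_mul_apply]
    have hπ : π i ≠ π r := fun h' => h (π.injective h')
    apply hfix
    · rw [Equiv.Perm.mul_apply, hinv i r i _ (toFront_left h), hinv _ _ (π i) _ (toFront_left hπ)]
    · rw [Equiv.Perm.mul_apply, hinv i r r _ toFront_right, hinv _ _ (π r) _ toFront_right]
  · nth_rw 1 [← P.perm_swap_ampliation (hx _)]
    rw [← S.perm_mul_apply]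
    apply hfix
    · rw [Equiv.Perm.mul_apply, Equiv.swap_apply_left, hinv r i i _ toFront_right,
        hinv i r i _ (toFront_left h)]
    · rw [Equiv.Perm.mul_apply, Equiv.swap_apply_right, hinv r i r _ (toFront_left h.symm),
        hinv i r r _ toFront_right]

theorem total_symm {n : ℕ} {x : S.Space n} (hx : S.IsSymmetric x) :
    S.IsSymmetric (P.total n x) := by
  have h2 : (2 : ℂ) • P.total n x =
      ∑ p : Fin n × Fin n with p.1 ≠ p.2, P.pair p.1 p.2 x := by
    have h1 : P.total n x = ∑ p : Fin n × Fin n with p.1 < p.2, P.pair p.1 p.2 x := by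
      rw [total, sum_apply, Finset.sum_filter, Fintype.sum_prod_type]
      refine Finset.sum_congr rfl fun i _ => ?_
      rw [sum_apply, Finset.sum_filter]
    have h1' : P.total n x = ∑ p : Fin n × Fin n with p.2 < p.1, P.pair p.1 p.2 x := by
      rw [h1]
      refine Finset.sum_bij (fun p _ => p.swap) ?_ ?_ ?_ ?_
      · intro p hp
        simpa using hp
      · intro p _ q _ hpq
        exact Prod.swap_injective hpq
      · intro p hp
        exact ⟨p.swap, by simpa using hp, by simp⟩
      · intro p hp
        have hp' : p.1 < p.2 := by simpa using hp
        exact ((P.pair_comm hp'.ne hx 1).2).symm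
    rw [two_smul]
    nth_rw 1 [h1]
    rw [h1', ← Finset.sum_union]
    · refine Finset.sum_congr ?_ fun _ _ => rfl
      ext p
      simp [lt_or_lt_iff_ne]
    · rw [Finset.disjoint_filter]
      intro p _ h h'
      exact lt_asymm h h'
  intro π
  have h3 : S.perm π ((2 : ℂ) • P.total n x) = (2 : ℂ) • P.total n x := by
    rw [h2, map_sum]
    refine Finset.sum_bij (fun p _ => (π p.1, π p.2)) ?_ ?_ ?_ ?_
    · intro p hp
      simpa using hp
    · intro p _ q _ hpq
      simpa [Prod.ext_iff] using hpq
    · intro p hp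
      exact ⟨(π.symm p.1, π.symm p.2), by simpa using hp, by simp⟩
    · intro p hp
      exact (P.pair_comm (by simpa using hp) hx π).1
  rw [map_smul] at h3
  exact smul_right_injective _ two_ne_zero h3

theorem norm_total_apply_le (n : ℕ) (x : S.Space n) :
    ‖P.total n x‖ ≤ (n : ℝ) ^ 2 / 2 * ‖P.V‖ * ‖x‖ := by
  rw [total, sum_apply]
  have h1 : ∀ i : Fin n, ‖(∑ r : Fin n with i < r, P.pair i r) x‖ ≤
      ((n : ℝ) - 1 - i.val) * (‖P.V‖ * ‖x‖) := by
    intro i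
    rw [sum_apply]
    refine (norm_sum_le_of_le _ fun r _ => P.norm_pair_apply_le i r x).trans (le_of_eq ?_)
    rw [Finset.sum_const, nsmul_eq_mul]
    congr 1
    have : Finset.univ.filter (fun r => i < r) = Finset.Ioi i := by ext; simp
    rw [this, Fin.card_Ioi, Nat.cast_sub (by omega), Nat.cast_sub (by have := i.2; omega)]
    simp
  refine (norm_sum_le_of_le _ fun i _ => h1 i).trans ?_
  rw [← Finset.sum_mul, mul_assoc]
  refine mul_le_mul_of_nonneg_right ?_ (by positivity)
  rw [Finset.sum_sub_distrib, Fin.sum_univ_eq_sum_range (fun i => (i : ℝ)), Finset.sum_const,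
    Finset.card_univ, Fintype.card_fin, nsmul_eq_mul]
  have h2 : ∀ k : ℕ, (∑ i ∈ Finset.range k, (i : ℝ)) = k * (k - 1) / 2 := by
    intro k
    induction k with
    | zero => simp
    | succ k ih => rw [Finset.sum_range_succ, ih]; push_cast; ring
  rw [h2]
  nlinarith [(Nat.cast_nonneg n : (0 : ℝ) ≤ n)]

end TwoBodyPotential

/-! ### The interaction acting on correlation errors -/

namespace MarginalSystem

variable {ι : Type*} (S : MarginalSystem ι)

/-- Fluctuations around `F` in the slots of `s`, and `F` in the other slots. -/
def mix {n : ℕ} (F : S.Space 1) (s : Finset (Fin n)) (i : Fin n) : S.SlotOp :=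
  if i ∈ s then S.fluct F else S.ins F

/-- Fluctuations around `F` in the first `j` slots. -/
def fluctBelow {n : ℕ} (F : S.Space 1) (j : ℕ) (i : Fin n) : S.SlotOp :=
  if i.val < j then S.fluct F else S.keep

/-- The slots with number less than `j`. -/
def below (n j : ℕ) : Finset (Fin n) := Finset.univ.filter fun i => i.val < j

@[simp] theorem mem_below {n j : ℕ} {i : Fin n} : i ∈ below n j ↔ i.val < j := by simp [below]

theorem card_below {n j : ℕ} (h : j ≤ n) : (below n j).card = j := by
  rw [below, Fin.card_filter_val_lt, min_eq_right h]

/-- The norm of the correlation error of order `k`, as a function of `F` and of the state `x`. -/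
def corrNorm {n : ℕ} (F : S.Space 1) (x : S.Space n) (k : ℕ) : ℝ :=
  if k ≤ n then ‖S.slots (S.mix F (below n k)) x‖ else 0

theorem corrNorm_nonneg {n : ℕ} (F : S.Space 1) (x : S.Space n) (k : ℕ) :
    0 ≤ S.corrNorm F x k := by
  unfold corrNorm
  split_ifs
  · exact norm_nonneg _
  · exact le_rfl

theorem norm_slots_mix {n : ℕ} (F : S.Space 1) {x : S.Space n} (hx : S.IsSymmetric x)
    {k : ℕ} (s : Finset (Fin n)) (hs : s.card = k) :
    ‖S.slots (S.mix F s) x‖ = S.corrNorm F x k := by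
  subst hs
  rw [corrNorm, if_pos (card_finset_fin_le s), 
    ← S.norm_perm (slotPerm s) (S.slots (S.mix F (below n s.card)) x), S.perm_slots, hx]
  congr 3
  funext i
  simp [mix, slotPerm_symm_lt_iff]

theorem corrNorm_le {n : ℕ} {F : S.Space 1} (hF : ‖F‖ ≤ 1) (x : S.Space n) (k : ℕ) :
    S.corrNorm F x k ≤ 2 ^ k * ‖x‖ := by
  unfold corrNorm
  split_ifs with h
  · refine (ContinuousLinearMap.le_of_opNorm_le _ (S.norm_slots_le _) x).trans ?_
    refine mul_le_mul_of_nonneg_right ?_ (norm_nonneg x)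
    have h1 : ∀ i : Fin n, ‖(S.mix F (below n k) i).1‖ + ‖(S.mix F (below n k) i).2‖ ≤
        if i ∈ below n k then 2 else 1 := by
      intro i
      unfold mix
      split_ifs <;> simp [fluct, ins] <;> linarith
    refine (Finset.prod_le_prod (fun i _ => by positivity) fun i _ => h1 i).trans ?_
    rw [Finset.prod_ite_mem, Finset.univ_inter, Finset.prod_const, card_below h]
  · positivity

theorem norm_marginal_fluctBelow {j n : ℕ} (hj : j ≤ n) {F : S.Space 1} (hF : ‖F‖ = 1)
    (x : S.Space n) :
    ‖S.marginal hj (S.slots (S.fluctBelow F j) x)‖ = ‖S.slots (S.mix F (below n j)) x‖ := by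
  rw [S.norm_marginal hj hF, S.slots_slots (e := S.mix F (below n j))]
  intro i A
  by_cases hi : i.val < j <;> simp [fluctBelow, mix, hi]

theorem norm_correlationError {j n : ℕ} (hj : j ≤ n) {F : S.Space 1} (hF : ‖F‖ = 1)
    {x : S.Space n} (hx : S.IsSymmetric x) :
    ‖S.correlationError x F hj‖ = S.corrNorm F x j := by
  rw [S.correlationError_eq hj F hx, corrNorm, if_pos hj]
  exact S.norm_marginal_fluctBelow hj hF x

end MarginalSystem

namespace TwoBodyPotential

variable {ι : Type*} {S : MarginalSystem ι} (P : TwoBodyPotential S)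

open MarginalSystem

theorem slots_mix_pair {n : ℕ} {i r : Fin n} (hir : i ≠ r) (c : Fin n → S.SlotOp) (F : S.Space 1)
    (x : S.Space n) :
    S.slots c (P.pair i r x) =
      S.slots (Function.update (Function.update (fun _ => S.keep) i (c i)) r (c r)) (P.pair i r
        (S.slots (Function.update (Function.update c i (S.fluct F)) r (S.fluct F)) x +
          S.slots (Function.update (Function.update c i (S.ins F)) r (S.fluct F)) x +
          S.slots (Function.update (Function.update c i (S.fluct F)) r (S.ins F)) x +
          S.slots (Function.update (Function.update c i (S.ins F)) r (S.ins F)) x)) := by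
  have h1 : S.slots (Function.update (Function.update c i (S.fluct F)) r (S.fluct F)) x +
          S.slots (Function.update (Function.update c i (S.ins F)) r (S.fluct F)) x +
          S.slots (Function.update (Function.update c i (S.fluct F)) r (S.ins F)) x +
          S.slots (Function.update (Function.update c i (S.ins F)) r (S.ins F)) x =
      S.slots (Function.update (Function.update c i S.keep) r S.keep) x := by
    rw [← S.fluct_add_ins F, S.slots_update_add]
    simp only [Function.update_comm hir, S.slots_update_add, add_apply]
    abel
  rw [h1, P.pair_slots hir]
  · rw [S.slots_slots]
    intro k A
    by_cases h : k = r
    · subst h; simp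
    · by_cases h' : k = i
      · subst h'; simp [hir]
      · simp [h, h']
  · simp [hir]
  · simp

theorem update_mix_fluct {n : ℕ} (F : S.Space 1) (s : Finset (Fin n)) (i : Fin n) :
    Function.update (S.mix F s) i (S.fluct F) = S.mix F (insert i s) := by
  funext k
  by_cases h : k = i
  · subst h; simp [mix]
  · simp [h, mix]

theorem update_mix_ins {n : ℕ} (F : S.Space 1) (s : Finset (Fin n)) (i : Fin n) :
    Function.update (S.mix F s) i (S.ins F) = S.mix F (s.erase i) := by
  funext k
  by_cases h : k = i
  · subst h; simp [mix]
  · simp [h, mix]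

theorem norm_slots_update_update_le {n : ℕ} {i r : Fin n} (hir : i ≠ r) (p q : S.SlotOp)
    (x : S.Space n) :
    ‖S.slots (Function.update (Function.update (fun _ => S.keep) i p) r q) x‖ ≤
      (‖p.1‖ + ‖p.2‖) * (‖q.1‖ + ‖q.2‖) * ‖x‖ := by
  have h := S.slots_comp (c := Function.update (fun _ => S.keep) i p)
    (d := Function.update (fun _ => S.keep) r q)
    (e := Function.update (Function.update (fun _ => S.keep) i p) r q) (by
      intro k A
      by_cases h : k = r
      · subst h; simp [hir.symm]
      · simp [h])
  rw [← h, S.slots_update_keep, S.slots_update_keep]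
  refine (ContinuousLinearMap.le_opNorm _ _).trans ?_
  refine mul_le_mul_of_nonneg_right ((ContinuousLinearMap.opNorm_comp_le _ _).trans ?_)
    (norm_nonneg x)
  exact mul_le_mul (S.norm_slotOp_le _ _) (S.norm_slotOp_le _ _) (norm_nonneg _) (by positivity)

theorem norm_fluct_le {F : S.Space 1} (hF : ‖F‖ = 1) :
    ‖(S.fluct F).1‖ + ‖(S.fluct F).2‖ = 2 := by
  simp [fluct, hF]
  norm_num

theorem norm_ins_le (F : S.Space 1) : ‖(S.ins F).1‖ + ‖(S.ins F).2‖ = ‖F‖ := by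
  simp [ins]

/-- Two interacting slots, both carrying fluctuations. -/
theorem norm_slots_mix_pair_le {n j : ℕ} (hj : j ≤ n) {F : S.Space 1} (hF : ‖F‖ = 1)
    {x : S.Space n} (hx : S.IsSymmetric x) {i r : Fin n} (hir : i ≠ r) (hi : i.val < j)
    (hr : r.val < j) :
    ‖S.slots (S.mix F (below n j)) (P.pair i r x)‖ ≤ 4 * ‖P.V‖ * (S.corrNorm F x j +
      2 * S.corrNorm F x (j - 1) + S.corrNorm F x (j - 2)) := by
  have hi' : i ∈ below n j := mem_below.mpr hi
  have hr' : r ∈ below n j := mem_below.mpr hr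
  rw [P.slots_mix_pair hir _ F]
  simp only [update_mix_fluct, update_mix_ins]
  have e1 : insert r (insert i (below n j)) = below n j := by
    rw [Finset.insert_eq_of_mem hi', Finset.insert_eq_of_mem hr']
  have e2 : insert r ((below n j).erase i) = (below n j).erase i :=
    Finset.insert_eq_of_mem (Finset.mem_erase.mpr ⟨hir.symm, hr'⟩)
  have e3 : (insert i (below n j)).erase r = (below n j).erase r := by
    rw [Finset.insert_eq_of_mem hi']
  have c2 : ((below n j).erase i).card = j - 1 := by
    rw [Finset.card_erase_of_mem hi', card_below hj]
  have c3 : ((below n j).erase r).card = j - 1 := by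
    rw [Finset.card_erase_of_mem hr', card_below hj]
  have c4 : (((below n j).erase i).erase r).card = j - 2 := by
    rw [Finset.card_erase_of_mem (Finset.mem_erase.mpr ⟨hir.symm, hr'⟩), c2]
    rfl
  rw [e1, e2, e3]
  have hp : S.mix F (below n j) i = S.fluct F := if_pos hi'
  have hq : S.mix F (below n j) r = S.fluct F := if_pos hr'
  refine (norm_slots_update_update_le hir _ _ _).trans ?_
  rw [hp, hq, norm_fluct_le hF, ← S.norm_slots_mix F hx _ c4, two_mul (S.corrNorm F x (j - 1))]
  nth_rw 1 [← S.norm_slots_mix F hx _ c2]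
  rw [← S.norm_slots_mix F hx _ c3, ← S.norm_slots_mix F hx _ (card_below hj)]
  have h1 := P.norm_pair_apply_le i r (S.slots (S.mix F (below n j)) x +
    S.slots (S.mix F ((below n j).erase i)) x + S.slots (S.mix F ((below n j).erase r)) x +
    S.slots (S.mix F (((below n j).erase i).erase r)) x)
  refine (mul_le_mul_of_nonneg_left h1 (by norm_num)).trans ?_
  have h2 : ‖S.slots (S.mix F (below n j)) x +
    S.slots (S.mix F ((below n j).erase i)) x + S.slots (S.mix F ((below n j).erase r)) x +
    S.slots (S.mix F (((below n j).erase i).erase r)) x‖ ≤ _ :=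
    (norm_add_le _ _).trans (add_le_add_left ((norm_add_le _ _).trans
      (add_le_add_left (norm_add_le _ _) _)) _)
  have := mul_le_mul_of_nonneg_left h2 (norm_nonneg P.V)
  linarith

/-- One of two interacting slots carries a fluctuation and the other one is traced out. -/
theorem norm_slots_mix_pair_sub_le {n j : ℕ} (hj : j ≤ n) {F : S.Space 1} (hF : ‖F‖ = 1)
    (hF1 : S.ellL 1 F = 1)
    {x : S.Space n} (hx : S.IsSymmetric x) {i r : Fin n} (hi : i.val < j) (hr : j ≤ r.val) :
    ‖S.slots (S.mix F (below n j)) (P.pair i r x) - S.slots (Function.update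
      (S.mix F (below n j)) i (S.ins (P.Q F F - S.ellL 1 (P.Q F F) • F))) x‖ ≤
      2 * ‖P.V‖ * (2 * S.corrNorm F x j + S.corrNorm F x (j + 1)) := by
  have hi' : i ∈ below n j := mem_below.mpr hi
  have hr' : r ∉ below n j := fun h => absurd (mem_below.mp h) (not_lt.mpr hr)
  have hir : i ≠ r := by rintro rfl; omega
  have hp : S.mix F (below n j) i = S.fluct F := if_pos hi'
  have hq : S.mix F (below n j) r = S.ins F := if_neg hr'
  have e1 : insert r (insert i (below n j)) = insert r (below n j) := by
    rw [Finset.insert_eq_of_mem hi']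
  have e3 : (insert i (below n j)).erase r = below n j := by
    rw [Finset.insert_eq_of_mem hi', Finset.erase_eq_of_notMem hr']
  have e4 : ((below n j).erase i).erase r = (below n j).erase i :=
    Finset.erase_eq_of_notMem fun h => hr' (Finset.mem_of_mem_erase h)
  have c1 : (insert r (below n j)).card = j + 1 := by
    rw [Finset.card_insert_of_notMem hr', card_below hj]
  have c2 : (insert r ((below n j).erase i)).card = j := by
    rw [Finset.card_insert_of_notMem fun h => hr' (Finset.mem_of_mem_erase h),
      Finset.card_erase_of_mem hi', card_below hj]
    omega
  have key : S.slots (Function.update (Function.update (fun _ => S.keep) i (S.fluct F)) r (S.ins F))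
      (P.pair i r (S.slots (S.mix F ((below n j).erase i)) x)) = S.slots (Function.update
      (S.mix F (below n j)) i (S.ins (P.Q F F - S.ellL 1 (P.Q F F) • F))) x := by
    have h1 : S.slots (S.mix F ((below n j).erase i)) x =
        S.slots (Function.update (Function.update (fun _ => S.keep) i (S.ins F)) r (S.ins F))
          (S.slots (S.mix F ((below n j).erase i)) x) := by
      refine (S.slots_slots ?_ x).symm
      intro k A
      by_cases h : k = r
      · subst h; simp [mix, hr', hF1]
      · by_cases h' : k = i
        · subst h'; simp [mix, h, hF1]
        · simp [h, h']
    have h2 : ∀ y : S.Space n, S.slots (Function.update (Function.update (fun _ => S.keep) i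
        (S.fluct F)) r (S.ins F)) y = S.slots (Function.update (fun _ => S.keep) i (S.fluct F))
          (S.slots (Function.update (fun _ => S.keep) r (S.ins F)) y) := by
      intro y
      refine (S.slots_slots ?_ y).symm
      intro k A
      by_cases h : k = r
      · subst h; simp [hir.symm]
      · simp [h]
    rw [h1, h2, P.pair_exchange hir, S.slots_slots (e := Function.update (Function.update
      (fun _ => S.keep) i (S.ins (P.Q F F - S.ellL 1 (P.Q F F) • F))) r (S.ins F)), S.slots_slots]
    · intro k A
      by_cases h : k = r
      · subst h; simp [mix, hr', hir.symm, hF1]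
      · by_cases h' : k = i
        · subst h'; simp [mix, h, hF1]
        · simp [h, h', mix]
    · intro k A
      by_cases h : k = r
      · subst h; simp [hir.symm]
      · by_cases h' : k = i
        · subst h'; simp [h, smul_sub, mul_smul]
        · simp [h, h']
  rw [P.slots_mix_pair hir _ F]
  simp only [update_mix_fluct, update_mix_ins]
  rw [e1, e3, e4, hp, hq, map_add, map_add, ← key, add_sub_cancel_right]
  refine (norm_slots_update_update_le hir _ _ _).trans ?_
  rw [norm_fluct_le hF, norm_ins_le, hF, mul_one, ← S.norm_slots_mix F hx _ c1, two_mul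
    (S.corrNorm F x j)]
  nth_rw 1 [← S.norm_slots_mix F hx _ c2]
  rw [← S.norm_slots_mix F hx _ (card_below hj)]
  have h1 := P.norm_pair_apply_le i r (S.slots (S.mix F (insert r (below n j))) x +
    S.slots (S.mix F (insert r ((below n j).erase i))) x + S.slots (S.mix F (below n j)) x)
  refine (mul_le_mul_of_nonneg_left h1 zero_le_two).trans ?_
  have h2 : ‖S.slots (S.mix F (insert r (below n j))) x +
    S.slots (S.mix F (insert r ((below n j).erase i))) x + S.slots (S.mix F (below n j)) x‖ ≤ _ :=
    (norm_add_le _ _).trans (add_le_add_left (norm_add_le _ _) _)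
  have := mul_le_mul_of_nonneg_left h2 (norm_nonneg P.V)
  linarith

end TwoBodyPotential

namespace TwoBodyPotential

variable {ι : Type*} {S : MarginalSystem ι} (P : TwoBodyPotential S)

open MarginalSystem

/-- The interaction contribution to the time derivative of the correlation error of order `j`,
before taking the marginal; `f` is the interaction term in the equation of `F`. -/
def drive {n : ℕ} (F f : S.Space 1) (x : S.Space n) (j : ℕ) : S.Space n :=
  (n : ℂ)⁻¹ • S.slots (S.fluctBelow F j) (P.total n x) -
    ∑ i ∈ below n j, S.slots (Function.update (S.fluctBelow F j) i (S.ins f)) x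

theorem slots_update_mix_ins {n j : ℕ} {F : S.Space 1} (hF1 : S.ellL 1 F = 1) (x : S.Space n)
    (i : Fin n) (G : S.Space 1) :
    S.slots (Function.update (S.mix F (below n j)) i (S.ins G)) x =
      S.slot i G (S.slots (S.mix F ((below n j).erase i)) x) := by
  have h : S.slot i G = S.slotOp i (S.ins G) := by
    simp [MarginalSystem.slotOp, MarginalSystem.ins]
  rw [h, ← S.slots_update_keep, S.slots_slots]
  intro k A
  by_cases hk : k = i
  · subst hk; simp [mix, hF1]
  · simp [hk, mix]

theorem norm_ite_add_ite_sum_le {n j : ℕ} {α β : ℝ} (hα : 0 ≤ α) (hβ : 0 ≤ β) (hj : j ≤ n) :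
    ∑ i : Fin n, ∑ r : Fin n with i < r, ((if i.val < j ∧ r.val < j then α else 0) +
      if i.val < j ∧ j ≤ r.val then β else 0) ≤ (j : ℝ) ^ 2 * α + j * n * β := by
  have h1 : ∀ i : Fin n, ∑ r : Fin n with i < r, ((if i.val < j ∧ r.val < j then α else 0) +
      if i.val < j ∧ j ≤ r.val then β else 0) ≤ if i ∈ below n j then j * α + n * β else 0 := by
    intro i
    refine (Finset.sum_le_sum_of_subset_of_nonneg (Finset.filter_subset _ _) fun r _ _ => ?_).trans ?_
    · positivity
    rw [Finset.sum_add_distrib]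
    by_cases hi : i.val < j
    · simp only [hi, true_and, mem_below, if_true]
      have e : (∑ r : Fin n, if r.val < j then α else 0) = j * α := by
        rw [← Finset.sum_filter, Finset.sum_const, nsmul_eq_mul]
        congr 2
        exact card_below hj
      rw [e]
      refine add_le_add_right ?_ _
      calc (∑ r : Fin n, if j ≤ r.val then β else 0) ≤ ∑ r : Fin n, β :=
            Finset.sum_le_sum fun r _ => by split_ifs <;> simp [hβ]
        _ = n * β := by simp
    · simp [hi]
  refine (Finset.sum_le_sum fun i _ => h1 i).trans (le_of_eq ?_)
  rw [Finset.sum_ite_mem, Finset.univ_inter, Finset.sum_const, card_below hj, nsmul_eq_mul]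
  ring

theorem norm_marginal_drive_le {n j : ℕ} (hn : 1 ≤ n) (hj : j ≤ n)
    (hmarg : ∀ i r : Fin n, i ≠ r → j ≤ i → j ≤ r → ∀ A, S.marginal hj (P.pair i r A) = 0)
    {F f : S.Space 1} (hF : ‖F‖ = 1) (hF1 : S.ellL 1 F = 1) (hf1 : S.ellL 1 f = 0)
    (hf : ‖f‖ ≤ ‖P.V‖) {x : S.Space n} (hx : S.IsSymmetric x) :
    ‖S.marginal hj (P.drive F f x j)‖ ≤
      ‖P.V‖ * (4 * ((j : ℝ) ^ 2 / n) * (S.corrNorm F x j + 2 * S.corrNorm F x (j - 1) +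
        S.corrNorm F x (j - 2)) + 2 * j * (2 * S.corrNorm F x j + S.corrNorm F x (j + 1)) +
        (j : ℝ) ^ 2 / n * S.corrNorm F x (j - 1)) +
      2 * j * ‖P.Q F F - f‖ * S.corrNorm F x (j - 1) := by
  have hn0 : (0 : ℝ) < n := by exact_mod_cast hn
  have hnC : (n : ℂ) ≠ 0 := by exact_mod_cast hn0.ne'
  set q' := P.Q F F - S.ellL 1 (P.Q F F) • F with hq'
  set M := S.slots (fun i : Fin n => if i.val < j then S.keep else S.ins F) with hM
  set Z : Fin n → S.Space 1 →L[ℂ] S.Space n := fun i =>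
    (S.slot i).flip (S.slots (S.mix F ((below n j).erase i)) x) with hZ
  have hMP : ∀ y, M (S.slots (S.fluctBelow F j) y) = S.slots (S.mix F (below n j)) y := by
    intro y
    refine S.slots_slots (fun i A => ?_) y
    by_cases hi : i.val < j <;> simp [fluctBelow, mix, hi]
  have hMZ : ∀ i ∈ below n j, M (S.slots (Function.update (S.fluctBelow F j) i (S.ins f)) x) =
      Z i f := by
    intro i hi
    rw [hZ]
    dsimp only
    rw [ContinuousLinearMap.flip_apply, ← slots_update_mix_ins hF1]
    refine S.slots_slots (fun k A => ?_) x
    by_cases hk : k = i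
    · subst hk
      simp [mem_below.mp hi]
    · by_cases hk' : k.val < j <;> simp [fluctBelow, mix, hk, hk']
  set t : Fin n → Fin n → S.Space n := fun i r => S.slots (S.mix F (below n j)) (P.pair i r x)
  set w : Fin n → Fin n → S.Space n := fun i r => if i.val < j ∧ j ≤ r.val then Z i q' else 0
  set α := 4 * ‖P.V‖ * (S.corrNorm F x j +
      2 * S.corrNorm F x (j - 1) + S.corrNorm F x (j - 2))
  set β := 2 * ‖P.V‖ * (2 * S.corrNorm F x j + S.corrNorm F x (j + 1))
  have hu := S.corrNorm_nonneg F x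
  have hα : 0 ≤ α := mul_nonneg (by positivity) (by linarith [hu j, hu (j - 1), hu (j - 2)])
  have hβ : 0 ≤ β := mul_nonneg (by positivity) (by linarith [hu j, hu (j + 1)])
  have htw : ∀ i r : Fin n, i < r → ‖t i r - w i r‖ ≤
      (if i.val < j ∧ r.val < j then α else 0) + if i.val < j ∧ j ≤ r.val then β else 0 := by
    intro i r hir
    by_cases hi : i.val < j
    · by_cases hr : r.val < j
      · simpa [w, hi, hr, not_le.mpr hr] using P.norm_slots_mix_pair_le hj hF hx hir.ne hi hr
      · have hr' := not_lt.mp hr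
        have h := P.norm_slots_mix_pair_sub_le hj hF hF1 hx hi hr'
        rw [slots_update_mix_ins hF1] at h
        have hw' : w i r = Z i q' := if_pos ⟨hi, hr'⟩
        rw [hw', if_neg fun h => hr h.2, if_pos ⟨hi, hr'⟩, zero_add]
        exact h
    · have hi' := not_lt.mp hi
      have hr' : j ≤ r.val := hi'.trans (le_of_lt hir)
      have h0 : t i r = 0 := by
        rw [← norm_eq_zero]
        change ‖S.slots (S.mix F (below n j)) (P.pair i r x)‖ = 0
        rw [← S.norm_marginal_fluctBelow hj hF, ← P.pair_slots hir.ne, hmarg i r hir.ne hi' hr',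
          norm_zero]
        · simp [fluctBelow, hi]
        · simp [fluctBelow, hr']
      simp [w, hi, h0]
  have hw : ∑ i : Fin n, ∑ r : Fin n with i < r, w i r =
      ((n : ℂ) - j) • ∑ i ∈ below n j, Z i q' := by
    rw [Finset.smul_sum, ← Finset.univ_inter (below n j), ← Finset.sum_ite_mem]
    refine Finset.sum_congr rfl fun i _ => ?_
    by_cases hi : i.val < j
    · rw [if_pos (mem_below.mpr hi), ← Finset.sum_filter_add_sum_filter_not _ (fun r => j ≤ r.val)]
      have e1 : ∑ r ∈ (Finset.univ.filter fun r => i < r).filter (fun r => ¬ j ≤ r.val), w i r = 0 :=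
        Finset.sum_eq_zero fun r hr => by simp [w, (Finset.mem_filter.mp hr).2]
      have e2 : (Finset.univ.filter fun r => i < r).filter (fun r => j ≤ r.val) =
          (below n j)ᶜ := by
        ext r
        simp only [Finset.mem_filter, Finset.mem_univ, true_and, Finset.mem_compl, mem_below, not_lt]
        exact ⟨fun h => h.2, fun h => ⟨show i.val < r.val from hi.trans_le h, h⟩⟩
      rw [e1, e2, add_zero]
      rw [Finset.sum_congr rfl (g := fun _ => Z i q') (fun r hr => by
        have hr' : j ≤ r.val := by simpa using hr
        simp [w, hi, hr'])]
      rw [Finset.sum_const, Finset.card_compl, Fintype.card_fin, card_below hj, ← Nat.cast_sub hj,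
        Nat.cast_smul_eq_nsmul]
    · rw [if_neg (by simpa using hi)]
      exact Finset.sum_eq_zero fun r _ => by simp [w, hi]
  set D := ∑ i : Fin n, ∑ r : Fin n with i < r, (t i r - w i r) with hD
  have hDn : ‖D‖ ≤ (j : ℝ) ^ 2 * α + j * n * β := by
    refine le_trans ?_ (norm_ite_add_ite_sum_le hα hβ hj)
    refine norm_sum_le_of_le _ fun i _ => norm_sum_le_of_le _ fun r hr => ?_
    exact htw i r (Finset.mem_filter.mp hr).2
  have hT : S.slots (S.mix F (below n j)) (P.total n x) =
      D + ((n : ℂ) - j) • ∑ i ∈ below n j, Z i q' := by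
    rw [← hw, hD]
    simp only [Finset.sum_sub_distrib, sub_add_cancel, total, sum_apply, map_sum]
    rfl
  have hMd : M (P.drive F f x j) = (n : ℂ)⁻¹ • D +
      ∑ i ∈ below n j, Z i (((n : ℂ)⁻¹ * (n - j)) • q' - f) := by
    rw [drive, map_sub, map_smul, hMP, map_sum, Finset.sum_congr rfl hMZ, hT, smul_add, smul_smul]
    simp only [map_sub, map_smul, Finset.sum_sub_distrib, Finset.smul_sum]
    abel
  have hq'f : ‖q' - f‖ ≤ 2 * ‖P.Q F F - f‖ := by
    have e : q' - f = (P.Q F F - f) - S.ellL 1 (P.Q F F - f) • F := by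
      rw [hq', map_sub, hf1, sub_zero]
      abel
    rw [e, two_mul]
    refine (norm_sub_le _ _).trans (add_le_add_right ?_ _)
    rw [norm_smul, hF, mul_one]
    exact S.norm_ellL_le _
  have hG : ‖((n : ℂ)⁻¹ * (n - j)) • q' - f‖ ≤ 2 * ‖P.Q F F - f‖ + j / n * ‖P.V‖ := by
    have e : ((n : ℂ)⁻¹ * (n - j)) • q' - f =
        ((n - j) / n : ℝ) • (q' - f) - (j / n : ℝ) • f := by
      have e1 : ((n : ℂ)⁻¹ * (n - j)) = (((n - j) / n : ℝ) : ℂ) := by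
        push_cast
        field_simp
      rw [e1, Complex.coe_smul]
      have e2 : f = ((n - j) / n : ℝ) • f + (j / n : ℝ) • f := by
        rw [← add_smul, ← add_div, sub_add_cancel, div_self hn0.ne', one_smul]
      rw [smul_sub _ q' f, sub_sub, ← e2]
    have hjn : (j : ℝ) ≤ n := by exact_mod_cast hj
    rw [e]
    refine (norm_sub_le _ _).trans (add_le_add ?_ ?_)
    · rw [norm_smul, Real.norm_of_nonneg (div_nonneg (sub_nonneg.mpr hjn) hn0.le)]
      refine (mul_le_of_le_one_left (norm_nonneg _) ?_).trans hq'f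
      rw [div_le_one hn0]
      linarith [(Nat.cast_nonneg j : (0 : ℝ) ≤ j)]
    · rw [norm_smul, Real.norm_of_nonneg (by positivity)]
      exact mul_le_mul_of_nonneg_left hf (by positivity)
  rw [S.norm_marginal hj hF, ← hM, hMd]
  have hZn : ∀ i ∈ below n j, ‖Z i (((n : ℂ)⁻¹ * (n - j)) • q' - f)‖ ≤
      (2 * ‖P.Q F F - f‖ + j / n * ‖P.V‖) * S.corrNorm F x (j - 1) := by
    intro i hi
    refine (S.norm_slot_apply_le i _ _).trans ?_
    rw [S.norm_slots_mix F hx (k := j - 1) _ (by rw [Finset.card_erase_of_mem hi, card_below hj])]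
    exact mul_le_mul_of_nonneg_right hG (hu _)
  have hDn' : ‖(n : ℂ)⁻¹ • D‖ ≤ (n : ℝ)⁻¹ * ((j : ℝ) ^ 2 * α + j * n * β) := by
    rw [norm_smul, norm_inv, Complex.norm_natCast]
    exact mul_le_mul_of_nonneg_left hDn (by positivity)
  refine (norm_add_le _ _).trans ((add_le_add hDn' (norm_sum_le_of_le _ hZn)).trans ?_)
  rw [Finset.sum_const, card_below hj, nsmul_eq_mul]
  refine le_of_eq ?_
  simp only [α, β]
  field_simp
  ring

end TwoBodyPotential

/-! ### The free generator and slot operators -/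

namespace MarginalSystem

variable {ι : Type*} (S : MarginalSystem ι) {K₀ : S.Space 1 →ₗ.[ℂ] S.Space 1}

theorem tprod_mem_freeGraph {n : ℕ} (A : Fin n → K₀.domain) :
    (S.tprod fun i => (A i : S.Space 1),
      ∑ i, S.tprod (Function.update (fun i => (A i : S.Space 1)) i (K₀ (A i)))) ∈
      S.freeGraph K₀ n :=
  Submodule.le_topologicalClosure _ (Submodule.subset_span ⟨A, rfl⟩)

/-- A bounded operator intertwines the free generators, up to a bounded operator, if it does so on
elementary tensors. -/
theorem mem_freeGraph_of_tprod {n n' : ℕ} (L B : S.Space n →L[ℂ] S.Space n')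
    (h : ∀ A : Fin n → K₀.domain, (L (S.tprod fun i => (A i : S.Space 1)),
      L (∑ i, S.tprod (Function.update (fun i => (A i : S.Space 1)) i (K₀ (A i)))) +
        B (S.tprod fun i => (A i : S.Space 1))) ∈ S.freeGraph K₀ n')
    {x y : S.Space n} (hxy : (x, y) ∈ S.freeGraph K₀ n) : (L x, L y + B x) ∈ S.freeGraph K₀ n' := by
  let Φ : S.Space n × S.Space n →L[ℂ] S.Space n' × S.Space n' :=
    (L ∘L ContinuousLinearMap.fst ℂ _ _).prod
      (L ∘L ContinuousLinearMap.snd ℂ _ _ + B ∘L ContinuousLinearMap.fst ℂ _ _)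
  have hle : S.freeGraph K₀ n ≤ (S.freeGraph K₀ n').comap (Φ : _ →ₗ[ℂ] _) := by
    refine Submodule.topologicalClosure_minimal _ ?_ ?_
    · rw [Submodule.span_le]
      rintro _ ⟨A, rfl⟩
      exact h A
    · exact (Submodule.isClosed_topologicalClosure _).preimage Φ.continuous
  exact hle hxy

theorem perm_mem_freeGraph {n : ℕ} (π : Equiv.Perm (Fin n)) {x y : S.Space n}
    (hxy : (x, y) ∈ S.freeGraph K₀ n) : (S.perm π x, S.perm π y) ∈ S.freeGraph K₀ n := by
  have h := S.mem_freeGraph_of_tprod (S.perm π) 0 (fun A => by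
    have h1 := S.tprod_mem_freeGraph fun i => A (π.symm i)
    convert h1 using 2
    · rw [S.perm_tprod]
    · rw [zero_apply, add_zero, map_sum]
      rw [← Equiv.sum_comp π.symm]
      refine Finset.sum_congr rfl fun i _ => ?_
      rw [S.perm_tprod]
      congr 1
      funext k
      by_cases hk : k = i
      · subst hk; simp
      · simp [hk]) hxy
  simpa using h

theorem marginal_mem_freeGraph {j n : ℕ} (hj : j ≤ n) (hK : ∀ F : K₀.domain, S.ellL 1 (K₀ F) = 0)
    {x y : S.Space n} (hxy : (x, y) ∈ S.freeGraph K₀ n) :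
    (S.marginal hj x, S.marginal hj y) ∈ S.freeGraph K₀ j := by
  have h := S.mem_freeGraph_of_tprod (S.marginal hj) 0 (fun A => by
    have h1 := (S.freeGraph K₀ j).smul_mem (∏ i : Fin n with j ≤ i.val, S.ellL 1 (A i))
      (S.tprod_mem_freeGraph fun i => A (Fin.castLE hj i))
    convert h1 using 2
    · rw [S.marginal_tprod]
      rfl
    · rw [zero_apply, add_zero, map_sum, sum_fin_split hj, Finset.sum_eq_zero, zero_add,
        Prod.smul_mk, Finset.smul_sum]
      · refine Finset.sum_congr rfl fun i _ => ?_
        rw [S.marginal_tprod]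
        congr 1
        · refine Finset.prod_congr rfl fun k hk => ?_
          have hki : k ≠ Fin.castLE hj i := by
            rintro rfl
            exact absurd i.2 (not_lt.mpr (Finset.mem_filter.mp hk).2)
          rw [Function.update_of_ne hki]
        · congr 1
          exact Function.update_comp_eq_of_injective _ (Fin.castLE_injective hj) i _
      · intro i hi
        rw [S.marginal_tprod, Finset.prod_eq_zero hi, zero_smul]
        rw [Function.update_self, hK]) hxy
  simpa using h

theorem fluctBelow_mem_freeGraph {n : ℕ} (j : ℕ) (hK : ∀ F : K₀.domain, S.ellL 1 (K₀ F) = 0)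
    (G : K₀.domain) {x y : S.Space n} (hxy : (x, y) ∈ S.freeGraph K₀ n) :
    (S.slots (S.fluctBelow (G : S.Space 1) j) x, S.slots (S.fluctBelow (G : S.Space 1) j) y -
      ∑ i ∈ below n j, S.slots (Function.update (S.fluctBelow (G : S.Space 1) j) i
        (S.ins (K₀ G))) x) ∈ S.freeGraph K₀ n := by
  have h := S.mem_freeGraph_of_tprod (S.slots (S.fluctBelow (G : S.Space 1) j))
    (-∑ i ∈ below n j, S.slots (Function.update (S.fluctBelow (G : S.Space 1) j) i
        (S.ins (K₀ G)))) (fun A => by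
    set B : Fin n → K₀.domain := fun i => if i.val < j then A i - S.ellL 1 (A i) • G else A i
      with hB
    have hBv : ∀ i, (B i : S.Space 1) = S.act (S.fluctBelow (G : S.Space 1) j i) (A i) := by
      intro i
      by_cases hi : i.val < j <;> simp [hB, fluctBelow, hi]
    have h1 := S.tprod_mem_freeGraph B
    convert h1 using 2
    · rw [slots_tprod]
      congr 1
      funext i
      rw [hBv]
    · rw [neg_apply, sum_apply, ← sub_eq_add_neg, map_sum, ← Finset.univ_inter (below n j),
        ← Finset.sum_ite_mem, ← Finset.sum_sub_distrib]
      refine Finset.sum_congr rfl fun i _ => ?_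
      have e1 : S.slots (S.fluctBelow (G : S.Space 1) j) (S.tprod (Function.update
          (fun i => (A i : S.Space 1)) i (K₀ (A i)))) =
          S.tprod (Function.update (fun i => (B i : S.Space 1)) i (K₀ (A i))) := by
        rw [slots_tprod]
        congr 1
        funext k
        by_cases hk : k = i
        · subst hk
          by_cases hi : k.val < j <;> simp [fluctBelow, hi, hK]
        · simp [hk, hBv]
      rw [e1]
      by_cases hi : i.val < j
      · rw [if_pos (mem_below.mpr hi), sub_eq_iff_eq_add, slots_tprod]
        have e2 : (fun k => S.act (Function.update (S.fluctBelow (G : S.Space 1) j) i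
            (S.ins (K₀ G)) k) (A k)) = Function.update (fun i => (B i : S.Space 1)) i
              (S.ellL 1 (A i) • K₀ G) := by
          funext k
          by_cases hk : k = i
          · subst hk; simp
          · simp [hk, hBv]
        rw [e2, ← S.tprod_update_add]
        congr 2
        have e3 : B i = A i - S.ellL 1 (A i) • G := if_pos hi
        rw [e3, K₀.map_sub, K₀.map_smul, sub_add_cancel]
      · rw [if_neg (by simpa using hi), sub_zero]
        have e3 : B i = A i := if_neg hi
        rw [e3]) hxy
  simpa [sub_eq_add_neg] using h

/-! ### Derivatives -/

theorem slots_fluctBelow_succ {n : ℕ} (F : S.Space 1) {j : ℕ} (hj : j < n) :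
    (S.slots (S.fluctBelow F (j + 1)) : S.Space n →L[ℂ] S.Space n) =
      S.slotOp ⟨j, hj⟩ (S.fluct F) ∘L S.slots (S.fluctBelow F j) := by
  rw [← slots_update_keep, S.slots_comp]
  intro i A
  by_cases hi : i = ⟨j, hj⟩
  · subst hi; simp [fluctBelow]
  · have h : i.val < j + 1 ↔ i.val < j := by
      have : i.val ≠ j := fun h => hi (Fin.ext h)
      omega
    simp [hi, fluctBelow, h]

theorem slots_fluctBelow_zero {n : ℕ} (F : S.Space 1) :
    (S.slots (S.fluctBelow F 0) : S.Space n →L[ℂ] S.Space n) = ContinuousLinearMap.id ℂ _ := by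
  rw [← slots_keep]
  congr 1

theorem hasDerivAt_slot {n : ℕ} (k : Fin n) {F : ℝ → S.Space 1} {F' : S.Space 1}
    {z : ℝ → S.Space n} {z' : S.Space n} {t : ℝ} (hF : HasDerivAt F F' t) (hz : HasDerivAt z z' t) :
    HasDerivAt (fun s => S.slot k (F s) (z s)) (S.slot k (F t) z' + S.slot k F' (z t)) t :=
  (ContinuousLinearMap.hasFDerivAt_of_bilinear ((S.slot k).bilinearRestrictScalars ℝ)
    hF.hasFDerivAt hz.hasFDerivAt).hasDerivAt.congr_deriv (by
      simp)

theorem hasDerivAt_slots_fluctBelow {n : ℕ} {F : ℝ → S.Space 1} {F' : S.Space 1}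
    {z : ℝ → S.Space n} {z' : S.Space n} {t : ℝ}
    (hF : HasDerivAt F F' t) (hz : HasDerivAt z z' t) {j : ℕ} (hj : j ≤ n) :
    HasDerivAt (fun s => S.slots (S.fluctBelow (F s) j) (z s))
      (S.slots (S.fluctBelow (F t) j) z' - ∑ i ∈ below n j,
        S.slots (Function.update (S.fluctBelow (F t) j) i (S.ins F')) (z t)) t := by
  induction j with
  | zero =>
    simp only [slots_fluctBelow_zero]
    have : below n 0 = ∅ := by ext; simp
    rw [this, Finset.sum_empty, sub_zero]
    exact hz
  | succ j ih =>
    have hj' : j < n := hj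
    have hb : below n (j + 1) = insert ⟨j, hj'⟩ (below n j) := by
      ext i
      simp only [mem_below, Finset.mem_insert, Fin.ext_iff]
      omega
    have hs : ∀ (G : S.Space 1) (y : S.Space n),
        S.slots (Function.update (fun _ => S.keep) ⟨j, hj'⟩ (S.ins G)) y = S.slot ⟨j, hj'⟩ G y := by
      intro G y
      rw [slots_update_keep]
      simp [slotOp, ins]
    have hf : ∀ (G : S.Space 1) (y : S.Space n),
        S.slotOp ⟨j, hj'⟩ (S.fluct G) y = y - S.slot ⟨j, hj'⟩ G y := by
      intro G y
      simp [slotOp, fluct, sub_eq_add_neg]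
    have hlt : ∀ i : Fin n, i ≠ ⟨j, hj'⟩ → (i.val < j + 1 ↔ i.val < j) := by
      intro i hi
      have : i.val ≠ j := fun h => hi (Fin.ext h)
      omega
    have h3 := (ih hj'.le).sub (S.hasDerivAt_slot ⟨j, hj'⟩ hF (ih hj'.le))
    simp only [S.slots_fluctBelow_succ _ hj', ContinuousLinearMap.comp_apply, hf]
    refine HasDerivAt.congr_deriv h3 (Eq.symm ?_)
    have key : ∑ k ∈ below n j, S.slots (Function.update (S.fluctBelow (F t) (j + 1)) k
        (S.ins F')) (z t) = S.slotOp ⟨j, hj'⟩ (S.fluct (F t)) (∑ k ∈ below n j,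
          S.slots (Function.update (S.fluctBelow (F t) j) k (S.ins F')) (z t)) := by
      rw [map_sum]
      refine Finset.sum_congr rfl fun k hk => ?_
      have hkj : k.val < j := mem_below.mp hk
      rw [← slots_update_keep, S.slots_slots]
      intro i A
      by_cases hi : i = ⟨j, hj'⟩
      · subst hi
        have : (⟨j, hj'⟩ : Fin n) ≠ k := fun h => by subst h; simp at hkj
        simp [fluctBelow, this]
      · by_cases hik : i = k
        · subst hik; simp [hi]
        · simp [hi, fluctBelow, hlt i hi, hik]
    rw [hb, Finset.sum_insert (by simp), key, hf, map_sub, ← hs F', S.slots_slots (e := Function.update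
      (S.fluctBelow (F t) (j + 1)) ⟨j, hj'⟩ (S.ins F'))]
    · abel
    · intro i A
      by_cases hi : i = ⟨j, hj'⟩
      · subst hi; simp [fluctBelow]
      · simp [hi, fluctBelow, hlt i hi]

end MarginalSystem

/-! ### Contraction semigroups and mild solutions -/

section Semigroups

variable {E : Type*} [NormedAddCommGroup E] [NormedSpace ℂ E]

/-- The norm of a solution of `u' = K u + r`, with `K` generating a contraction semigroup, grows at
most at the rate `‖r‖`. -/
theorem frequently_slope_norm_lt {U : ℝ → E →L[ℂ] E} {Γ : Set (E × E)} (hΓ : HasGenerator U Γ)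
    (hU : ∀ t, 0 ≤ t → ‖U t‖ ≤ 1) {u : ℝ → E} {u' r : E} {t ρ : ℝ} (hu : HasDerivAt u u' t)
    (hmem : (u t, u' - r) ∈ Γ) (hρ : ‖r‖ < ρ) :
    ∃ᶠ z in 𝓝[>] t, (z - t)⁻¹ * (‖u z‖ - ‖u t‖) < ρ := by
  have h1 : Tendsto (fun h : ℝ => h⁻¹ • (u (t + h) - u t)) (𝓝[>] 0) (𝓝 u') :=
    (hasDerivAt_iff_tendsto_slope_zero.mp hu).mono_left
      (nhdsWithin_mono _ fun x hx => (ne_of_gt hx : x ≠ 0))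
  have h2 := (hΓ _ _).mp hmem
  have h3 : Tendsto (fun h : ℝ => ‖h⁻¹ • (u (t + h) - u t) - (h : ℂ)⁻¹ • (U h (u t) - u t)‖)
      (𝓝[>] 0) (𝓝 ‖r‖) := by
    have := (h1.sub h2).norm
    rwa [sub_sub_cancel] at this
  have h4 : ∀ᶠ h : ℝ in 𝓝[>] 0, h⁻¹ * (‖u (t + h)‖ - ‖u t‖) < ρ := by
    filter_upwards [h3.eventually_lt_const hρ, self_mem_nhdsWithin] with h hh hpos
    have hpos : 0 < h := hpos
    refine lt_of_le_of_lt ?_ hh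
    have e : h⁻¹ • (u (t + h) - u t) - (h : ℂ)⁻¹ • (U h (u t) - u t) =
        h⁻¹ • (u (t + h) - U h (u t)) := by
      rw [← Complex.ofReal_inv, Complex.coe_smul, ← smul_sub, sub_sub_sub_cancel_right]
    rw [e, norm_smul, Real.norm_of_nonneg (inv_nonneg.mpr hpos.le)]
    refine mul_le_mul_of_nonneg_left ?_ (inv_nonneg.mpr hpos.le)
    have h5 : ‖U h (u t)‖ ≤ ‖u t‖ := by
      simpa using (U h).le_of_opNorm_le (hU h hpos.le) (u t)
    have h6 := norm_sub_norm_le (u (t + h)) (U h (u t))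
    linarith
  have h5 : Tendsto (fun z : ℝ => z - t) (𝓝[>] t) (𝓝[>] 0) := by
    refine tendsto_nhdsWithin_iff.mpr ⟨?_, ?_⟩
    · have : Tendsto (fun z : ℝ => z - t) (𝓝 t) (𝓝 (t - t)) := (continuous_sub_right t).tendsto t
      rw [sub_self] at this
      exact this.mono_left nhdsWithin_le_nhds
    · filter_upwards [self_mem_nhdsWithin] with z hz
      exact sub_pos.mpr (show t < z from hz)
  have h6 := h5.eventually h4
  simp only [add_sub_cancel] at h6
  exact h6.frequently

theorem norm_le_add_integral {U : ℝ → E →L[ℂ] E} {Γ : Set (E × E)} (hΓ : HasGenerator U Γ)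
    (hU : ∀ t, 0 ≤ t → ‖U t‖ ≤ 1) {u u' r : ℝ → E} {g : ℝ → ℝ}
    (hu : ∀ t, 0 ≤ t → HasDerivAt u (u' t) t) (hmem : ∀ t, 0 ≤ t → (u t, u' t - r t) ∈ Γ)
    (hg : Continuous g) (hr : ∀ t, 0 ≤ t → ‖r t‖ ≤ g t) {t : ℝ} (ht : 0 ≤ t) :
    ‖u t‖ ≤ ‖u 0‖ + ∫ s in (0 : ℝ)..t, g s := by
  have hB : ∀ x, HasDerivAt (fun t => ‖u 0‖ + ∫ s in (0 : ℝ)..t, g s) (g x) x := fun x =>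
    (intervalIntegral.integral_hasDerivAt_right (hg.intervalIntegrable _ _)
      (hg.stronglyMeasurableAtFilter _ _) hg.continuousAt).const_add _
  refine image_le_of_liminf_slope_right_le_deriv_boundary (f := fun t => ‖u t‖) (a := 0) (b := t)
    (B := fun t => ‖u 0‖ + ∫ s in (0 : ℝ)..t, g s) (B' := g) ?_ ?_ ?_ ?_ ?_ (right_mem_Icc.mpr ht)
  · exact fun x hx => (hu x hx.1).continuousAt.norm.continuousWithinAt
  · simp
  · exact fun x _ => (hB x).continuousAt.continuousWithinAt
  · exact fun x _ => (hB x).hasDerivWithinAt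
  · intro x hx ρ hρ
    have := frequently_slope_norm_lt hΓ hU (hu x hx.1) (hmem x hx.1) ((hr x hx.1).trans_lt hρ)
    refine this.mono fun z hz => ?_
    rwa [slope_def_field, div_eq_inv_mul]

theorem norm_le_mul_exp {U : ℝ → E →L[ℂ] E} {Γ : Set (E × E)} (hΓ : HasGenerator U Γ)
    (hU : ∀ t, 0 ≤ t → ‖U t‖ ≤ 1) {u u' r : ℝ → E} {C : ℝ}
    (hu : ∀ t, 0 ≤ t → HasDerivAt u (u' t) t) (hmem : ∀ t, 0 ≤ t → (u t, u' t - r t) ∈ Γ)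
    (hr : ∀ t, 0 ≤ t → ‖r t‖ ≤ C * ‖u t‖) {t : ℝ} (ht : 0 ≤ t) :
    ‖u t‖ ≤ ‖u 0‖ * Real.exp (C * t) := by
  have h := le_gronwallBound_of_liminf_deriv_right_le (f := fun t => ‖u t‖) (f' := fun t => ‖r t‖)
    (a := 0) (b := t) (δ := ‖u 0‖) (K := C) (ε := 0)
    (fun x hx => (hu x hx.1).continuousAt.norm.continuousWithinAt)
    (fun x hx ρ hρ => frequently_slope_norm_lt hΓ hU (hu x hx.1) (hmem x hx.1) hρ) le_rfl
    (fun x hx => by rw [add_zero]; exact hr x hx.1) t (right_mem_Icc.mpr ht)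
  rwa [gronwallBound_ε0, sub_zero] at h

/-- The average of `G` over the interval from `t` to `t + h`. -/
def timeAvg (h : ℝ) (G : ℝ → E) (t : ℝ) : E := h⁻¹ • ∫ s in t..t + h, G s

theorem tendsto_timeAvg [CompleteSpace E] {G : ℝ → E} (hG : Continuous G) (t : ℝ) :
    Tendsto (fun h => timeAvg h G t) (𝓝[>] 0) (𝓝 (G t)) := by
  have h1 : HasDerivAt (fun x => ∫ s in t..x, G s) (G t) t :=
    intervalIntegral.integral_hasDerivAt_right (hG.intervalIntegrable _ _)
      (hG.stronglyMeasurableAtFilter _ _) hG.continuousAt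
  have h2 := (hasDerivAt_iff_tendsto_slope_zero.mp h1).mono_left
    (nhdsWithin_mono 0 fun x (hx : x ∈ Ioi (0 : ℝ)) => (ne_of_gt hx : x ≠ 0))
  simpa [timeAvg] using h2

theorem hasDerivAt_timeAvg [CompleteSpace E] {G : ℝ → E} (hG : Continuous G) (h t : ℝ) :
    HasDerivAt (timeAvg h G) (h⁻¹ • (G (t + h) - G t)) t := by
  have h0 : ∀ x, HasDerivAt (fun x => ∫ s in (0 : ℝ)..x, G s) (G x) x := fun x =>
    intervalIntegral.integral_hasDerivAt_right (hG.intervalIntegrable _ _)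
      (hG.stronglyMeasurableAtFilter _ _) hG.continuousAt
  have h1 : timeAvg h G = fun t => h⁻¹ • ((∫ s in (0 : ℝ)..t + h, G s) - ∫ s in (0 : ℝ)..t, G s) := by
    funext t
    rw [timeAvg, intervalIntegral.integral_interval_sub_left (hG.intervalIntegrable _ _)
      (hG.intervalIntegrable _ _)]
  rw [h1]
  exact (((h0 (t + h)).comp_add_const t h).sub (h0 t)).const_smul _

theorem continuous_timeAvg [CompleteSpace E] {G : ℝ → E} (hG : Continuous G) (h : ℝ) :
    Continuous (timeAvg h G) :=
  continuous_iff_continuousAt.mpr fun t => (hasDerivAt_timeAvg hG h t).continuousAt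

theorem norm_timeAvg_le {G : ℝ → E} {h t C : ℝ} (hh : 0 < h) (hC : ∀ s, t ≤ s → ‖G s‖ ≤ C) :
    ‖timeAvg h G t‖ ≤ C := by
  have h1 : ‖∫ s in t..t + h, G s‖ ≤ C * |t + h - t| := by
    refine intervalIntegral.norm_integral_le_of_norm_le_const fun s hs => hC s ?_
    rw [uIoc_of_le (by linarith)] at hs
    exact hs.1.le
  rw [add_sub_cancel_left, abs_of_pos hh] at h1
  rw [timeAvg, norm_smul, Real.norm_of_nonneg (inv_nonneg.mpr hh.le), inv_mul_le_iff₀ hh]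
  linarith

theorem map_timeAvg [CompleteSpace E] {E' : Type*} [NormedAddCommGroup E'] [NormedSpace ℂ E']
    [CompleteSpace E'] (L : E →L[ℂ] E') {G : ℝ → E} (hG : Continuous G) (h t : ℝ) :
    L (timeAvg h G t) = timeAvg h (fun s => L (G s)) t := by
  rw [timeAvg, timeAvg, ← Complex.coe_smul, map_smul, Complex.coe_smul,
    ← ContinuousLinearMap.intervalIntegral_comp_comm L (hG.intervalIntegrable _ _)]

theorem timeAvg_congr {G G' : ℝ → E} {h t : ℝ} (hh : 0 < h) (hG : ∀ s, t ≤ s → G s = G' s) :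
    timeAvg h G t = timeAvg h G' t := by
  rw [timeAvg, timeAvg]
  congr 1
  refine intervalIntegral.integral_congr fun s hs => hG s ?_
  rw [uIcc_of_le (by linarith)] at hs
  exact hs.1

theorem timeAvg_const {h : ℝ} (hh : 0 < h) (c : E) [CompleteSpace E] (t : ℝ) :
    timeAvg h (fun _ => c) t = c := by
  rw [timeAvg, intervalIntegral.integral_const, add_sub_cancel_left, smul_smul,
    inv_mul_cancel₀ hh.ne', one_smul]

theorem IsC0Semigroup.continuous_apply {U : ℝ → E →L[ℂ] E} (hc : IsC0Semigroup U)
    (hU : ∀ t, 0 ≤ t → ‖U t‖ ≤ 1) {X : Type*} [TopologicalSpace X] {a : X → ℝ} {v : X → E}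
    (ha : Continuous a) (hv : Continuous v) : Continuous fun x => U (max (a x) 0) (v x) := by
  refine continuous_iff_continuousAt.mpr fun x₀ => ?_
  have h1 : Continuous fun x => U (max (a x) 0) (v x₀) :=
    (hc.cont (v x₀)).comp_continuous (ha.max continuous_const)
      fun x => mem_Ici.mpr (le_max_right _ _)
  rw [ContinuousAt, tendsto_iff_norm_sub_tendsto_zero]
  have h2 : Tendsto (fun x => ‖v x - v x₀‖ + ‖U (max (a x) 0) (v x₀) - U (max (a x₀) 0) (v x₀)‖)
      (𝓝 x₀) (𝓝 0) := by
    have h3 : Continuous fun x => ‖v x - v x₀‖ +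
        ‖U (max (a x) 0) (v x₀) - U (max (a x₀) 0) (v x₀)‖ :=
      (hv.sub continuous_const).norm.add (h1.sub continuous_const).norm
    have h4 := h3.tendsto x₀
    simpa using h4
  refine squeeze_zero (fun _ => norm_nonneg _) (fun x => ?_) h2
  have h3 : U (max (a x) 0) (v x) - U (max (a x₀) 0) (v x₀) =
      U (max (a x) 0) (v x - v x₀) + (U (max (a x) 0) (v x₀) - U (max (a x₀) 0) (v x₀)) := by
    rw [map_sub]
    abel
  rw [h3]
  refine (norm_add_le _ _).trans (add_le_add_left ?_ _)
  simpa using (U (max (a x) 0)).le_of_opNorm_le (hU _ (le_max_right _ _)) (v x - v x₀)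

/-- Averages of mild solutions of `G' = K G + f` are classical solutions. -/
theorem timeAvg_mem_generator [CompleteSpace E] {U : ℝ → E →L[ℂ] E} (hc : IsC0Semigroup U)
    (hU : ∀ t, 0 ≤ t → ‖U t‖ ≤ 1) {Γ : Set (E × E)} (hΓ : HasGenerator U Γ) {G f : ℝ → E}
    (hG : Continuous G) (hf : Continuous f)
    (hmild : ∀ t, 0 ≤ t → G t = U t (G 0) + ∫ s in (0 : ℝ)..t, U (t - s) (f s)) {h t : ℝ}
    (hh : 0 < h) (ht : 0 ≤ t) :
    (timeAvg h G t, h⁻¹ • (G (t + h) - G t) - timeAvg h f t) ∈ Γ := by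
  set W : ℝ → E →L[ℂ] E := fun t => U (max t 0) with hW
  have hWU : ∀ t, 0 ≤ t → W t = U t := fun t ht => by rw [hW]; simp [ht]
  set k : ℝ → ℝ → E := fun δ s => ∫ σ in (0 : ℝ)..1, W (δ * (1 - σ)) (f (s + δ * σ)) with hk
  have hkc : Continuous fun p : ℝ × ℝ => k p.1 p.2 := by
    refine intervalIntegral.continuous_parametric_intervalIntegral_of_continuous' ?_ 0 1
    exact hc.continuous_apply hU (by fun_prop) (hf.comp (by fun_prop))
  have hstep : ∀ δ s, 0 ≤ δ → 0 ≤ s → U δ (G s) = G (s + δ) - δ • k δ s := by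
    intro δ s hδ hs
    have e1 : ∫ r in (0 : ℝ)..s + δ, U (s + δ - r) (f r) =
        (∫ r in (0 : ℝ)..s, U (s + δ - r) (f r)) + ∫ r in s..s + δ, U (s + δ - r) (f r) := by
      have hi : ∀ a b, a ≤ s + δ → b ≤ s + δ → IntervalIntegrable
          (fun r => U (s + δ - r) (f r)) MeasureTheory.volume a b := by
        intro a b ha hb
        have h1 : Continuous fun r => W (s + δ - r) (f r) :=
          hc.continuous_apply hU (by fun_prop) hf
        refine (h1.intervalIntegrable a b).congr ?_
        intro r hr
        have : r ≤ s + δ := hr.2.trans (max_le ha hb)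
        dsimp only
        rw [hWU _ (by linarith)]
      exact (intervalIntegral.integral_add_adjacent_intervals (hi _ _ (by linarith) (by linarith))
        (hi _ _ (by linarith) le_rfl)).symm
    have e2 : ∫ r in (0 : ℝ)..s, U (s + δ - r) (f r) =
        U δ (∫ r in (0 : ℝ)..s, U (s - r) (f r)) := by
      rw [← ContinuousLinearMap.intervalIntegral_comp_comm]
      · refine intervalIntegral.integral_congr fun r hr => ?_
        rw [uIcc_of_le hs] at hr
        rw [show s + δ - r = δ + (s - r) by ring, hc.add _ _ hδ (by linarith [hr.2])]
        rfl
      · have h1 : Continuous fun r => W (s - r) (f r) := hc.continuous_apply hU (by fun_prop) hf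
        refine (h1.intervalIntegrable 0 s).congr ?_
        intro r hr
        rw [uIoc_of_le hs] at hr
        dsimp only
        rw [hWU _ (by linarith [hr.2])]
    have e3 : ∫ r in s..s + δ, U (s + δ - r) (f r) = δ • k δ s := by
      have h1 := intervalIntegral.integral_comp_add_left (a := 0) (b := δ)
        (fun r => U (s + δ - r) (f r)) s
      rw [add_zero] at h1
      have h2 := intervalIntegral.smul_integral_comp_mul_left (a := 0) (b := 1)
        (fun r => U (s + δ - (s + r)) (f (s + r))) δ
      rw [mul_zero, mul_one] at h2
      rw [← h1, ← h2]
      congr 1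
      refine intervalIntegral.integral_congr fun σ hσ => ?_
      rw [uIcc_of_le zero_le_one] at hσ
      rw [hWU _ (mul_nonneg hδ (by linarith [hσ.2])), show s + δ - (s + δ * σ) = δ * (1 - σ) by ring]
    rw [hmild (s + δ) (by linarith), e1, e2, e3]
    nth_rw 1 [hmild s hs]
    rw [map_add, add_comm s δ, hc.add _ _ hδ hs, ContinuousLinearMap.comp_apply]
    abel
  rw [hΓ]
  have hlim1 : Tendsto (fun δ : ℝ => δ⁻¹ • (timeAvg h G (t + δ) - timeAvg h G t)) (𝓝[>] 0)
      (𝓝 (h⁻¹ • (G (t + h) - G t))) :=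
    (hasDerivAt_iff_tendsto_slope_zero.mp (hasDerivAt_timeAvg hG h t)).mono_left
      (nhdsWithin_mono 0 fun x (hx : x ∈ Ioi (0 : ℝ)) => (ne_of_gt hx : x ≠ 0))
  have hlim2 : Tendsto (fun δ : ℝ => timeAvg h (k δ) t) (𝓝[>] 0) (𝓝 (timeAvg h f t)) := by
    have h1 : Continuous fun δ : ℝ => timeAvg h (k δ) t :=
      (intervalIntegral.continuous_parametric_intervalIntegral_of_continuous' hkc t (t + h)).const_smul
        h⁻¹
    have h2 := h1.tendsto 0
    have h3 : k 0 = f := by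
      funext s
      simp [hk, hW, hc.zero]
    rw [h3] at h2
    exact h2.mono_left nhdsWithin_le_nhds
  refine (hlim1.sub hlim2).congr' ?_
  filter_upwards [self_mem_nhdsWithin] with δ hδ
  have hδ : 0 < δ := hδ
  have e1 : U δ (timeAvg h G t) = timeAvg h G (t + δ) - δ • timeAvg h (k δ) t := by
    rw [map_timeAvg _ hG, timeAvg_congr hh (fun s hs => hstep δ s hδ.le (ht.trans hs))]
    have hkδ : Continuous (k δ) := hkc.comp (by fun_prop : Continuous fun s : ℝ => (δ, s))
    have h1 : timeAvg h G (t + δ) = h⁻¹ • ∫ s in t..t + h, G (s + δ) := by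
      rw [timeAvg, intervalIntegral.integral_comp_add_right, add_right_comm]
    have h2 : Continuous fun s => G (s + δ) := hG.comp (by fun_prop)
    have h3 : ∫ s in t..t + h, (G (s + δ) - δ • k δ s) =
        (∫ s in t..t + h, G (s + δ)) - ∫ s in t..t + h, δ • k δ s :=
      intervalIntegral.integral_sub (h2.intervalIntegrable _ _)
        ((hkδ.const_smul δ).intervalIntegrable _ _)
    rw [h1, timeAvg, timeAvg, h3, intervalIntegral.integral_smul, smul_sub, smul_comm h⁻¹ δ]
  rw [e1, ← Complex.ofReal_inv, Complex.coe_smul, sub_right_comm, smul_sub _ _ (δ • _),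
    smul_smul δ⁻¹ δ, inv_mul_cancel₀ hδ.ne', one_smul]

end Semigroups

section Semigroups

variable {E : Type*} [NormedAddCommGroup E] [NormedSpace ℂ E] [CompleteSpace E]

theorem timeAvg_orbit_mem {U : ℝ → E →L[ℂ] E} (hc : IsC0Semigroup U)
    (hU : ∀ t, 0 ≤ t → ‖U t‖ ≤ 1) {Γ : Set (E × E)} (hΓ : HasGenerator U Γ) (x : E) {h t : ℝ}
    (hh : 0 < h) (ht : 0 ≤ t) :
    (timeAvg h (fun t => U (max t 0) x) t,
      h⁻¹ • (U (max (t + h) 0) x - U (max t 0) x)) ∈ Γ := by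
  have h1 := timeAvg_mem_generator hc hU hΓ (G := fun t => U (max t 0) x) (f := fun _ => 0)
    (hc.continuous_apply hU continuous_id continuous_const) continuous_const (fun t ht => by
      simp [ht, hc.zero]) hh ht
  rwa [timeAvg_const hh, sub_zero] at h1

/-- Fixed points of `R` remain fixed under the semigroup generated by `K + c • T`, if `R` commutes
with `K` and `T` preserves the range of `R`. -/
theorem semigroup_apply_fixed {U : ℝ → E →L[ℂ] E} (hc : IsC0Semigroup U)
    (hU : ∀ t, 0 ≤ t → ‖U t‖ ≤ 1) {Γ : Submodule ℂ (E × E)} {T R : E →L[ℂ] E} {c : ℂ}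
    (hΓ : HasGenerator U {p | (p.1, p.2 - c • T p.1) ∈ Γ})
    (hR : ∀ a b, (a, b) ∈ Γ → (R a, R b) ∈ Γ) (hT : ∀ z, R (T (R z)) = T (R z)) {x : E}
    (hx : R x = x) {t : ℝ} (ht : 0 ≤ t) : R (U t x) = U t x := by
  set y : ℝ → E := fun t => U (max t 0) x with hy
  have hyc : Continuous y := hc.continuous_apply hU continuous_id continuous_const
  set L : E →L[ℂ] E := ContinuousLinearMap.id ℂ _ - R with hL
  have hLx : ∀ z, L z = z - R z := fun z => rfl
  have hTL : ∀ z, L (T z) = L (T (L z)) := by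
    intro z
    have h1 : L (T (R z)) = 0 := by rw [hLx, hT, sub_self]
    rw [hLx z, map_sub, map_sub, h1, sub_zero]
  have key : ∀ h, 0 < h → ‖L (timeAvg h y t)‖ ≤ ‖L (timeAvg h y 0)‖ *
      Real.exp (‖c • (R ∘L T)‖ * t) := by
    intro h hh
    refine norm_le_mul_exp hΓ hU (u := fun t => L (timeAvg h y t))
      (u' := fun t => L (h⁻¹ • (y (t + h) - y t)))
      (r := fun t => -(c • R (T (L (timeAvg h y t))))) ?_ ?_ ?_ ht
    · intro s _
      exact (L.restrictScalars ℝ).hasFDerivAt.comp_hasDerivAt s (hasDerivAt_timeAvg hyc h s)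
    · intro s hs
      have h1 : (timeAvg h y s, h⁻¹ • (y (s + h) - y s) - c • T (timeAvg h y s)) ∈ Γ :=
        timeAvg_orbit_mem hc hU hΓ x hh hs
      have h2 := sub_mem h1 (hR _ _ h1)
      change (_, _) ∈ Γ
      generalize h⁻¹ • (y (s + h) - y s) = w at h2 ⊢
      rw [Prod.mk_sub_mk, ← hLx, ← hLx, map_sub L w, map_smul L c, hTL, hLx (T (L _)),
        smul_sub, sub_sub_eq_add_sub] at h2
      rw [sub_neg_eq_add]
      exact h2
    · intro s _
      rw [norm_neg]
      exact (c • (R ∘L T)).le_opNorm _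
  have hlim : ∀ s, Tendsto (fun h => ‖L (timeAvg h y s)‖) (𝓝[>] 0) (𝓝 ‖L (y s)‖) := fun s =>
    ((L.continuous.tendsto _).comp (tendsto_timeAvg hyc s)).norm
  have h1 := le_of_tendsto_of_tendsto (hlim t) ((hlim 0).mul_const _)
    (by filter_upwards [self_mem_nhdsWithin] with h hh using key h hh)
  have h0 : L (y 0) = 0 := by
    have : y 0 = x := by simp [hy, hc.zero]
    rw [this, hLx, hx, sub_self]
  rw [h0, norm_zero, zero_mul] at h1
  have h2 : L (y t) = 0 := norm_le_zero_iff.mp h1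
  have h3 : y t = U t x := by simp [hy, ht]
  rw [h3, hLx, sub_eq_zero] at h2
  exact h2.symm

end Semigroups

/-! ### The hierarchy of inequalities for the correlation errors -/

namespace MarginalSystem

variable {ι : Type*} (S : MarginalSystem ι)

/-- The average over all permutations of the slots. -/
def symmetrize (n : ℕ) : S.Space n →L[ℂ] S.Space n :=
  (n.factorial : ℂ)⁻¹ • ∑ π : Equiv.Perm (Fin n), S.perm π

theorem symmetrize_of_isSymmetric {n : ℕ} {x : S.Space n} (hx : S.IsSymmetric x) :
    S.symmetrize n x = x := by
  rw [symmetrize, smul_apply, sum_apply, Finset.sum_congr rfl fun π _ => hx π, Finset.sum_const,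
    Finset.card_univ, Fintype.card_perm, Fintype.card_fin, ← Nat.cast_smul_eq_nsmul ℂ, smul_smul,
    inv_mul_cancel₀ (by exact_mod_cast n.factorial_ne_zero), one_smul]

theorem isSymmetric_symmetrize {n : ℕ} (x : S.Space n) : S.IsSymmetric (S.symmetrize n x) := by
  intro π
  rw [symmetrize, smul_apply, map_smul, sum_apply, map_sum]
  congr 1
  simp only [← S.perm_mul_apply]
  exact Fintype.sum_equiv (Equiv.mulLeft π) _ _ fun _ => rfl

theorem symmetrize_mem_freeGraph {K₀ : S.Space 1 →ₗ.[ℂ] S.Space 1} {n : ℕ} {x y : S.Space n}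
    (hxy : (x, y) ∈ S.freeGraph K₀ n) :
    (S.symmetrize n x, S.symmetrize n y) ∈ S.freeGraph K₀ n := by
  have h := (S.freeGraph K₀ n).smul_mem (n.factorial : ℂ)⁻¹
    (Submodule.sum_mem _ fun (π : Equiv.Perm (Fin n)) (_ : π ∈ Finset.univ) =>
      S.perm_mem_freeGraph π hxy)
  convert h using 1
  refine Prod.ext ?_ ?_
  · simp [symmetrize, sum_apply, Prod.fst_sum]
  · simp [symmetrize, sum_apply, Prod.snd_sum]

theorem continuous_corrNorm {n : ℕ} {X : Type*} [TopologicalSpace X] {F : X → S.Space 1}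
    {x : X → S.Space n} (hF : Continuous F) (hx : Continuous x) (k : ℕ) :
    Continuous fun a => S.corrNorm (F a) (x a) k := by
  unfold corrNorm
  split_ifs
  · refine ((S.continuous_slots (c := fun a => S.mix (F a) (below n k)) ?_).clm_apply hx).norm
    refine continuous_pi fun i => ?_
    unfold mix
    split_ifs
    · exact continuous_const.prodMk hF.neg
    · exact continuous_const.prodMk hF
  · exact continuous_const

theorem ins_add (G H : S.Space 1) : S.ins (G + H) = S.ins G + S.ins H := by
  simp [ins]

end MarginalSystem

namespace TwoBodyPotential

variable {ι : Type*} {S : MarginalSystem ι} (P : TwoBodyPotential S)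

theorem continuous_Q {X : Type*} [TopologicalSpace X] {F G : X → S.Space 1} (hF : Continuous F)
    (hG : Continuous G) : Continuous fun x => P.Q (F x) (G x) :=
  (S.ptr 1).continuous.comp (P.V.continuous.comp
    (((S.tensor (rfl : 1 + 1 = 2)).continuous.comp hF).clm_apply hG))

theorem norm_Q_le (F G : S.Space 1) : ‖P.Q F G‖ ≤ ‖P.V‖ * (‖F‖ * ‖G‖) := by
  refine (S.norm_ptr_le _).trans ((P.V.le_opNorm _).trans ?_)
  rw [S.norm_tensor]

end TwoBodyPotential

namespace Dynamics

variable {ι : Type*} {S : MarginalSystem ι} {N : ℕ} (D : Dynamics S N)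

open MarginalSystem

theorem continuous_evol (hN : 1 ≤ N) (x : S.Space N) :
    Continuous fun t => D.evol N (max t 0) x :=
  (D.evol_c0 N hN le_rfl).continuous_apply (D.norm_evol_le N hN le_rfl) continuous_id
    continuous_const

/-- Averages of the evolution belong to the domain of its generator. -/
theorem timeAvg_evol_mem (hN : 1 ≤ N) (x : S.Space N) {h t : ℝ} (hh : 0 < h) (ht : 0 ≤ t) :
    (timeAvg h (fun t => D.evol N (max t 0) x) t,
      h⁻¹ • (D.evol N (max (t + h) 0) x - D.evol N (max t 0) x) -
        (N : ℂ)⁻¹ • D.total N (timeAvg h (fun t => D.evol N (max t 0) x) t)) ∈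
      S.freeGraph D.K₀ N :=
  timeAvg_orbit_mem (D.evol_c0 N hN le_rfl) (D.norm_evol_le N hN le_rfl)
    (D.evol_generator N hN le_rfl) x hh ht

theorem isSymmetric_evol (hN : 1 ≤ N) {x : S.Space N} (hx : S.IsSymmetric x) {t : ℝ}
    (ht : 0 ≤ t) : S.IsSymmetric (D.evol N t x) := by
  rw [← semigroup_apply_fixed (D.evol_c0 N hN le_rfl) (D.norm_evol_le N hN le_rfl)
    (D.evol_generator N hN le_rfl) (R := S.symmetrize N)
    (fun a b h => S.symmetrize_mem_freeGraph h)
    (fun z => S.symmetrize_of_isSymmetric (D.total_symm (S.isSymmetric_symmetrize z)))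
    (S.symmetrize_of_isSymmetric hx) ht]
  exact S.isSymmetric_symmetrize _

/-- The growth rate of the correlation error of order `j` for `‖V‖ = 1`, in terms of the norms `u k`
of the correlation errors of all orders. -/
def growth (N j : ℕ) (u : ℕ → ℝ) : ℝ :=
  4 * ((j : ℝ) ^ 2 / N) * (u j + 2 * u (j - 1) + u (j - 2)) + 2 * j * (2 * u j + u (j + 1)) +
    (j : ℝ) ^ 2 / N * u (j - 1) + (j : ℝ) ^ 2 / (2 * N) * u j

/-- The differential form of the hierarchy. -/
theorem marginal_mem_generator {j : ℕ} (hj : j ≤ N) (G : D.K₀.domain)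
    (f : S.Space 1) {x y : S.Space N} (hxy : (x, y - (N : ℂ)⁻¹ • D.total N x) ∈ S.freeGraph D.K₀ N) :
    (S.marginal hj (S.slots (S.fluctBelow (G : S.Space 1) j) x),
      S.marginal hj (S.slots (S.fluctBelow (G : S.Space 1) j) y - ∑ i ∈ below N j,
        S.slots (Function.update (S.fluctBelow (G : S.Space 1) j) i (S.ins (D.K₀ G + f))) x) -
      (S.marginal hj (D.drive (G : S.Space 1) f x j) - (N : ℂ)⁻¹ • D.total j
        (S.marginal hj (S.slots (S.fluctBelow (G : S.Space 1) j) x)))) ∈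
      {p : S.Space j × S.Space j | (p.1, p.2 - (N : ℂ)⁻¹ • D.total j p.1) ∈
        S.freeGraph D.K₀ j} := by
  have h1 := S.marginal_mem_freeGraph hj D.ell_K₀ (S.fluctBelow_mem_freeGraph j D.ell_K₀ G hxy)
  change (_, _) ∈ S.freeGraph D.K₀ j
  convert h1 using 2
  rw [sub_sub, sub_add_cancel, ← map_sub]
  congr 1
  rw [TwoBodyPotential.drive, map_sub, map_smul]
  simp only [ins_add, S.slots_update_add, add_apply, Finset.sum_add_distrib]
  abel

end Dynamics

theorem tendsto_apply₂ {X Y Z α : Type*} [TopologicalSpace X] [TopologicalSpace Y]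
    [TopologicalSpace Z] {f : X → Y → Z} (hf : Continuous fun p : X × Y => f p.1 p.2)
    {l : Filter α} {x : α → X} {x₀ : X} {y : α → Y} {y₀ : Y} (hx : Tendsto x l (𝓝 x₀))
    (hy : Tendsto y l (𝓝 y₀)) : Tendsto (fun a => f (x a) (y a)) l (𝓝 (f x₀ y₀)) :=
  (hf.tendsto (x₀, y₀)).comp (hx.prodMk_nhds hy)

theorem MarginalSystem.tendsto_corrNorm {ι : Type*} (S : MarginalSystem ι) {n : ℕ} {α : Type*}
    {l : Filter α} {F : α → S.Space 1} {F₀ : S.Space 1} {x : α → S.Space n} {x₀ : S.Space n}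
    (hF : Tendsto F l (𝓝 F₀)) (hx : Tendsto x l (𝓝 x₀)) (k : ℕ) :
    Tendsto (fun a => S.corrNorm (F a) (x a) k) l (𝓝 (S.corrNorm F₀ x₀ k)) :=
  tendsto_apply₂ (f := fun F x => S.corrNorm F x k)
    (S.continuous_corrNorm continuous_fst continuous_snd k) hF hx

namespace Dynamics

variable {ι : Type*} {S : MarginalSystem ι} {N : ℕ} {D : Dynamics S N}

open MarginalSystem

section MeanFieldSolution

variable {F : ℝ → S.Space 1}

theorem IsMeanFieldSolution.continuous (hF : D.IsMeanFieldSolution F) :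
    Continuous fun t => F (max t 0) :=
  hF.cont.comp_continuous (continuous_id.max continuous_const) fun _ => mem_Ici.mpr (le_max_right _ _)

theorem IsMeanFieldSolution.norm_max (hF : D.IsMeanFieldSolution F) (t : ℝ) : ‖F (max t 0)‖ = 1 :=
  hF.norm_eq _ (le_max_right _ _)

theorem IsMeanFieldSolution.ellL_max (hF : D.IsMeanFieldSolution F) (t : ℝ) :
    S.ellL 1 (F (max t 0)) = 1 := by
  rw [S.ellL_of_mem_posCone (hF.pos _ (le_max_right _ _)), hF.norm_max, Complex.ofReal_one]

theorem IsMeanFieldSolution.ellL_timeAvg (hF : D.IsMeanFieldSolution F) {h : ℝ} (hh : 0 < h)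
    (t : ℝ) : S.ellL 1 (timeAvg h (fun t => F (max t 0)) t) = 1 := by
  rw [map_timeAvg _ hF.continuous]
  simp only [hF.ellL_max]
  exact timeAvg_const hh 1 t

theorem IsMeanFieldSolution.norm_timeAvg (hF : D.IsMeanFieldSolution F) {h : ℝ} (hh : 0 < h)
    (t : ℝ) : ‖timeAvg h (fun t => F (max t 0)) t‖ = 1 := by
  refine le_antisymm (norm_timeAvg_le hh fun s _ => (hF.norm_max s).le) ?_
  have h1 := S.norm_ellL_le (timeAvg h (fun t => F (max t 0)) t)
  rwa [hF.ellL_timeAvg hh, norm_one] at h1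

theorem IsMeanFieldSolution.norm_Q_max (hF : D.IsMeanFieldSolution F) (t : ℝ) :
    ‖D.Q (F (max t 0)) (F (max t 0))‖ ≤ ‖D.V‖ := by
  simpa [hF.norm_max] using D.norm_Q_le (F (max t 0)) (F (max t 0))

theorem IsMeanFieldSolution.timeAvg_mem (hF : D.IsMeanFieldSolution F) {h t : ℝ} (hh : 0 < h)
    (ht : 0 ≤ t) :
    (timeAvg h (fun t => F (max t 0)) t, h⁻¹ • (F (max (t + h) 0) - F (max t 0)) -
      timeAvg h (fun t => D.Q (F (max t 0)) (F (max t 0))) t) ∈ D.K₀.graph := by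
  refine timeAvg_mem_generator D.free_c0 D.norm_free_le D.free_generator
    (G := fun t => F (max t 0)) (f := fun t => D.Q (F (max t 0)) (F (max t 0)))
    hF.continuous (D.continuous_Q hF.continuous hF.continuous) (fun t ht => ?_) hh ht
  simp only [max_eq_left ht, max_self]
  rw [hF.mild t ht]
  congr 1
  refine intervalIntegral.integral_congr fun s hs => ?_
  rw [uIcc_of_le ht] at hs
  simp only [max_eq_left hs.1]

end MeanFieldSolution

variable (D)

theorem norm_generator_remainder_le (hN : 1 ≤ N) {j : ℕ} (hj1 : 1 ≤ j) (hj : j ≤ N)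
    {F f : S.Space 1} (hF : ‖F‖ = 1) (hF1 : S.ellL 1 F = 1) (hf1 : S.ellL 1 f = 0)
    (hf : ‖f‖ ≤ ‖D.V‖) {x : S.Space N} (hx : S.IsSymmetric x) :
    ‖S.marginal hj (D.drive F f x j) - (N : ℂ)⁻¹ • D.total j
        (S.marginal hj (S.slots (S.fluctBelow F j) x))‖ ≤
      ‖D.V‖ * growth N j (S.corrNorm F x) +
        2 * j * ‖D.Q F F - f‖ * S.corrNorm F x (j - 1) := by
  have h1 := D.norm_marginal_drive_le hN hj (fun i r hir hi hr A =>
    D.marginal_pair j (hi.trans_lt i.2) hj1 i r hir hi hr A) hF hF1 hf1 hf hx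
  have h2 : ‖(N : ℂ)⁻¹ • D.total j (S.marginal hj (S.slots (S.fluctBelow F j) x))‖ ≤
      ‖D.V‖ * ((j : ℝ) ^ 2 / (2 * N) * S.corrNorm F x j) := by
    have h3 := D.norm_total_apply_le j (S.marginal hj (S.slots (S.fluctBelow F j) x))
    rw [S.norm_marginal_fluctBelow hj hF] at h3
    rw [norm_smul, norm_inv, Complex.norm_natCast, corrNorm, if_pos hj]
    refine (mul_le_mul_of_nonneg_left h3 (by positivity)).trans (le_of_eq ?_)
    have : (N : ℝ) ≠ 0 := by positivity
    field_simp
  refine (norm_sub_le _ _).trans ((add_le_add h1 h2).trans (le_of_eq ?_))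
  rw [growth]
  ring

theorem continuous_growth {X : Type*} [TopologicalSpace X] {u : ℕ → X → ℝ}
    (hu : ∀ k, Continuous (u k)) (N j : ℕ) : Continuous fun s => growth N j fun k => u k s := by
  unfold growth
  have h1 := hu j
  have h2 := hu (j - 1)
  have h3 := hu (j - 2)
  have h4 := hu (j + 1)
  fun_prop

theorem growth_mono (N j : ℕ) {u w : ℕ → ℝ} (h : ∀ k, u k ≤ w k) :
    growth N j u ≤ growth N j w := by
  have h1 := h j
  have h2 := h (j - 1)
  have h3 := h (j - 2)
  have h4 := h (j + 1)
  unfold growth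
  gcongr

theorem growth_nonneg (N j : ℕ) {u : ℕ → ℝ} (h : ∀ k, 0 ≤ u k) : 0 ≤ growth N j u := by
  have h1 := h j
  have h2 := h (j - 1)
  have h3 := h (j - 2)
  have h4 := h (j + 1)
  unfold growth
  positivity

/-- The norm of the correlation error of order `k` at time `t`. -/
def err (FN : S.Space N) (F : ℝ → S.Space 1) (k : ℕ) (t : ℝ) : ℝ :=
  S.corrNorm (F (max t 0)) (D.evol N (max t 0) FN) k

variable {D} {F : ℝ → S.Space 1} {FN : S.Space N}

theorem timeAvg_corrNorm_le (hN : 1 ≤ N) (hFN : S.IsState FN) (hF : D.IsMeanFieldSolution F)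
    {j : ℕ} (hj1 : 1 ≤ j) (hj : j ≤ N) {h t : ℝ} (hh : 0 < h) (ht : 0 ≤ t) :
    S.corrNorm (timeAvg h (fun t => F (max t 0)) t)
        (timeAvg h (fun t => D.evol N (max t 0) FN) t) j ≤
      S.corrNorm (timeAvg h (fun t => F (max t 0)) 0)
        (timeAvg h (fun t => D.evol N (max t 0) FN) 0) j +
      ∫ s in (0 : ℝ)..t, (‖D.V‖ * growth N j (S.corrNorm (timeAvg h (fun t => F (max t 0)) s)
          (timeAvg h (fun t => D.evol N (max t 0) FN) s)) +
        2 * j * ‖D.Q (timeAvg h (fun t => F (max t 0)) s) (timeAvg h (fun t => F (max t 0)) s) -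
          timeAvg h (fun t => D.Q (F (max t 0)) (F (max t 0))) s‖ *
          S.corrNorm (timeAvg h (fun t => F (max t 0)) s)
            (timeAvg h (fun t => D.evol N (max t 0) FN) s) (j - 1)) := by
  set G : ℝ → S.Space 1 := timeAvg h (fun t => F (max t 0)) with hG
  set x : ℝ → S.Space N := timeAvg h (fun t => D.evol N (max t 0) FN) with hx
  set f : ℝ → S.Space 1 := timeAvg h (fun t => D.Q (F (max t 0)) (F (max t 0))) with hf
  have hFc := hF.continuous
  have hxc := D.continuous_evol hN FN
  have hGc : Continuous G := continuous_timeAvg hFc h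
  have hxhc : Continuous x := continuous_timeAvg hxc h
  have hfc : Continuous f := continuous_timeAvg (D.continuous_Q hFc hFc) h
  have hG1 : ∀ s, ‖G s‖ = 1 := hF.norm_timeAvg hh
  have hmem : ∀ s, 0 ≤ s → ∃ g : D.K₀.domain, (g : S.Space 1) = G s ∧
      D.K₀ g = h⁻¹ • (F (max (s + h) 0) - F (max s 0)) - f s := fun s hs =>
    (LinearPMap.mem_graph_iff _).mp (hF.timeAvg_mem hh hs)
  have hsymm : ∀ s, S.IsSymmetric (x s) := by
    intro s π
    rw [hx, map_timeAvg _ hxc]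
    exact timeAvg_congr hh fun r _ => D.isSymmetric_evol hN hFN.symm (le_max_right _ _) π
  have hf1 : ∀ s, 0 ≤ s → S.ellL 1 (f s) = 0 := by
    intro s hs
    obtain ⟨g, _, hg⟩ := hmem s hs
    have h1 := D.ell_K₀ g
    rw [hg, map_sub, ← Complex.coe_smul, map_smul, map_sub, hF.ellL_max, hF.ellL_max, sub_self,
      smul_zero, zero_sub, neg_eq_zero] at h1
    exact h1
  have hfn : ∀ s, ‖f s‖ ≤ ‖D.V‖ := fun s => norm_timeAvg_le hh fun r _ => hF.norm_Q_max r
  have hcorr : ∀ s, S.corrNorm (G s) (x s) j =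
      ‖S.marginal hj (S.slots (S.fluctBelow (G s) j) (x s))‖ := fun s => by
    rw [S.norm_marginal_fluctBelow hj (hG1 s), corrNorm, if_pos hj]
  rw [hcorr, hcorr]
  have hu := fun k => S.continuous_corrNorm hGc hxhc k
  refine norm_le_add_integral (D.evol_generator j hj1 hj) (D.norm_evol_le j hj1 hj)
    (u := fun s => S.marginal hj (S.slots (S.fluctBelow (G s) j) (x s)))
    (u' := fun s => S.marginal hj (S.slots (S.fluctBelow (G s) j)
      (h⁻¹ • (D.evol N (max (s + h) 0) FN - D.evol N (max s 0) FN)) - ∑ i ∈ below N j,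
        S.slots (Function.update (S.fluctBelow (G s) j) i
          (S.ins (h⁻¹ • (F (max (s + h) 0) - F (max s 0))))) (x s)))
    (r := fun s => S.marginal hj (D.drive (G s) (f s) (x s) j) - (N : ℂ)⁻¹ • D.total j
        (S.marginal hj (S.slots (S.fluctBelow (G s) j) (x s)))) ?_ ?_ ?_ ?_ ht
  · intro s _
    exact ((S.marginal hj).restrictScalars ℝ).hasFDerivAt.comp_hasDerivAt s
      (S.hasDerivAt_slots_fluctBelow (hasDerivAt_timeAvg hFc h s) (hasDerivAt_timeAvg hxc h s) hj)
  · intro s hs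
    obtain ⟨g, hg, hKg⟩ := hmem s hs
    have h1 := D.marginal_mem_generator hj g (f s) (D.timeAvg_evol_mem hN FN hh hs)
    rw [hKg, sub_add_cancel, hg] at h1
    exact h1
  · exact (continuous_const.mul (continuous_growth hu N j)).add
      ((continuous_const.mul ((D.continuous_Q hGc hGc).sub hfc).norm).mul (hu (j - 1)))
  · exact fun s hs => D.norm_generator_remainder_le hN hj1 hj (hG1 s) (hF.ellL_timeAvg hh s)
      (hf1 s hs) (hfn s) (hsymm s)

theorem continuous_err (hN : 1 ≤ N) (hF : D.IsMeanFieldSolution F) (k : ℕ) :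
    Continuous (D.err FN F k) :=
  S.continuous_corrNorm hF.continuous (D.continuous_evol hN FN) k

theorem err_nonneg (k : ℕ) (t : ℝ) : 0 ≤ D.err FN F k t := S.corrNorm_nonneg _ _ _

theorem norm_evol_max_le (hN : 1 ≤ N) (hFN : S.IsState FN) (t : ℝ) :
    ‖D.evol N (max t 0) FN‖ ≤ 1 := by
  simpa [hFN.norm_eq] using
    (D.evol N (max t 0)).le_of_opNorm_le (D.norm_evol_le N hN le_rfl _ (le_max_right _ _)) FN

theorem err_le_two_pow (hN : 1 ≤ N) (hFN : S.IsState FN) (hF : D.IsMeanFieldSolution F) (k : ℕ)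
    (t : ℝ) : D.err FN F k t ≤ 2 ^ k :=
  (S.corrNorm_le (hF.norm_max t).le _ k).trans
    (mul_le_of_le_one_right (by positivity) (norm_evol_max_le hN hFN t))

theorem err_of_lt {k : ℕ} (hk : N < k) (t : ℝ) : D.err FN F k t = 0 := if_neg (not_le.mpr hk)

theorem err_le_integral (hN : 1 ≤ N) (hFN : S.IsState FN) (hF : D.IsMeanFieldSolution F)
    {j : ℕ} (hj1 : 1 ≤ j) (hj : j ≤ N) {t : ℝ} (ht : 0 ≤ t) :
    D.err FN F j t ≤ D.err FN F j 0 +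
      ∫ s in (0 : ℝ)..t, ‖D.V‖ * growth N j fun k => D.err FN F k s := by
  have hFc := hF.continuous
  have hxc := D.continuous_evol hN FN
  have hQc := D.continuous_Q hFc hFc
  have hlim : ∀ s k, Tendsto (fun h => S.corrNorm (timeAvg h (fun t => F (max t 0)) s)
      (timeAvg h (fun t => D.evol N (max t 0) FN) s) k) (𝓝[>] 0) (𝓝 (D.err FN F k s)) := by
    intro s k
    exact S.tendsto_corrNorm (tendsto_timeAvg hFc s) (tendsto_timeAvg hxc s) k
  have hpos : ∀ᶠ h : ℝ in 𝓝[>] 0, 0 < h := self_mem_nhdsWithin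
  refine le_of_tendsto_of_tendsto (hlim t j) ((hlim 0 j).add ?_)
    (by filter_upwards [hpos] with h hh using timeAvg_corrNorm_le hN hFN hF hj1 hj hh ht)
  have hbd : ∀ h, 0 < h → ∀ s k, S.corrNorm (timeAvg h (fun t => F (max t 0)) s)
      (timeAvg h (fun t => D.evol N (max t 0) FN) s) k ≤ 2 ^ k := fun h hh s k =>
    (S.corrNorm_le (hF.norm_timeAvg hh s).le _ k).trans (mul_le_of_le_one_right (by positivity)
      (norm_timeAvg_le hh fun r _ => norm_evol_max_le hN hFN r))
  refine intervalIntegral.tendsto_integral_filter_of_dominated_convergence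
    (fun _ => ‖D.V‖ * growth N j (fun k => 2 ^ k) + 2 * j * (2 * ‖D.V‖) * 2 ^ (j - 1)) ?_ ?_
    intervalIntegrable_const (Eventually.of_forall fun s _ => ?_)
  · refine Eventually.of_forall fun h => Continuous.aestronglyMeasurable ?_
    have hGc := continuous_timeAvg hFc h
    have hu := fun k => S.continuous_corrNorm hGc (continuous_timeAvg hxc h) k
    exact (continuous_const.mul (continuous_growth hu N j)).add
      ((continuous_const.mul ((D.continuous_Q hGc hGc).sub (continuous_timeAvg hQc h)).norm).mul
        (hu (j - 1)))
  · filter_upwards [hpos] with h hh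
    refine Eventually.of_forall fun s _ => ?_
    have h1 := growth_nonneg N j fun k => S.corrNorm_nonneg (timeAvg h (fun t => F (max t 0)) s)
      (timeAvg h (fun t => D.evol N (max t 0) FN) s) k
    have h2 := S.corrNorm_nonneg (timeAvg h (fun t => F (max t 0)) s)
      (timeAvg h (fun t => D.evol N (max t 0) FN) s) (j - 1)
    rw [Real.norm_of_nonneg (by positivity)]
    have h3 : ‖D.Q (timeAvg h (fun t => F (max t 0)) s) (timeAvg h (fun t => F (max t 0)) s) -
        timeAvg h (fun t => D.Q (F (max t 0)) (F (max t 0))) s‖ ≤ 2 * ‖D.V‖ := by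
      have h4 := D.norm_Q_le (timeAvg h (fun t => F (max t 0)) s)
        (timeAvg h (fun t => F (max t 0)) s)
      rw [hF.norm_timeAvg hh, mul_one, mul_one] at h4
      have h5 : ‖timeAvg h (fun t => D.Q (F (max t 0)) (F (max t 0))) s‖ ≤ ‖D.V‖ :=
        norm_timeAvg_le hh fun r _ => hF.norm_Q_max r
      exact (norm_sub_le _ _).trans (by linarith)
    have h6 := growth_mono N j (hbd h hh s)
    have h7 := hbd h hh s (j - 1)
    gcongr
  · have h1 := ((D.continuous_Q continuous_id continuous_id).tendsto (F (max s 0))).comp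
      (tendsto_timeAvg hFc s)
    have h2 := (h1.sub (tendsto_timeAvg hQc s)).norm
    simp only [id_eq, sub_self, norm_zero] at h2
    have h3 := (h2.const_mul (2 * (j : ℝ))).mul (hlim s (j - 1))
    rw [mul_zero, zero_mul] at h3
    have h4 : Continuous fun u : ℕ → ℝ => growth N j u :=
      continuous_growth (fun k => continuous_apply k) N j
    have h5 := (h4.tendsto fun k => D.err FN F k s).comp (tendsto_pi_nhds.mpr fun k => hlim s k)
    have h6 := (h5.const_mul ‖D.V‖).add h3
    rw [add_zero] at h6
    exact h6

theorem norm_E (hN : 1 ≤ N) (hFN : S.IsState FN) (hF : D.IsMeanFieldSolution F) {j : ℕ}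
    (hj : j ≤ N) {t : ℝ} (ht : 0 ≤ t) : ‖D.E FN F hj t‖ = D.err FN F j t := by
  rw [E, S.norm_correlationError hj (hF.norm_eq t ht) (D.isSymmetric_evol hN hFN.symm ht), err,
    max_eq_left ht]

end Dynamics

/-! ### Solving the hierarchy -/

theorem one_add_inv_pow_le_exp {j : ℕ} (hj : 1 ≤ j) : (1 + 1 / (j : ℝ)) ^ j ≤ Real.exp 1 := by
  have hj0 : (j : ℝ) ≠ 0 := by positivity
  calc (1 + 1 / (j : ℝ)) ^ j ≤ Real.exp (1 / j) ^ j := by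
        refine pow_le_pow_left₀ (by positivity) ?_ j
        linarith [Real.add_one_le_exp (1 / (j : ℝ))]
    _ = Real.exp 1 := by rw [← Real.exp_nat_mul, mul_one_div_cancel hj0]

theorem Dynamics.growth_le {N j : ℕ} (hj1 : 1 ≤ j) (hj : j ≤ N) {q M : ℝ} (hM : 0 ≤ M)
    (hq : 1 / √(N : ℝ) ≤ q) (hqj : q * j ≤ 2) {u : ℕ → ℝ} (hu : ∀ k, u k ≤ M * (q * k) ^ k) :
    growth N j u ≤ 44 * j * (M * (q * j) ^ j) := by
  have hN1 : (1 : ℝ) ≤ N := by exact_mod_cast hj1.trans hj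
  have hj1' : (1 : ℝ) ≤ j := by exact_mod_cast hj1
  have hj' : (j : ℝ) ≤ N := by exact_mod_cast hj
  have hs : √(N : ℝ) ^ 2 = N := Real.sq_sqrt (by linarith)
  have hs0 : 0 < √(N : ℝ) := Real.sqrt_pos.mpr (by linarith)
  have hq0 : 0 < q := lt_of_lt_of_le (by positivity) hq
  have hq2 : 1 / (N : ℝ) ≤ q ^ 2 := by
    calc 1 / (N : ℝ) = (1 / √(N : ℝ)) ^ 2 := by rw [div_pow, hs, one_pow]
      _ ≤ q ^ 2 := pow_le_pow_left₀ (by positivity) hq 2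
  have hq1 : 1 / (N : ℝ) ≤ q := by
    refine le_trans (one_div_le_one_div_of_le hs0 ?_) hq
    exact Real.sqrt_le_iff.mpr ⟨by linarith, by nlinarith⟩
  set Y : ℝ := (q * j) ^ j with hY
  have hY0 : 0 ≤ Y := by positivity
  set p : ℝ := (j : ℝ) ^ 2 / N with hp
  have hp0 : 0 ≤ p := by positivity
  have hpj : p ≤ j := by
    rw [hp, div_le_iff₀ (by linarith)]
    nlinarith
  have hpq : p ≤ j * (q * j) := by
    calc p = j * (1 / N * j) := by rw [hp]; ring
      _ ≤ j * (q * j) := by gcongr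
  have hpq2 : p ≤ j * (q * j) ^ 2 := by
    calc p = (1 / N) * (j : ℝ) ^ 2 * 1 := by rw [hp]; ring
      _ ≤ q ^ 2 * (j : ℝ) ^ 2 * j := by gcongr
      _ = j * (q * j) ^ 2 := by ring
  have ha : p * (q * (j - 1 : ℕ)) ^ (j - 1) ≤ j * Y := by
    obtain ⟨k, rfl⟩ := Nat.exists_eq_add_of_le' hj1
    calc p * (q * (k + 1 - 1 : ℕ)) ^ (k + 1 - 1)
        ≤ (k + 1 : ℕ) * (q * (k + 1 : ℕ)) * (q * (k + 1 : ℕ)) ^ k := by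
          rw [Nat.add_sub_cancel]
          gcongr
          omega
      _ = (k + 1 : ℕ) * Y := by rw [hY, pow_succ]; ring
  have hb : p * (q * (j - 2 : ℕ)) ^ (j - 2) ≤ j * Y := by
    rcases Nat.lt_or_ge j 2 with h | h
    · have hj1 : j = 1 := by omega
      subst hj1
      simpa [hY] using hpq
    · obtain ⟨k, rfl⟩ := Nat.exists_eq_add_of_le' h
      calc p * (q * (k + 2 - 2 : ℕ)) ^ (k + 2 - 2)
          ≤ (k + 2 : ℕ) * (q * (k + 2 : ℕ)) ^ 2 * (q * (k + 2 : ℕ)) ^ k := by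
            rw [Nat.add_sub_cancel]
            gcongr
            omega
        _ = (k + 2 : ℕ) * Y := by rw [hY, pow_add]; ring
  have hc : (q * (j + 1 : ℕ)) ^ (j + 1) ≤ 4 * Real.exp 1 * Y := by
    have e : q * (j + 1 : ℕ) = q * j * (1 + 1 / j) := by
      push_cast
      field_simp
    have h2 : 1 + 1 / (j : ℝ) ≤ 2 := by
      have : 1 / (j : ℝ) ≤ 1 := (div_le_one (by linarith)).mpr hj1'
      linarith
    calc (q * (j + 1 : ℕ)) ^ (j + 1) = (q * j * (1 + 1 / j)) * (1 + 1 / (j : ℝ)) ^ j * Y := by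
          rw [e, pow_succ, mul_pow (q * j), hY]; ring
      _ ≤ (2 * 2) * Real.exp 1 * Y := by
          gcongr
          exact one_add_inv_pow_le_exp hj1
      _ = 4 * Real.exp 1 * Y := by ring
  have he : Real.exp 1 ≤ 2.75 := by linarith [Real.exp_one_lt_d9]
  have hj0 : (0 : ℝ) ≤ j := by linarith
  have hMY : 0 ≤ M * Y := mul_nonneg hM hY0
  have t0 : p * u j ≤ j * (M * Y) :=
    (mul_le_mul_of_nonneg_left (hu j) hp0).trans (mul_le_mul_of_nonneg_right hpj hMY)
  have t1 : p * u (j - 1) ≤ j * (M * Y) := by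
    have := mul_le_mul_of_nonneg_left (hu (j - 1)) hp0
    have := mul_le_mul_of_nonneg_left ha hM
    linarith
  have t2 : p * u (j - 2) ≤ j * (M * Y) := by
    have := mul_le_mul_of_nonneg_left (hu (j - 2)) hp0
    have := mul_le_mul_of_nonneg_left hb hM
    linarith
  have t3 : j * u j ≤ j * (M * Y) := mul_le_mul_of_nonneg_left (hu j) hj0
  have t4 : j * u (j + 1) ≤ 11 * (j * (M * Y)) := by
    have h1 : u (j + 1) ≤ M * (4 * Real.exp 1 * Y) :=
      (hu (j + 1)).trans (mul_le_mul_of_nonneg_left hc hM)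
    have h2 := mul_le_mul_of_nonneg_right he hMY
    have h3 : u (j + 1) ≤ 11 * (M * Y) := by linarith
    have := mul_le_mul_of_nonneg_left h3 hj0
    linarith
  have e : growth N j u = 4 * (p * u j) + 8 * (p * u (j - 1)) + 4 * (p * u (j - 2)) +
      4 * (j * u j) + 2 * (j * u (j + 1)) + p * u (j - 1) + 1 / 2 * (p * u j) := by
    rw [growth, hp]
    ring
  rw [e]
  have : 0 ≤ j * (M * Y) := by positivity
  linarith

/-- A bound which can be improved by the factor `2` holds with the constant `1`. -/
theorem of_improvable {P : ℝ → Prop} (hP : ∀ M, 1 ≤ M → P M → P (max 1 (M / 2))) {M : ℝ}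
    (hM : 1 ≤ M) (h : P M) : P 1 := by
  obtain ⟨n, hn⟩ := pow_unbounded_of_one_lt M (one_lt_two : (1 : ℝ) < 2)
  replace hn := hn.le
  induction n generalizing M with
  | zero =>
    rw [pow_zero] at hn
    rwa [le_antisymm hn hM] at h
  | succ n ih =>
    refine ih (le_max_left _ _) (hP M hM h) (max_le (one_le_pow₀ one_le_two) ?_)
    rw [pow_succ] at hn
    linarith

theorem integral_le_of_le_deriv_exp {g : ℝ → ℝ} (hg : Continuous g) {b c K t : ℝ} (ht : 0 ≤ t)
    (h : ∀ s, 0 ≤ s → s ≤ t → g s ≤ K * (b * (c * Real.exp (b * s)))) :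
    ∫ s in (0 : ℝ)..t, g s ≤ K * (c * Real.exp (b * t) - c) := by
  have h1 : ∀ s, HasDerivAt (fun s => K * (c * Real.exp (b * s)))
      (K * (b * (c * Real.exp (b * s)))) s := by
    intro s
    have h2 : HasDerivAt (fun s => b * s) b s := by
      simpa using (hasDerivAt_id s).const_mul b
    exact ((h2.exp.const_mul c).const_mul K).congr_deriv (by ring)
  have h3 : Continuous fun s => K * (b * (c * Real.exp (b * s))) := by fun_prop
  have h4 := intervalIntegral.integral_eq_sub_of_hasDerivAt (fun s _ => h1 s)
    (h3.intervalIntegrable 0 t)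
  rw [mul_zero, Real.exp_zero, mul_one, ← mul_sub] at h4
  rw [← h4]
  exact intervalIntegral.integral_mono_on ht (hg.intervalIntegrable _ _) (h3.intervalIntegrable _ _)
    fun s hs => h s hs.1 hs.2

theorem add_mul_sub_le_max_mul {a b M : ℝ} (ha : 0 ≤ a) (hab : a ≤ b) :
    a + M / 2 * (b - a) ≤ max 1 (M / 2) * b := by
  have h1 : M / 2 * (b - a) ≤ max 1 (M / 2) * (b - a) :=
    mul_le_mul_of_nonneg_right (le_max_right _ _) (by linarith)
  have h2 : 1 * a ≤ max 1 (M / 2) * a := mul_le_mul_of_nonneg_right (le_max_left _ _) ha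
  linarith

/-! ### The constants -/

theorem two_mul_exp_one_le_rpow :
    2 * Real.exp 1 ≤ (2 * Real.exp 1) ^ (1 + 1 / (12 * Real.exp 1)) := by
  have h1 : 1 ≤ 2 * Real.exp 1 := by linarith [Real.exp_one_gt_d9]
  have h2 : 0 ≤ 1 / (12 * Real.exp 1) := by positivity
  calc 2 * Real.exp 1 = (2 * Real.exp 1) ^ (1 : ℝ) := (Real.rpow_one _).symm
    _ ≤ _ := Real.rpow_le_rpow_of_exponent_le h1 (by linarith)

theorem abs_log_bounds : 1 / (24 * Real.exp 1) ≤ |Real.log (1 - 1 / (24 * Real.exp 1))| ∧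
    |Real.log (1 - 1 / (24 * Real.exp 1))| ≤ 1 := by
  set x := 1 / (24 * Real.exp 1) with hx
  have hx0 : 0 < x := by positivity
  have hx1 : x ≤ 1 / 2 := by
    rw [hx]
    exact one_div_le_one_div_of_le two_pos (by linarith [Real.exp_one_gt_d9])
  have h1 := Real.log_le_sub_one_of_pos (show 0 < 1 - x by linarith)
  have h2 := Real.one_sub_inv_le_log_of_pos (show 0 < 1 - x by linarith)
  have h3 : (1 - x)⁻¹ ≤ 2 := by
    rw [inv_le_comm₀ (by linarith) two_pos]
    linarith
  rw [abs_of_neg (by linarith)]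
  constructor <;> linarith

theorem C₁_ge : 320 ≤ C₁ := by
  have h1 := abs_log_bounds
  have h2 := two_mul_exp_one_le_rpow
  have h0 : 0 < 1 / (24 * Real.exp 1) := by positivity
  rw [C₁, le_div_iff₀ (by linarith), add_comm (1 / (12 * Real.exp 1))]
  linarith [Real.exp_one_gt_d9]

theorem C₂_ge {C₀ : ℝ} (hC₀ : 1 ≤ C₀) : 80 * C₀ ≤ C₂ C₀ := by
  have h2 := two_mul_exp_one_le_rpow
  rw [C₂]
  gcongr
  linarith [Real.exp_one_gt_d9]

theorem C₁_le_C₂_sq {C₀ : ℝ} (hC₀ : 1 ≤ C₀) : C₁ ≤ 32 * C₂ C₀ ^ 2 := by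
  obtain ⟨h1, _⟩ := abs_log_bounds
  have h2 := two_mul_exp_one_le_rpow
  have h0 : 0 < 1 / (24 * Real.exp 1) := by positivity
  rw [C₁, C₂, add_comm (1 / (12 * Real.exp 1))]
  set w := (2 * Real.exp 1) ^ (1 + 1 / (12 * Real.exp 1)) with hw
  have he := Real.exp_pos 1
  have hw0 : 0 < w := by linarith
  calc 4 * (16 * w) / |Real.log (1 - 1 / (24 * Real.exp 1))|
      ≤ 4 * (16 * w) / (1 / (24 * Real.exp 1)) := by gcongr
    _ = 1536 * w * Real.exp 1 := by field_simp; norm_num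
    _ ≤ 1536 * w * w := by gcongr; linarith
    _ ≤ 8192 * (w * w) * 1 := by nlinarith
    _ ≤ 8192 * (w * w) * C₀ ^ 2 := by gcongr; exact one_le_pow₀ hC₀
    _ = 32 * (16 * w * C₀) ^ 2 := by ring

theorem one_le_B₂ {B₀ C₀ : ℝ} (hB₀ : 0 < B₀) (hC₀ : 1 ≤ C₀) : 1 ≤ B₂ B₀ C₀ := by
  have h1 := C₁_ge
  have h2 := C₁_le_C₂_sq hC₀
  have h3 : 1 / 2 ≤ 16 * C₂ C₀ ^ 2 / (C₁ - 2) := by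
    rw [le_div_iff₀ (by linarith)]
    linarith
  rw [B₂]
  linarith

theorem B₂_mul_ge {B₀ C₀ : ℝ} (hB₀ : 0 < B₀) (hC₀ : 1 ≤ C₀) :
    13 + 8.5 * B₂ B₀ C₀ + 8 * C₂ C₀ ^ 2 ≤ C₁ * B₂ B₀ C₀ := by
  have h1 := C₁_ge
  have h2 := C₂_ge hC₀
  have h3 : 16 * C₂ C₀ ^ 2 ≤ (C₁ - 2) * B₂ B₀ C₀ := by
    have : 16 * C₂ C₀ ^ 2 / (C₁ - 2) ≤ B₂ B₀ C₀ := by rw [B₂]; linarith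
    rwa [div_le_iff₀' (by linarith)] at this
  have h4 : 80 ^ 2 ≤ C₂ C₀ ^ 2 := pow_le_pow_left₀ (by norm_num) (by linarith) 2
  have h5 := one_le_B₂ hB₀ hC₀
  nlinarith

namespace Dynamics

variable {ι : Type*} {S : MarginalSystem ι} {N : ℕ} {D : Dynamics S N} {F : ℝ → S.Space 1}
  {FN : S.Space N}

theorem err_zero_le (hN : 1 ≤ N) (hFN : S.IsState FN) (hF : D.IsMeanFieldSolution F) (t : ℝ) :
    D.err FN F 0 t ≤ 1 := by
  simpa using err_le_two_pow hN hFN hF 0 t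

theorem continuous_growth_err (hN : 1 ≤ N) (hF : D.IsMeanFieldSolution F) (j : ℕ) :
    Continuous fun s => ‖D.V‖ * growth N j fun k => D.err FN F k s :=
  continuous_const.mul (continuous_growth (fun k => continuous_err hN hF k) N j)

/-- The bound on the correlation errors of all orders. -/
theorem err_le (hN : 1 ≤ N) (hFN : S.IsState FN) (hF : D.IsMeanFieldSolution F) {C₀ : ℝ}
    (hC₀ : 1 ≤ C₀)
    (h0 : ∀ j, 1 ≤ j → j ≤ N → D.err FN F j 0 ≤ C₀ ^ j * ((j : ℝ) / √(N : ℝ)) ^ j) {t : ℝ}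
    (ht : 0 ≤ t) (k : ℕ) :
    D.err FN F k t ≤ (C₂ C₀ * Real.exp (C₁ * t * ‖D.V‖)) ^ k * ((k : ℝ) / √(N : ℝ)) ^ k := by
  have hv := norm_nonneg D.V
  have hC₁ := C₁_ge
  have hC₂ : C₀ ≤ C₂ C₀ := by linarith [C₂_ge hC₀]
  have hC₂0 : 0 < C₂ C₀ := by linarith
  have hs : 1 ≤ √(N : ℝ) := Real.one_le_sqrt.mpr (by exact_mod_cast hN)
  have hs0 : 0 < √(N : ℝ) := by linarith
  set q : ℝ → ℝ := fun t => C₂ C₀ * Real.exp (C₁ * t * ‖D.V‖) / √(N : ℝ) with hq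
  have hq0 : ∀ t, 0 < q t := fun t => by positivity
  have hq1 : ∀ t, 0 ≤ t → 1 / √(N : ℝ) ≤ q t := by
    intro t ht
    have h1 : 1 ≤ Real.exp (C₁ * t * ‖D.V‖) := Real.one_le_exp (by positivity)
    have h2 : 1 * 1 ≤ C₂ C₀ * Real.exp (C₁ * t * ‖D.V‖) :=
      mul_le_mul (by linarith) h1 zero_le_one (by linarith)
    exact div_le_div_of_nonneg_right (by linarith) hs0.le
  have hqm : ∀ s t, s ≤ t → q s ≤ q t := by
    intro s t hst
    simp only [hq]
    gcongr
  have hexp : ∀ (t : ℝ) (j : ℕ), (q t * j) ^ j =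
      (C₂ C₀ / √(N : ℝ) * j) ^ j * Real.exp (j * (C₁ * ‖D.V‖) * t) := by
    intro t j
    rw [mul_assoc (j : ℝ), Real.exp_nat_mul, ← mul_pow]
    simp only [hq]
    ring_nf
  have hmain : ∀ t, 0 ≤ t → ∀ k : ℕ, D.err FN F k t ≤ 1 * (q t * k) ^ k := by
    refine of_improvable (P := fun M => ∀ t, 0 ≤ t → ∀ k : ℕ, D.err FN F k t ≤ M * (q t * k) ^ k)
      (M := (2 * √(N : ℝ)) ^ N) (fun M hM hP t ht j => ?_)
      (one_le_pow₀ (by linarith)) (fun t ht j => ?_)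
    · have hy0 : 0 ≤ (q t * j) ^ j := by have := hq0 t; positivity
      have hmax : 1 * (q t * j) ^ j ≤ max 1 (M / 2) * (q t * j) ^ j :=
        mul_le_mul_of_nonneg_right (le_max_left _ _) hy0
      rcases Nat.eq_zero_or_pos j with rfl | hj1
      · have := err_zero_le hN hFN hF t
        simp only [pow_zero, mul_one] at hmax ⊢
        linarith
      rcases lt_or_ge N j with hjN | hjN
      · rw [err_of_lt hjN]
        linarith
      rcases le_or_gt 2 (q t * j) with hb | hb
      · have h1 : (2 : ℝ) ^ j ≤ (q t * j) ^ j := pow_le_pow_left₀ zero_le_two hb j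
        linarith [err_le_two_pow hN hFN hF j t]
      · have h1 := err_le_integral hN hFN hF hj1 hjN ht
        have h2 := integral_le_of_le_deriv_exp (continuous_growth_err (FN := FN) hN hF j)
          (b := j * (C₁ * ‖D.V‖)) (c := (C₂ C₀ / √(N : ℝ) * j) ^ j) (K := M / 2) ht (by
            intro s hs0 hst
            have hqs : q s * j ≤ 2 :=
              (mul_le_mul_of_nonneg_right (hqm s t hst) (Nat.cast_nonneg j)).trans hb.le
            have h3 := growth_le hj1 hjN (by linarith) (hq1 s hs0) hqs (hP s hs0)
            rw [← hexp]
            have h4 : 0 ≤ ‖D.V‖ * (j * (M * (q s * j) ^ j)) := by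
              have := hq0 s
              positivity
            calc ‖D.V‖ * growth N j (fun k => D.err FN F k s)
                ≤ ‖D.V‖ * (44 * j * (M * (q s * j) ^ j)) := mul_le_mul_of_nonneg_left h3 hv
              _ = 44 * (‖D.V‖ * (j * (M * (q s * j) ^ j))) := by ring
              _ ≤ C₁ / 2 * (‖D.V‖ * (j * (M * (q s * j) ^ j))) :=
                mul_le_mul_of_nonneg_right (by linarith) h4
              _ = M / 2 * (j * (C₁ * ‖D.V‖) * (q s * j) ^ j) := by ring)
        rw [← hexp] at h2
        have h5 : (C₂ C₀ / √(N : ℝ) * j) ^ j = (q 0 * j) ^ j := by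
          rw [hexp, mul_zero, Real.exp_zero, mul_one]
        rw [h5] at h2
        have h6 : D.err FN F j 0 ≤ (q 0 * j) ^ j := by
          rw [← h5]
          refine (h0 j hj1 hjN).trans ?_
          rw [← mul_pow]
          refine pow_le_pow_left₀ (by positivity) ?_ j
          calc C₀ * (j / √(N : ℝ)) ≤ C₂ C₀ * (j / √(N : ℝ)) := by gcongr
            _ = C₂ C₀ / √(N : ℝ) * j := by ring
        have h7 : (q 0 * j) ^ j ≤ (q t * j) ^ j :=
          pow_le_pow_left₀ (by have := hq0 0; positivity)
            (mul_le_mul_of_nonneg_right (hqm 0 t ht) (Nat.cast_nonneg j)) j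
        have h8 : 0 ≤ (q 0 * j) ^ j := by have := hq0 0; positivity
        have h9 := add_mul_sub_le_max_mul (M := M) h8 h7
        linarith
    · have hy0 : 0 ≤ (q t * j) ^ j := by have := hq0 t; positivity
      rcases lt_or_ge N j with hjN | hjN
      · rw [err_of_lt hjN]
        positivity
      refine (err_le_two_pow hN hFN hF j t).trans ?_
      rcases Nat.eq_zero_or_pos j with rfl | hj1
      · simpa using one_le_pow₀ (n := N) (show 1 ≤ 2 * √(N : ℝ) by linarith)
      have hj1' : (1 : ℝ) ≤ j := by exact_mod_cast hj1
      calc (2 : ℝ) ^ j = (2 * √(N : ℝ)) ^ j * (1 / √(N : ℝ) * 1) ^ j := by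
            rw [← mul_pow]
            congr 1
            field_simp
        _ ≤ (2 * √(N : ℝ)) ^ N * (q t * j) ^ j := by
            have := hq1 t ht
            have := hq0 t
            gcongr
            linarith
  have h := hmain t ht k
  rw [one_mul] at h
  refine h.trans (le_of_eq ?_)
  rw [← mul_pow]
  simp only [hq]
  ring_nf

/-- The bound on the correlation error of order one. -/
theorem err_one_le (hN : 1 ≤ N) (hFN : S.IsState FN) (hF : D.IsMeanFieldSolution F) {C₀ B₀ : ℝ}
    (hC₀ : 1 ≤ C₀) (hB₀ : 0 < B₀)
    (h0 : ∀ j, 1 ≤ j → j ≤ N → D.err FN F j 0 ≤ C₀ ^ j * ((j : ℝ) / √(N : ℝ)) ^ j)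
    (h1 : D.err FN F 1 0 ≤ B₀ / N) {t : ℝ} (ht : 0 ≤ t) :
    D.err FN F 1 t ≤ B₂ B₀ C₀ / N * Real.exp (B₁ * ‖D.V‖ * t) := by
  have hv := norm_nonneg D.V
  have hC₁ := C₁_ge
  have hC₂ := C₂_ge hC₀
  have hB₂ := one_le_B₂ hB₀ hC₀
  have hN1 : (1 : ℝ) ≤ N := by exact_mod_cast hN
  have hs : √(N : ℝ) ^ 2 = N := Real.sq_sqrt (by linarith)
  have hB₁ : B₁ = 2 * C₁ := rfl
  have hE1 : ∀ t, 0 ≤ t → 1 ≤ Real.exp (B₁ * ‖D.V‖ * t) := fun t ht =>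
    Real.one_le_exp (mul_nonneg (mul_nonneg (by linarith) hv) ht)
  have h2 : ∀ t, 0 ≤ t → D.err FN F 2 t ≤ 4 * C₂ C₀ ^ 2 / N * Real.exp (B₁ * ‖D.V‖ * t) := by
    intro t ht
    refine (err_le hN hFN hF hC₀ h0 ht 2).trans (le_of_eq ?_)
    have e : B₁ * ‖D.V‖ * t = (2 : ℕ) * (C₁ * t * ‖D.V‖) := by rw [hB₁]; push_cast; ring
    rw [e, Real.exp_nat_mul, div_pow, hs]
    push_cast
    ring
  have hc : 0 ≤ B₂ B₀ C₀ / N := by positivity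
  have hmain : ∀ t, 0 ≤ t → D.err FN F 1 t ≤
      1 * (B₂ B₀ C₀ / N * Real.exp (B₁ * ‖D.V‖ * t)) := by
    refine of_improvable (P := fun M => ∀ t, 0 ≤ t → D.err FN F 1 t ≤
      M * (B₂ B₀ C₀ / N * Real.exp (B₁ * ‖D.V‖ * t))) (M := 2 * N) (fun M hM hP t ht => ?_)
      (by linarith) (fun t ht => ?_)
    · have h3 := err_le_integral hN hFN hF le_rfl hN ht
      have h4 := integral_le_of_le_deriv_exp (continuous_growth_err (FN := FN) hN hF 1)
        (b := B₁ * ‖D.V‖) (c := B₂ B₀ C₀ / N) (K := M / 2) ht (by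
          intro s hs0 _
          have g0 := err_zero_le hN hFN hF s
          have g1 := hP s hs0
          have g2 := h2 s hs0
          have gE := hE1 s hs0
          set E := Real.exp (B₁ * ‖D.V‖ * s) with hE
          have gn := err_nonneg (D := D) (F := F) (FN := FN) 1 s
          have hN' : 0 < 1 / (N : ℝ) := by positivity
          have hN2 : 1 / (N : ℝ) ≤ 1 := (div_le_one (by linarith)).mpr hN1
          have e1 : growth N 1 (fun k => D.err FN F k s) =
              13 * (1 / N * D.err FN F 0 s) + 4.5 * (1 / N * D.err FN F 1 s) +
                4 * D.err FN F 1 s + 2 * D.err FN F 2 s := by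
            simp only [growth, Nat.cast_one, Nat.reduceAdd, one_pow,
              show 1 - 2 = 0 from rfl]
            ring
          have e2 : 1 / N * D.err FN F 0 s ≤ 1 / N * E := by gcongr; linarith
          have e3 : 1 / N * D.err FN F 1 s ≤ 1 * D.err FN F 1 s := by gcongr
          have e4 : growth N 1 (fun k => D.err FN F k s) ≤
              M * (13 + 8.5 * B₂ B₀ C₀ + 8 * C₂ C₀ ^ 2) * (1 / N * E) := by
            have a0 : 0 ≤ 1 / N * E := by positivity
            have a1 : 1 * (1 / N * E) ≤ M * (1 / N * E) := by gcongr
            have a2 : 1 * (C₂ C₀ ^ 2 * (1 / N * E)) ≤ M * (C₂ C₀ ^ 2 * (1 / N * E)) := by gcongr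
            have a3 : D.err FN F 1 s ≤ M * (B₂ B₀ C₀ * (1 / N * E)) := by
              refine g1.trans (le_of_eq ?_); ring
            have a4 : D.err FN F 2 s ≤ 4 * (C₂ C₀ ^ 2 * (1 / N * E)) := by
              refine g2.trans (le_of_eq ?_); ring
            rw [e1]
            linarith
          calc ‖D.V‖ * growth N 1 (fun k => D.err FN F k s)
              ≤ ‖D.V‖ * (M * (C₁ * B₂ B₀ C₀) * (1 / N * E)) := by
                refine mul_le_mul_of_nonneg_left (e4.trans ?_) hv
                gcongr
                exact B₂_mul_ge hB₀ hC₀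
            _ = M / 2 * (B₁ * ‖D.V‖ * (B₂ B₀ C₀ / N * E)) := by rw [hB₁]; ring)
      have h5 : D.err FN F 1 0 ≤ B₂ B₀ C₀ / N := by
        refine h1.trans ?_
        gcongr
        have : 0 ≤ 16 * C₂ C₀ ^ 2 / (C₁ - 2) := div_nonneg (by positivity) (by linarith)
        rw [B₂]
        linarith
      have h6 := add_mul_sub_le_max_mul (M := M) hc (le_mul_of_one_le_right hc (hE1 t ht))
      linarith
    · have h3 := err_le_two_pow hN hFN hF 1 t
      have h4 : 1 * 1 ≤ B₂ B₀ C₀ * Real.exp (B₁ * ‖D.V‖ * t) :=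
        mul_le_mul hB₂ (hE1 t ht) zero_le_one (by linarith)
      have e : 2 * N * (B₂ B₀ C₀ / N * Real.exp (B₁ * ‖D.V‖ * t)) =
          2 * (B₂ B₀ C₀ * Real.exp (B₁ * ‖D.V‖ * t)) := by
        field_simp
      rw [e]
      linarith
  simpa using hmain t ht

end Dynamics

end MeanField

end

theorem mainTheorem1 {ι : Type*} [Countable ι] (S : MeanField.MarginalSystem ι)
    (N : ℕ) (hN : 1 ≤ N) (D : MeanField.Dynamics S N)
    (FN : S.Space N) (hFN : S.IsState FN)
    (F : ℝ → S.Space 1) (hF : D.IsMeanFieldSolution F)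
    (C₀ : ℝ) (hC₀ : 1 ≤ C₀)
    (h0 : ∀ (j : ℕ) (hj : j ≤ N), 1 ≤ j →
      ‖D.E FN F hj 0‖ ≤ C₀ ^ j * ((j : ℝ) / √(N : ℝ)) ^ j) :
    (0 ≤ MeanField.C₁ ∧ 1 ≤ MeanField.C₂ C₀ ∧
      ∀ t : ℝ, 0 < t → ∀ (j : ℕ) (hj : j ≤ N), 1 ≤ j →
        ‖D.E FN F hj t‖ ≤
          (MeanField.C₂ C₀ * Real.exp (MeanField.C₁ * t * ‖D.V‖)) ^ j *
            ((j : ℝ) / √(N : ℝ)) ^ j) ∧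
    (∀ B₀ : ℝ, 0 < B₀ → ‖D.E FN F hN 0‖ ≤ B₀ / N →
      0 < MeanField.B₁ ∧ 1 ≤ MeanField.B₂ B₀ C₀ ∧
      ∀ t : ℝ, 0 < t →
        ‖D.E FN F hN t‖ ≤
          1 / N * (MeanField.B₂ B₀ C₀ * Real.exp (MeanField.B₁ * t * ‖D.V‖))) := by
  have hE : ∀ {t : ℝ}, 0 ≤ t → ∀ {j : ℕ} (hj : j ≤ N), ‖D.E FN F hj t‖ = D.err FN F j t :=
    fun ht _ hj => MeanField.Dynamics.norm_E hN hFN hF hj ht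
  have h0' : ∀ j, 1 ≤ j → j ≤ N → D.err FN F j 0 ≤ C₀ ^ j * ((j : ℝ) / √(N : ℝ)) ^ j :=
    fun j hj1 hj => hE le_rfl hj ▸ h0 j hj hj1
  have hC₁ := MeanField.C₁_ge
  refine ⟨⟨by linarith, by linarith [MeanField.C₂_ge hC₀], fun t ht j hj _ => ?_⟩,
    fun B₀ hB₀ h1 => ⟨?_, MeanField.one_le_B₂ hB₀ hC₀, fun t ht => ?_⟩⟩
  · rw [hE ht.le]
    exact MeanField.Dynamics.err_le hN hFN hF hC₀ h0' ht.le j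
  · rw [MeanField.B₁]
    linarith
  · rw [hE le_rfl] at h1
    rw [hE ht.le]
    refine (MeanField.Dynamics.err_one_le hN hFN hF hC₀ hB₀ h0' h1 ht.le).trans (le_of_eq ?_)
    rw [mul_right_comm MeanField.B₁]
    ring
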